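/- Let $d,w\ge 0$ be integers. A vector $(r_1,\dots,r_w)\in\mathbb Z^w$ is called a positive $A_w$-root if there are $1\le a\le b\le w$ with $r_i=1$ for $a\le i\le b$ and $r_i=0$ for all other $i$. A $d\times w$ integer matrix $A=(a_{ij})$ is called quasi-basic if every row of $A$ is a positive $A_w$-root and no column of $A$ is zero. For a quasi-basic matrix $A$ and $(c_1,\dots,c_w)\in\mathbb Z^w$ such that $\sum_{i=1}^d a_{ij}n_i+c_j\neq 0$ for all $1\le j\le w$ and all integers $n_1,\dots,n_d\ge 1$, consider the generalized big zeta value of weight $w$ and depth $d$ $$Z(A\,|\,c_1,\dots,c_w)=\sum_{n_1,\dots,n_d\ge 1}\ \frac{1}{\prod_{j=1}^{w}\left(\sum_{i=1}^{d}a_{ij}n_i+c_j\right)} .$$ (All the terms of this series are positive.) **Theorem.** If the series $Z(A\,|\,c_1,\dots,c_w)$ converges, then its value is a $\mathbb Q$-linear combination of multiple zeta values $$\zeta(k_1,\dots,k_r)=\sum_{0<n_1<\cdots<n_r}\frac1{n_1^{k_1}\cdots n_r^{k_r}},\qquad k_1,\dots,k_{r-1}\ge 1,\ k_r\ge 2,$$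 of weight $k_1+\cdots+k_r\le w$ and depth $r\le d$, where the number $1$ counts as the multiple zeta value of weight $0$ and depth $0$ (the case $r=0$). -/

import Mathlib

/-- A vector `r` of length `w` is a positive `A_w`-root: there are `a ≤ b` such that `r i = 1` for
`a ≤ i ≤ b` and `r i = 0` otherwise. -/
def IsPositiveRoot {w : ℕ} (r : Fin w → ℤ) : Prop :=
  ∃ a b : Fin w, a ≤ b ∧ ∀ i, r i = if a ≤ i ∧ i ≤ b then 1 else 0

/-- A `d × w` matrix is quasi-basic if all its rows are positive `A_w`-roots and it has no zero
column. -/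
structure IsQuasiBasic {d w : ℕ} (A : Matrix (Fin d) (Fin w) ℤ) : Prop where
  rows : ∀ i, IsPositiveRoot (A i)
  no_zero_column : ∀ j, ∃ i, A i j ≠ 0

/-- The linear form `∑ i, a_{ij} n_i + c_j` attached to column `j`, at a point `n` with positive
integer coordinates. -/
def columnForm {d w : ℕ} (A : Matrix (Fin d) (Fin w) ℤ) (c : Fin w → ℤ) (n : Fin d → ℕ+)
    (j : Fin w) : ℤ :=
  ∑ i, A i j * (n i : ℤ) + c j

/-- The general term of the series `Z(A | c_1, …, c_w)`. -/
noncomputable def bigZetaTerm {d w : ℕ} (A : Matrix (Fin d) (Fin w) ℤ) (c : Fin w → ℤ)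
    (n : Fin d → ℕ+) : ℝ :=
  1 / ∏ j, (columnForm A c n j : ℝ)

/-- The generalized big zeta value `Z(A | c_1, …, c_w)`, of weight `w` and depth `d`. -/
noncomputable def bigZeta {d w : ℕ} (A : Matrix (Fin d) (Fin w) ℤ) (c : Fin w → ℤ) : ℝ :=
  ∑' n : Fin d → ℕ+, bigZetaTerm A c n

/-- Indices `(k_1, …, k_r)` of convergent multiple zeta values: all `k_i ≥ 1`, and the last one
is at least `2`. The empty index is admissible. -/
def IsAdmissible {r : ℕ} (k : Fin r → ℕ) : Prop :=
  (∀ i, 1 ≤ k i) ∧ ∀ i : Fin r, (i : ℕ) + 1 = r → 2 ≤ k i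

/-- `ζ(k_1, …, k_r) = ∑_{0 < n_1 < ⋯ < n_r} 1 / (n_1^{k_1} ⋯ n_r^{k_r})`. For `r = 0` the sum has
exactly one term, equal to `1`. -/
noncomputable def multiZeta {r : ℕ} (k : Fin r → ℕ) : ℝ :=
  ∑' n : {n : Fin r → ℕ // (∀ i, 0 < n i) ∧ StrictMono n}, 1 / ∏ i, (n.1 i : ℝ) ^ k i

/-- The `ℚ`-linear combinations of multiple zeta values of weight at most `w` and depth at
most `d`. -/
noncomputable def multiZetaSpan (w d : ℕ) : Submodule ℚ ℝ :=
  Submodule.span ℚ {x | ∃ (r : ℕ) (k : Fin r → ℕ),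
    IsAdmissible k ∧ ∑ i, k i ≤ w ∧ r ≤ d ∧ x = multiZeta k}

/-! The entries of a row are consecutive ones, so the columns can be processed from left to right: a
row becomes active at its first nonzero column, stays active up to its last one, and never returns.
Encode a partial summand as an array of coefficients, that is, a power series in variables `X_i`.
Activating row `i` multiplies by `X_i / (1 - X_i)`. A column divides each coefficient by its total
degree plus `c_k`, because the form of the column is the sum of the active exponents plus `c_k`.
When row `i` ends, its exponent is summed over, which is the specialization `X_i = 1`. After all
columns only a number remains. Each column costs one unit of weight and each row one unit of depth
(`PartialSum.start`, `PartialSum.column`, `PartialSum.finish`).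

The difficulty is that specialization must keep the array in `wordModule`, the span of words in
these operations with multiple zeta values as coefficients, without raising weight or depth.
Homogenize by `X_s = Y` and `X_t ↦ X_t Y` for `t ≠ s` (`hat`): division by the degree becomes `(θ_Y
+ c)⁻¹`, an integration in `Y`. One proves by induction on words that every homogenized word has an
expansion at `Y = 1` in powers of `1 - Y` and `log (1 - Y)` whose coefficient arrays lie in
`wordModule` (`hat_evalWord_mem_expandingFamily`). By Abel's theorem and uniqueness of expansions
the specialization is then in the same module (`sumOver_mem_wordModule`).

The only hard step of that induction is the constant of integration `K`, itself an array in the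
other variables. Each single entry `K x` is a combination of multiple zeta values by the
one-variable theory: polylogarithms with poles at `1` are stable under all `(θ + c)⁻¹`
(`divOp_mem_polarClass`), and shuffle regularization gives their expansions at `1`
(`polylog_mem_expanding`). That the entries together form an array of the right kind comes from a
first-order differential equation in the other variables, modulo words of smaller weight, which
determines `K` up to finitely many entries (`constant_mem_wordModule`). A word has such an equation
unless multiplications by `1 / (1 - X_s)` and `1 / (1 - X_t)` are adjacent; then partial fractions
in `Y` reduce its depth (`reducible_or_eq`). -/

namespace BigZeta

open Filter Asymptotics Topology

/-! ### Asymptotic expansions at `1` with coefficients in a `ℚ`-module of arrays -/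

/-- `-log (1 - y)`, the logarithmic singularity at `y = 1`. -/
noncomputable def logSing (y : ℝ) : ℝ := -Real.log (1 - y)

lemma eventually_mem_Ioo : ∀ᶠ y in 𝓝[<] (1 : ℝ), y ∈ Set.Ioo (0 : ℝ) 1 :=
  Ioo_mem_nhdsLT one_pos

lemma tendsto_one_sub : Tendsto (fun y : ℝ => 1 - y) (𝓝[<] 1) (𝓝[>] 0) := by
  apply tendsto_nhdsWithin_of_tendsto_nhds_of_eventually_within
  · have : Tendsto (fun y : ℝ => 1 - y) (𝓝 1) (𝓝 (1 - 1)) :=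
      (continuous_const.sub continuous_id).tendsto 1
    rw [sub_self] at this
    exact this.mono_left nhdsWithin_le_nhds
  · filter_upwards [eventually_mem_Ioo] with y hy
    simpa using hy.2

lemma tendsto_logSing : Tendsto logSing (𝓝[<] 1) atTop :=
  tendsto_neg_atBot_atTop.comp (Real.tendsto_log_nhdsGT_zero.comp tendsto_one_sub)

lemma exp_neg_logSing {y : ℝ} (hy : y < 1) : Real.exp (-logSing y) = 1 - y := by
  rw [logSing, neg_neg, Real.exp_log (by linarith)]

lemma isBigO_zpow_of_le {j k : ℤ} (h : k ≤ j) :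
    (fun y : ℝ => (1 - y) ^ j) =O[𝓝[<] 1] fun y => (1 - y) ^ k := by
  refine IsBigO.of_bound 1 ?_
  filter_upwards [eventually_mem_Ioo] with y hy
  have h0 : 0 < 1 - y := by linarith [hy.2]
  rw [one_mul, Real.norm_of_nonneg (zpow_nonneg h0.le _), Real.norm_of_nonneg (zpow_nonneg h0.le _)]
  exact zpow_le_zpow_right_of_le_one₀ h0 (by linarith [hy.1]) h

/-- With `t = -log (1 - y)` this is `t ^ n * exp (-t) → 0`. -/
lemma tendsto_one_sub_mul_logSing_pow (n : ℕ) :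
    Tendsto (fun y => (1 - y) * logSing y ^ n) (𝓝[<] 1) (𝓝 0) := by
  have := (Real.tendsto_pow_mul_exp_neg_atTop_nhds_zero n).comp tendsto_logSing
  refine this.congr' ?_
  filter_upwards [eventually_mem_Ioo] with y hy
  simp only [Function.comp, exp_neg_logSing hy.2, mul_comm]

lemma isBigO_zpow_mul_logSing (j k : ℤ) (n : ℕ) (h : k < j) :
    (fun y : ℝ => (1 - y) ^ j * logSing y ^ n) =O[𝓝[<] 1] fun y => (1 - y) ^ k := by
  have h1 : (fun y : ℝ => (1 - y) * logSing y ^ n) =O[𝓝[<] 1] fun _ => (1 : ℝ) :=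
    (tendsto_one_sub_mul_logSing_pow n).isBigO_one ℝ
  have h2 := (isBigO_zpow_of_le (j := j - 1) (k := k) (by omega)).mul h1
  refine (h2.congr' ?_ ?_)
  · filter_upwards [eventually_mem_Ioo] with y hy
    have h0 : 1 - y ≠ 0 := by linarith [hy.2]
    rw [zpow_sub_one₀ h0]; field_simp
  · exact Eventually.of_forall fun y => by simp

variable {κ κ' : Type*}

/-- Finite sums of `(1 - y) ^ j * (-log (1 - y)) ^ i * v` with `v ∈ V`. -/
noncomputable def logLaurent (V : Submodule ℚ (κ → ℝ)) : Submodule ℚ (ℝ → κ → ℝ) :=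
  Submodule.span ℚ {f | ∃ (j : ℤ) (i : ℕ) (v : κ → ℝ), v ∈ V ∧
    f = fun y x => (1 - y) ^ j * logSing y ^ i * v x}

/-- Families of functions with an asymptotic expansion at `y = 1` to every order, in powers of
`1 - y` and `log (1 - y)`, with coefficients in `V`. -/
noncomputable def expansible (V : Submodule ℚ (κ → ℝ)) : Submodule ℚ (ℝ → κ → ℝ) where
  carrier := {a | ∀ J : ℕ, ∃ p ∈ logLaurent V, ∀ x,
    (fun y => a y x - p y x) =O[𝓝[<] (1 : ℝ)] fun y => (1 - y) ^ (J : ℤ)}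
  zero_mem' := fun J => ⟨0, zero_mem _, fun x => by simpa using isBigO_zero _ _⟩
  add_mem' := by
    intro a b ha hb J
    obtain ⟨p, hp, hp'⟩ := ha J
    obtain ⟨q, hq, hq'⟩ := hb J
    refine ⟨p + q, add_mem hp hq, fun x => ?_⟩
    refine ((hp' x).add (hq' x)).congr_left fun y => ?_
    simp only [Pi.add_apply]; ring
  smul_mem' := by
    intro c a ha J
    obtain ⟨p, hp, hp'⟩ := ha J
    refine ⟨c • p, Submodule.smul_mem _ _ hp, fun x => ?_⟩
    refine ((hp' x).const_mul_left (c : ℝ)).congr_left fun y => ?_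
    simp only [Pi.smul_apply, Rat.smul_def]; ring

variable {V W : Submodule ℚ (κ → ℝ)} {a b : ℝ → κ → ℝ}

lemma term_mem_logLaurent (j : ℤ) (i : ℕ) {v : κ → ℝ} (hv : v ∈ V) :
    (fun (y : ℝ) x => (1 - y) ^ j * logSing y ^ i * v x) ∈ logLaurent V :=
  Submodule.subset_span ⟨j, i, v, hv, rfl⟩

lemma logLaurent_mono (h : V ≤ W) : logLaurent V ≤ logLaurent W := by
  refine Submodule.span_mono ?_
  rintro f ⟨j, i, v, hv, rfl⟩
  exact ⟨j, i, v, h hv, rfl⟩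

lemma expansible_mono (h : V ≤ W) : expansible V ≤ expansible W := by
  intro a ha J
  obtain ⟨p, hp, hp'⟩ := ha J
  exact ⟨p, logLaurent_mono h hp, hp'⟩

lemma logLaurent_le_expansible : logLaurent V ≤ expansible V := by
  intro a ha J
  exact ⟨a, ha, fun x => by simpa using isBigO_zero _ _⟩

/-- Expansions can be built order by order: the approximating family may depend on the order `J`. -/
lemma expansible_of_approx
    (h : ∀ J : ℕ, ∃ a ∈ expansible V, ∀ x,
      (fun y => b y x - a y x) =O[𝓝[<] (1 : ℝ)] fun y => (1 - y) ^ (J : ℤ)) :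
    b ∈ expansible V := by
  intro J
  obtain ⟨a, ha, hab⟩ := h J
  obtain ⟨p, hp, hp'⟩ := ha J
  exact ⟨p, hp, fun x => ((hab x).add (hp' x)).congr_left fun y => by ring⟩

lemma expansible_congr (h : ∀ x, (fun y => a y x) =ᶠ[𝓝[<] (1 : ℝ)] fun y => b y x)
    (ha : a ∈ expansible V) : b ∈ expansible V :=
  expansible_of_approx fun J => ⟨a, ha, fun x => by
    refine (isBigO_zero (fun y : ℝ => (1 - y) ^ (J : ℤ)) (𝓝[<] (1 : ℝ))).congr' ?_
      EventuallyEq.rfl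
    filter_upwards [h x] with y hy
    rw [hy, sub_self]⟩

lemma const_mem_expansible {v : κ → ℝ} (hv : v ∈ V) : (fun _ => v) ∈ expansible V := by
  apply logLaurent_le_expansible
  simpa using term_mem_logLaurent 0 0 hv

/-- Multiplication by a function that preserves the Laurent-logarithmic sums and is bounded by
`(1 - y) ^ (-N)`. -/
lemma expansible_mul_of {φ : ℝ → ℝ} (N : ℕ)
    (hφ : φ =O[𝓝[<] (1 : ℝ)] fun y => (1 - y) ^ (-(N : ℤ)))
    (hp : ∀ (j : ℤ) (i : ℕ) (v : κ → ℝ), v ∈ V →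
      (fun (y : ℝ) x => φ y * ((1 - y) ^ j * logSing y ^ i * v x)) ∈ logLaurent V)
    (ha : a ∈ expansible V) : (fun y x => φ y * a y x) ∈ expansible V := by
  intro J
  obtain ⟨p, hp1, hp2⟩ := ha (J + N)
  refine ⟨fun y x => φ y * p y x, ?_, fun x => ?_⟩
  · clear hp2
    induction hp1 using Submodule.span_induction with
    | mem f hf => obtain ⟨j, i, v, hv, rfl⟩ := hf; exact hp j i v hv
    | zero => convert zero_mem (logLaurent V) using 1; ext; simp
    | add f g _ _ h1 h2 => convert add_mem h1 h2 using 1; ext; simp [mul_add]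
    | smul c f _ h1 =>
      convert Submodule.smul_mem _ c h1 using 1; ext
      simp only [Pi.smul_apply, Rat.smul_def]; ring
  · refine (hφ.mul (hp2 x)).congr' (Eventually.of_forall fun y => by ring) ?_
    filter_upwards [eventually_mem_Ioo] with y hy
    have h0 : 1 - y ≠ 0 := by linarith [hy.2]
    rw [← zpow_add₀ h0]; congr 1; push_cast; ring

lemma expansible_zpow_mul (k : ℤ) (ha : a ∈ expansible V) :
    (fun (y : ℝ) x => (1 - y) ^ k * a y x) ∈ expansible V := by
  -- on `y = 1` the exponents do not add, but only `y < 1` matters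
  intro J
  -- Multiplication by `(1 - y) ^ k` can lose `|k|` orders, so `a` is expanded that much further.
  obtain ⟨p, hp1, hp2⟩ := ha (J + k.natAbs)
  have key : ∃ q ∈ logLaurent V, ∀ x, ∀ᶠ y in 𝓝[<] (1 : ℝ), q y x = (1 - y) ^ k * p y x := by
    clear hp2
    induction hp1 using Submodule.span_induction with
    | mem f hf =>
      obtain ⟨j, i, v, hv, rfl⟩ := hf
      refine ⟨_, term_mem_logLaurent (k + j) i hv, fun x => ?_⟩
      filter_upwards [eventually_mem_Ioo] with y hy
      have h0 : 1 - y ≠ 0 := by linarith [hy.2]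
      rw [zpow_add₀ h0]; ring
    | zero => exact ⟨0, zero_mem _, fun x => by simp⟩
    | add f g _ _ h1 h2 =>
      obtain ⟨q, hq, hq'⟩ := h1
      obtain ⟨r, hr, hr'⟩ := h2
      refine ⟨q + r, add_mem hq hr, fun x => ?_⟩
      filter_upwards [hq' x, hr' x] with y h1 h2
      simp only [Pi.add_apply, h1, h2]; ring
    | smul c f _ h1 =>
      obtain ⟨q, hq, hq'⟩ := h1
      refine ⟨c • q, Submodule.smul_mem _ _ hq, fun x => ?_⟩
      filter_upwards [hq' x] with y h1
      simp only [Pi.smul_apply, Rat.smul_def, h1]; ring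
  obtain ⟨q, hq, hq'⟩ := key
  refine ⟨q, hq, fun x => ?_⟩
  have h1 := ((isBigO_refl (fun y : ℝ => (1 - y) ^ k) (𝓝[<] 1)).mul (hp2 x))
  have h2 : (fun y : ℝ => (1 - y) ^ k * (1 - y) ^ ((J + k.natAbs : ℕ) : ℤ)) =O[𝓝[<] 1]
      fun y => (1 - y) ^ (J : ℤ) := by
    refine (isBigO_zpow_of_le (j := k + ((J + k.natAbs : ℕ) : ℤ)) (k := J)
      (by push_cast; have := neg_abs_le k; omega)).congr' ?_ EventuallyEq.rfl
    filter_upwards [eventually_mem_Ioo] with y hy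
    have h0 : 1 - y ≠ 0 := by linarith [hy.2]
    rw [zpow_add₀ h0]
  refine (h1.trans h2).congr' ?_ EventuallyEq.rfl
  filter_upwards [hq' x] with y h
  rw [h]; ring

lemma expansible_logSing_mul (ha : a ∈ expansible V) :
    (fun (y : ℝ) x => logSing y * a y x) ∈ expansible V := by
  refine expansible_mul_of 1 ?_ ?_ ha
  · refine (isBigO_zpow_mul_logSing 0 (-1) 1 (by norm_num)).congr_left fun y => by simp
  · intro j i v hv
    convert term_mem_logLaurent j (i + 1) hv using 3
    ring

lemma logLaurent_bound {p : ℝ → κ → ℝ} (hp : p ∈ logLaurent V) :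
    ∃ B : ℕ, ∀ x, (fun y => p y x) =O[𝓝[<] (1 : ℝ)] fun y => (1 - y) ^ (-(B : ℤ)) := by
  induction hp using Submodule.span_induction with
  | mem f hf =>
    obtain ⟨j, i, v, hv, rfl⟩ := hf
    refine ⟨j.natAbs + 1, fun x => ?_⟩
    refine ((isBigO_zpow_mul_logSing j (-((j.natAbs + 1 : ℕ) : ℤ)) i
      (by push_cast; have := neg_abs_le j; omega)).const_mul_left (v x)).congr_left
      fun y => by ring
  | zero => exact ⟨0, fun x => isBigO_zero _ _⟩
  | add f g _ _ h1 h2 =>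
    obtain ⟨B, hB⟩ := h1
    obtain ⟨C, hC⟩ := h2
    refine ⟨max B C, fun x => ?_⟩
    refine ((hB x).trans (isBigO_zpow_of_le ?_)).add ((hC x).trans (isBigO_zpow_of_le ?_))
    · push_cast; omega
    · push_cast; omega
  | smul c f _ h1 =>
    obtain ⟨B, hB⟩ := h1
    exact ⟨B, fun x => ((hB x).const_mul_left (c : ℝ)).congr_left fun y => by
      simp [Rat.smul_def]⟩

/-- The exponent `B` is the same for all coordinates, since one finite sum serves them all. It tells
in advance how far an auxiliary expansion must be pushed. -/
lemma expansible_bound (ha : a ∈ expansible V) :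
    ∃ B : ℕ, ∀ x, (fun y => a y x) =O[𝓝[<] (1 : ℝ)] fun y => (1 - y) ^ (-(B : ℤ)) := by
  obtain ⟨p, hp, hp'⟩ := ha 0
  obtain ⟨B, hB⟩ := logLaurent_bound hp
  refine ⟨B, fun x => ?_⟩
  refine (((hp' x).trans (isBigO_zpow_of_le (k := -(B : ℤ)) ?_)).add (hB x)).congr_left
    fun y => by ring
  push_cast; omega

/-- A map between function spaces each of whose output coordinates is a finite linear combination
of input coordinates. -/
def FiniteRows (T : (κ → ℝ) → κ' → ℝ) : Prop :=
  ∀ x', ∃ (s : Finset κ) (c : κ → ℝ), ∀ f, T f x' = ∑ x ∈ s, c x * f x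

lemma FiniteRows.map_add {T : (κ → ℝ) → κ' → ℝ} (hT : FiniteRows T) (f g : κ → ℝ) :
    T (f + g) = T f + T g := by
  ext x
  obtain ⟨s, c, h⟩ := hT x
  simp [h, mul_add, Finset.sum_add_distrib]

lemma FiniteRows.map_smul {T : (κ → ℝ) → κ' → ℝ} (hT : FiniteRows T) (r : ℝ) (f : κ → ℝ) :
    T (r • f) = r • T f := by
  ext x
  obtain ⟨s, c, h⟩ := hT x
  simp only [h, Pi.smul_apply, smul_eq_mul, Finset.mul_sum]
  exact Finset.sum_congr rfl fun _ _ => by ring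

/-- The error bounds hold for each coordinate separately, so only finite combinations of coordinates
can be controlled; this is the role of `FiniteRows`. -/
lemma expansible_map {T : (κ → ℝ) → κ' → ℝ} (hT : FiniteRows T) {W : Submodule ℚ (κ' → ℝ)}
    (hVW : ∀ v ∈ V, T v ∈ W) (ha : a ∈ expansible V) : (fun y => T (a y)) ∈ expansible W := by
  intro J
  obtain ⟨p, hp1, hp2⟩ := ha J
  refine ⟨fun y => T (p y), ?_, fun x => ?_⟩
  · clear hp2
    induction hp1 using Submodule.span_induction with
    | mem f hf =>
      obtain ⟨j, i, v, hv, rfl⟩ := hf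
      convert term_mem_logLaurent j i (hVW v hv) using 2 with y
      exact hT.map_smul ((1 - y) ^ j * logSing y ^ i) v
    | zero =>
      convert zero_mem (logLaurent W) using 2 with y
      have := hT.map_smul 0 0
      simpa using this
    | add f g _ _ h1 h2 => convert add_mem h1 h2 using 2 with y; exact hT.map_add _ _
    | smul c f _ h1 =>
      convert Submodule.smul_mem _ c h1 using 2 with y
      have := hT.map_smul (c : ℝ) (f y)
      rw [Rat.cast_smul_eq_qsmul, Rat.cast_smul_eq_qsmul] at this
      exact this
  · obtain ⟨s, c, h⟩ := hT x
    have : (∑ z ∈ s, fun y => c z * (a y z - p y z)) =O[𝓝[<] (1 : ℝ)]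
        fun y => (1 - y) ^ (J : ℤ) :=
      IsBigO.sum fun z _ => (hp2 z).const_mul_left (c z)
    refine this.congr_left fun y => ?_
    simp [h, mul_sub]

lemma expansible_mul_self (ha : a ∈ expansible V) : (fun (y : ℝ) x => y * a y x) ∈ expansible V := by
  convert sub_mem ha (expansible_zpow_mul 1 ha) using 3
  simp; ring

/-- Expand `1 / y` as the geometric series in `1 - y`. After `J + B` terms the remainder is `y⁻¹ *
(1 - y) ^ (J + B)`, where `B` pays for the growth of `a`. -/
lemma expansible_inv_mul (ha : a ∈ expansible V) :
    (fun (y : ℝ) x => y⁻¹ * a y x) ∈ expansible V := by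
  obtain ⟨B, hB⟩ := expansible_bound ha
  refine expansible_of_approx fun J => ?_
  refine ⟨fun y x => ∑ k ∈ Finset.range (J + B), (1 - y) ^ (k : ℤ) * a y x, ?_, fun x => ?_⟩
  · have := Submodule.sum_mem (expansible V) (t := Finset.range (J + B))
      (f := fun k => fun (y : ℝ) x => (1 - y) ^ (k : ℤ) * a y x)
      fun k _ => expansible_zpow_mul (k : ℤ) ha
    convert this using 1
    ext; simp
  · have h1 : (fun y : ℝ => y⁻¹) =O[𝓝[<] 1] fun _ => (1 : ℝ) := by
      have : Tendsto (fun y : ℝ => y⁻¹) (𝓝[<] 1) (𝓝 (1⁻¹)) :=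
        (tendsto_id.inv₀ one_ne_zero).mono_left nhdsWithin_le_nhds
      exact this.isBigO_one ℝ
    have h2 := (h1.mul (hB x)).mul (isBigO_refl (fun y : ℝ => (1 - y) ^ ((J + B : ℕ) : ℤ)) (𝓝[<] 1))
    refine h2.congr' ?_ ?_
    · filter_upwards [eventually_mem_Ioo] with y hy
      have h0 : y ≠ 0 := hy.1.ne'
      have h3 := geom_sum_mul (1 - y) (J + B)
      simp only [zpow_natCast]
      rw [← Finset.sum_mul]
      have h4 : ∑ k ∈ Finset.range (J + B), (1 - y) ^ k = y⁻¹ * (1 - (1 - y) ^ (J + B)) := by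
        field_simp; linarith
      rw [h4]; ring
    · filter_upwards [eventually_mem_Ioo] with y hy
      have h0 : 1 - y ≠ 0 := by linarith [hy.2]
      rw [one_mul, ← zpow_add₀ h0]; congr 1; push_cast; ring

lemma expansible_self_zpow_mul (c : ℤ) (ha : a ∈ expansible V) :
    (fun (y : ℝ) x => y ^ c * a y x) ∈ expansible V := by
  induction c using Int.induction_on with
  | zero => simpa using ha
  | succ n ih =>
    refine expansible_congr (fun x => ?_) (expansible_mul_self ih)
    filter_upwards [eventually_mem_Ioo] with y hy
    rw [zpow_add_one₀ hy.1.ne']; ring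
  | pred n ih =>
    refine expansible_congr (fun x => ?_) (expansible_inv_mul ih)
    filter_upwards [eventually_mem_Ioo] with y hy
    rw [zpow_sub_one₀ hy.1.ne']; ring

/-! ### Limits -/

lemma tendsto_exp_mul_polynomial {j : ℤ} (hj : 0 < j) (P : Polynomial ℝ) :
    Tendsto (fun t : ℝ => Real.exp (-(j * t)) * P.eval t) atTop (𝓝 0) := by
  have h1 := P.tendsto_div_exp_atTop
  have h2 : Tendsto (fun t : ℝ => Real.exp (-((j - 1) * t))) atTop (𝓝 0) ∨
      (fun t : ℝ => Real.exp (-((j - 1) * t))) = fun _ => (1 : ℝ) := by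
    rcases eq_or_lt_of_le (show (1 : ℤ) ≤ j by omega) with h | h
    · right; subst h; simp
    · left
      have : (0 : ℝ) < j - 1 := by exact_mod_cast (by omega : 0 < j - 1)
      exact Real.tendsto_exp_neg_atTop_nhds_zero.comp (tendsto_id.const_mul_atTop this)
  have h3 : (fun t : ℝ => Real.exp (-(j * t)) * P.eval t) =
      fun t => Real.exp (-((j - 1) * t)) * (P.eval t / Real.exp t) := by
    ext t
    rw [div_eq_mul_inv, ← Real.exp_neg, mul_comm (P.eval t), ← mul_assoc, ← Real.exp_add]
    congr 2; ring
  rw [h3]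
  rcases h2 with h2 | h2
  · simpa using h2.mul h1
  · simpa [funext_iff] using (show Tendsto (fun t => (fun t : ℝ => Real.exp (-((j - 1) * t))) t *
      (P.eval t / Real.exp t)) atTop (𝓝 0) by rw [h2]; simpa using h1)

/-- The least exponent `a` dominates. If `a < 0`, multiplying by `exp (a t)` leaves `P a → 0`, so `P
a = 0` and it can be dropped. If `a = 0`, the polynomial `P 0` has a finite limit, so it is
constant. If `a > 0`, everything tends to `0`. -/
lemma limit_exp_polynomial (s : Finset ℤ) (P : ℤ → Polynomial ℝ) (l : ℝ)
    (h : Tendsto (fun t : ℝ => ∑ j ∈ s, Real.exp (-(j * t)) * (P j).eval t) atTop (𝓝 l)) :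
    l = if 0 ∈ s then (P 0).coeff 0 else 0 := by
  induction s using Finset.induction_on_min with
  | empty => simpa using tendsto_nhds_unique h (by simp)
  | insert a s ha ih =>
    have has : a ∉ s := fun h => lt_irrefl _ (ha a h)
    simp only [Finset.sum_insert has] at h
    have hrest : ∀ b : ℤ, b ≤ a → Tendsto (fun t : ℝ => ∑ j ∈ s, Real.exp (b * t) *
        (Real.exp (-(j * t)) * (P j).eval t)) atTop (𝓝 0) := by
      intro b hb
      rw [← Finset.sum_const_zero (s := s)]
      refine tendsto_finsetSum _ fun j hj => ?_
      refine (tendsto_exp_mul_polynomial (j := j - b) (by have := ha j hj; omega) (P j)).congr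
        fun t => ?_
      rw [← mul_assoc, ← Real.exp_add]; congr 2; push_cast; ring
    rcases lt_trichotomy a 0 with h0 | h0 | h0
    · have h1 : Tendsto (fun t : ℝ => Real.exp (a * t)) atTop (𝓝 0) := by
        refine (Real.tendsto_exp_neg_atTop_nhds_zero.comp
          (tendsto_id.const_mul_atTop (show (0 : ℝ) < -a by exact_mod_cast (by omega)))).congr
          fun t => ?_
        simp
      have h2 := (h1.mul h).sub (hrest a le_rfl)
      have h3 : Tendsto (fun t => (P a).eval t) atTop (𝓝 0) := by
        simp only [zero_mul, sub_zero] at h2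
        refine h2.congr fun t => ?_
        rw [mul_add, ← Finset.mul_sum, ← mul_assoc, ← Real.exp_add]
        simp
      have h4 : P a = 0 := by
        rw [Polynomial.tendsto_nhds_iff] at h3
        exact Polynomial.leadingCoeff_eq_zero.mp h3.1
      simp only [h4, Polynomial.eval_zero, mul_zero, zero_add] at h
      rw [ih h]
      have : (0 : ℤ) ≠ a := by omega
      simp [this]
    · subst h0
      have h2 := h.sub (hrest 0 le_rfl)
      have h3 : Tendsto (fun t => (P 0).eval t) atTop (𝓝 l) := by
        simp only [sub_zero] at h2
        refine h2.congr fun t => ?_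
        simp
      rw [Polynomial.tendsto_nhds_iff] at h3
      rw [if_pos (Finset.mem_insert_self 0 s), ← h3.1, Polynomial.leadingCoeff,
        Polynomial.natDegree_eq_zero_iff_degree_le_zero.mpr h3.2]
    · have h2 := (tendsto_exp_mul_polynomial h0 (P a)).add (hrest 0 h0.le)
      have h3 : l = 0 := by
        refine tendsto_nhds_unique h ?_
        simpa using h2
      have : (0 : ℤ) ∉ insert a s := by
        rw [Finset.mem_insert]; rintro (h | h)
        · omega
        · have := ha 0 h; omega
      simp [h3, this]

/-- The substitution `y = 1 - exp (-t)` turns `(1 - y) ^ j * logSing y ^ i` into `exp (-j t) * t ^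
i`. -/
lemma limit_logLaurent_scalar (c : ℤ × ℕ →₀ ℝ) (l : ℝ)
    (h : Tendsto (fun y : ℝ => c.sum fun ji r => (1 - y) ^ ji.1 * logSing y ^ ji.2 * r)
      (𝓝[<] 1) (𝓝 l)) : l = c (0, 0) := by
  classical
  have h1 : Tendsto (fun t : ℝ => 1 - Real.exp (-t)) atTop (𝓝[<] 1) := by
    apply tendsto_nhdsWithin_of_tendsto_nhds_of_eventually_within
    · simpa using Real.tendsto_exp_neg_atTop_nhds_zero.const_sub 1
    · exact Eventually.of_forall fun t => by simp [Real.exp_pos]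
  have h2 := h.comp h1
  let P : ℤ → Polynomial ℝ := fun j =>
    ∑ ji ∈ c.support.filter (fun ji => ji.1 = j), Polynomial.monomial ji.2 (c ji)
  have h3 := limit_exp_polynomial (c.support.image Prod.fst) P l (h2.congr fun t => ?_)
  · rw [h3]
    have hP : (P 0).coeff 0 = c (0, 0) := by
      simp only [P, Polynomial.finsetSum_coeff, Polynomial.coeff_monomial]
      rw [Finset.sum_eq_single (0, 0)]
      · simp
      · rintro ⟨j, i⟩ hji hne
        simp only [Finset.mem_filter] at hji
        rw [if_neg]
        rintro rfl
        exact hne (by simp [hji.2])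
      · intro hn
        by_contra h
        simp at hn h
        exact h hn
    rw [hP]
    split_ifs with h4
    · rfl
    · by_contra hne
      exact h4 (Finset.mem_image.mpr ⟨(0, 0), by simpa using Ne.symm hne, rfl⟩)
  · simp only [Function.comp, Finsupp.sum]
    rw [← Finset.sum_fiberwise_of_maps_to (g := Prod.fst) (t := c.support.image Prod.fst)
      (fun x hx => Finset.mem_image_of_mem _ hx)]
    refine Finset.sum_congr rfl fun j _ => ?_
    simp only [P, Polynomial.eval_finsetSum, Finset.mul_sum, Polynomial.eval_monomial]
    refine Finset.sum_congr rfl fun ji hji => ?_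
    have hj : ji.1 = j := (Finset.mem_filter.mp hji).2
    have h5 : logSing (1 - Real.exp (-t)) = t := by simp [logSing]
    have : -(j * t) = (j : ℝ) * -t := by ring
    rw [h5, hj, sub_sub_cancel, this, mul_comm (j : ℝ), Real.exp_mul, Real.rpow_intCast]; ring

/-- Collecting like terms gives one array in `V` for each pair of exponents, valid for all
coordinates at once. Hence a limit is a whole element of `V`, not merely a family of entries. -/
lemma logLaurent_eq_sum {p : ℝ → κ → ℝ} (hp : p ∈ logLaurent V) :
    ∃ f : ℤ × ℕ →₀ V, ∀ y x, p y x =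
      f.sum fun ji v => (1 - y) ^ ji.1 * logSing y ^ ji.2 * (v : κ → ℝ) x := by
  induction hp using Submodule.span_induction with
  | mem f hf =>
    obtain ⟨j, i, v, hv, rfl⟩ := hf
    exact ⟨Finsupp.single (j, i) ⟨v, hv⟩, fun y x => by simp⟩
  | zero => exact ⟨0, by simp⟩
  | add f g _ _ h1 h2 =>
    classical
    obtain ⟨f', hf⟩ := h1
    obtain ⟨g', hg⟩ := h2
    refine ⟨f' + g', fun y x => ?_⟩
    rw [Finsupp.sum_add_index' (by simp) (by simp [mul_add])]
    simp [hf, hg]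
  | smul c f _ h1 =>
    obtain ⟨f', hf⟩ := h1
    refine ⟨c • f', fun y x => ?_⟩
    rw [Finsupp.sum_smul_index' (by simp)]
    simp only [Pi.smul_apply, hf, Finsupp.sum, Finset.smul_sum, Submodule.coe_smul, Rat.smul_def]
    exact Finset.sum_congr rfl fun _ _ => by ring

/-- The limit of an expansible family has its coefficients in the same module. -/
lemma limit_mem_of_expansible (ha : a ∈ expansible V) {l : κ → ℝ}
    (hl : ∀ x, Tendsto (fun y => a y x) (𝓝[<] 1) (𝓝 (l x))) : l ∈ V := by
  obtain ⟨p, hp, hp'⟩ := ha 1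
  obtain ⟨f, hf⟩ := logLaurent_eq_sum hp
  have : l = f (0, 0) := by
    ext x
    have h0 : Tendsto (fun y : ℝ => (1 - y) ^ ((1 : ℕ) : ℤ)) (𝓝[<] 1) (𝓝 0) := by
      simpa using tendsto_one_sub.mono_right nhdsWithin_le_nhds
    have h1 : Tendsto (fun y => p y x) (𝓝[<] 1) (𝓝 (l x)) := by
      simpa using (hl x).sub ((hp' x).trans_tendsto h0)
    have h2 := limit_logLaurent_scalar (f.mapRange (fun v : V => (v : κ → ℝ) x) (by simp)) (l x)
      (h1.congr fun y => ?_)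
    · simpa using h2
    · rw [hf, Finsupp.sum_mapRange_index (by simp)]
  rw [this]
  exact (f (0, 0)).2

/-! ### Integration -/

lemma hasDerivAt_of_eq {f g : ℝ → ℝ} {f' g' x : ℝ} (h : HasDerivAt f f' x)
    (hfg : ∀ z, g z = f z) (hd : g' = f') : HasDerivAt g g' x := by
  rw [hd, funext hfg]; exact h

lemma hasDerivAt_logSing {y : ℝ} (hy : y < 1) : HasDerivAt logSing ((1 - y)⁻¹) y := by
  have h := (((hasDerivAt_id y).const_sub 1).log (by simp; linarith)).neg
  refine hasDerivAt_of_eq h (fun z => rfl) ?_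
  simp [div_eq_mul_inv]

/-- For `j = -1` the power of the logarithm goes up by one; otherwise integrate by parts, lowering
it. Only rational factors occur, so `V` need only be a `ℚ`-module. -/
lemma exists_primitive_term (j : ℤ) (i : ℕ) {v : κ → ℝ} (hv : v ∈ V) :
    ∃ q ∈ logLaurent V, ∀ x, ∀ y : ℝ, y < 1 →
      HasDerivAt (fun y => q y x) ((1 - y) ^ j * logSing y ^ i * v x) y := by
  by_cases hj : j = -1
  · subst hj
    refine ⟨((i + 1 : ℚ)⁻¹) • fun y x => (1 - y) ^ (0 : ℤ) * logSing y ^ (i + 1) * v x,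
      Submodule.smul_mem _ _ (term_mem_logLaurent 0 (i + 1) hv), fun x y hy => ?_⟩
    have h := (((hasDerivAt_logSing hy).pow (i + 1)).mul_const (v x)).const_mul ((i + 1 : ℝ)⁻¹)
    refine hasDerivAt_of_eq h (fun z => ?_) ?_
    · simp [Rat.smul_def]
    · have : (i + 1 : ℝ) ≠ 0 := by positivity
      simp; field_simp
  · induction i with
    | zero =>
      refine ⟨(-(j + 1 : ℚ)⁻¹) • fun y x => (1 - y) ^ (j + 1) * logSing y ^ 0 * v x,
        Submodule.smul_mem _ _ (term_mem_logLaurent (j + 1) 0 hv), fun x y hy => ?_⟩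
      have h0 : 1 - y ≠ 0 := by linarith
      have h1 := (hasDerivAt_zpow (j + 1) (1 - y) (Or.inl h0)).comp y
        ((hasDerivAt_id y).const_sub 1)
      have h2 := (h1.mul_const (v x)).const_mul (-(j + 1 : ℝ)⁻¹)
      have : (j + 1 : ℝ) ≠ 0 := by exact_mod_cast (by omega : j + 1 ≠ 0)
      refine hasDerivAt_of_eq h2 (fun z => ?_) ?_
      · simp [Rat.smul_def]
      · simp; field_simp
    | succ i ih =>
      obtain ⟨q, hq, hq'⟩ := ih
      refine ⟨(-(j + 1 : ℚ)⁻¹) • (fun y x => (1 - y) ^ (j + 1) * logSing y ^ (i + 1) * v x) +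
        ((i + 1) * (j + 1 : ℚ)⁻¹) • q,
        add_mem (Submodule.smul_mem _ _ (term_mem_logLaurent (j + 1) (i + 1) hv))
          (Submodule.smul_mem _ _ hq), fun x y hy => ?_⟩
      have h0 : 1 - y ≠ 0 := by linarith
      have h1 := (hasDerivAt_zpow (j + 1) (1 - y) (Or.inl h0)).comp y
        ((hasDerivAt_id y).const_sub 1)
      have h2 := ((h1.mul ((hasDerivAt_logSing hy).pow (i + 1))).mul_const (v x)).const_mul
        (-(j + 1 : ℝ)⁻¹)
      have h3 := h2.add ((hq' x y hy).const_mul ((i + 1) * (j + 1 : ℝ)⁻¹))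
      have : (j + 1 : ℝ) ≠ 0 := by exact_mod_cast (by omega : j + 1 ≠ 0)
      refine hasDerivAt_of_eq h3 (fun z => ?_) ?_
      · simp [Rat.smul_def]
      · simp [zpow_add_one₀ h0]; field_simp; ring

lemma exists_primitive_logLaurent {p : ℝ → κ → ℝ} (hp : p ∈ logLaurent V) :
    ∃ q ∈ logLaurent V, ∀ x, ∀ y : ℝ, y < 1 → HasDerivAt (fun y => q y x) (p y x) y := by
  induction hp using Submodule.span_induction with
  | mem f hf => obtain ⟨j, i, v, hv, rfl⟩ := hf; exact exists_primitive_term j i hv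
  | zero => exact ⟨0, zero_mem _, fun x y _ => by simpa using hasDerivAt_const y (0 : ℝ)⟩
  | add f g _ _ h1 h2 =>
    obtain ⟨f', hf, hf'⟩ := h1
    obtain ⟨g', hg, hg'⟩ := h2
    exact ⟨f' + g', add_mem hf hg, fun x y hy => (hf' x y hy).add (hg' x y hy)⟩
  | smul c f _ h1 =>
    obtain ⟨f', hf, hf'⟩ := h1
    refine ⟨c • f', Submodule.smul_mem _ _ hf, fun x y hy => ?_⟩
    refine hasDerivAt_of_eq ((hf' x y hy).const_mul (c : ℝ)) (fun z => ?_) ?_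
    · simp [Rat.smul_def]
    · simp [Rat.smul_def]

/-- A function whose derivative is `O((1 - y) ^ J)` has a limit at `1`, with error
`O((1 - y) ^ J)`. -/
lemma exists_limit_of_deriv_isBigO {f f' : ℝ → ℝ} (J : ℕ)
    (hf : ∀ y ∈ Set.Ioo (0 : ℝ) 1, HasDerivAt f (f' y) y)
    (h : f' =O[𝓝[<] (1 : ℝ)] fun y => (1 - y) ^ (J : ℤ)) :
    ∃ l, (fun y => f y - l) =O[𝓝[<] (1 : ℝ)] fun y => (1 - y) ^ (J : ℤ) := by
  obtain ⟨C, hC⟩ := h.bound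
  have hev := hC.and eventually_mem_Ioo
  rw [eventually_iff, mem_nhdsLT_iff_exists_Ioo_subset] at hev
  obtain ⟨y₀, hy₀, hsub⟩ := hev
  have hy₀ : y₀ < 1 := hy₀
  have hbd : ∀ y ∈ Set.Ioo y₀ 1, ∀ z ∈ Set.Ioo y₀ 1, y ≤ z →
      ‖f z - f y‖ ≤ |C| * (1 - y) ^ J * ‖z - y‖ := by
    intro y hy z hz hyz
    refine Convex.norm_image_sub_le_of_norm_hasDerivWithin_le (s := Set.Icc y z) (f' := f')
      (fun x hx => ?_) (fun x hx => ?_) (convex_Icc y z) ⟨le_rfl, hyz⟩ ⟨hyz, le_rfl⟩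
    · have hx' : x ∈ Set.Ioo y₀ 1 := ⟨lt_of_lt_of_le hy.1 hx.1, lt_of_le_of_lt hx.2 hz.2⟩
      exact (hf x (hsub hx').2).hasDerivWithinAt
    · have hx' : x ∈ Set.Ioo y₀ 1 := ⟨lt_of_lt_of_le hy.1 hx.1, lt_of_le_of_lt hx.2 hz.2⟩
      refine (hsub hx').1.trans ?_
      have h1 : 0 ≤ 1 - x := by linarith [hx'.2]
      rw [zpow_natCast, Real.norm_of_nonneg (by positivity)]
      refine mul_le_mul (le_abs_self C) ?_ (by positivity) (abs_nonneg _)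
      exact pow_le_pow_left₀ h1 (by linarith [hx.1]) _
  -- A uniform Lipschitz bound near `1` makes `f` Cauchy there, which produces `l`; letting `z → 1`
  -- in `hbd` then gives the rate.
  have hlip : ∀ y ∈ Set.Ioo y₀ 1, ∀ z ∈ Set.Ioo y₀ 1,
      dist (f y) (f z) ≤ |C| * (1 - y₀) ^ J * dist y z := by
    have aux : ∀ y ∈ Set.Ioo y₀ 1, ∀ z ∈ Set.Ioo y₀ 1, y ≤ z →
        dist (f y) (f z) ≤ |C| * (1 - y₀) ^ J * dist y z := by
      intro y hy z hz hyz
      rw [dist_comm, dist_comm y, dist_eq_norm, dist_eq_norm]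
      refine (hbd y hy z hz hyz).trans ?_
      gcongr
      · linarith [hy.2]
      · exact hy.1.le
    intro y hy z hz
    rcases le_total y z with h | h
    · exact aux y hy z hz h
    · rw [dist_comm, dist_comm y]; exact aux z hz y hy h
  have hcau : Cauchy (map f (𝓝[<] (1 : ℝ))) := by
    have hL : LipschitzOnWith (Real.toNNReal (|C| * (1 - y₀) ^ J)) f (Set.Ioo y₀ 1) := by
      refine LipschitzOnWith.of_dist_le_mul fun y hy z hz => ?_
      rw [Real.coe_toNNReal _ (by have : 0 ≤ 1 - y₀ := by linarith
                                  positivity)]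
      exact hlip y hy z hz
    refine Cauchy.map_of_le (s := Set.Ioo y₀ 1) (cauchy_nhds.mono nhdsWithin_le_nhds)
      hL.uniformContinuousOn ?_
    exact le_principal_iff.mpr (Ioo_mem_nhdsLT hy₀)
  obtain ⟨l, hl⟩ := CompleteSpace.complete hcau
  refine ⟨l, IsBigO.of_bound |C| ?_⟩
  filter_upwards [Ioo_mem_nhdsLT hy₀, eventually_mem_Ioo] with y hy hy'
  have h1 : 0 ≤ 1 - y := by linarith [hy.2]
  have hlim : Tendsto (fun z => ‖f z - f y‖) (𝓝[<] (1 : ℝ)) (𝓝 ‖l - f y‖) :=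
    ((show Tendsto f (𝓝[<] (1 : ℝ)) (𝓝 l) from hl).sub_const _).norm
  rw [norm_sub_rev, zpow_natCast, Real.norm_of_nonneg (pow_nonneg h1 _)]
  refine le_of_tendsto hlim ?_
  filter_upwards [Ioo_mem_nhdsLT hy.2] with z hz
  refine (hbd y hy z ⟨hy.1.trans hz.1, hz.2⟩ hz.1.le).trans ?_
  have h2 : ‖z - y‖ ≤ 1 := by
    rw [Real.norm_of_nonneg (by linarith [hz.1])]; linarith [hz.2, hy'.1]
  exact mul_le_of_le_one_right (by positivity) h2

/-- A primitive of an expansible family is expansible up to constants. -/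
lemma exists_const_of_hasDerivAt
    (hb : ∀ x, ∀ y ∈ Set.Ioo (0 : ℝ) 1, HasDerivAt (fun y => b y x) (a y x) y)
    (ha : a ∈ expansible V) : ∃ K : κ → ℝ, (fun y x => b y x - K x) ∈ expansible V := by
  have key : ∀ J : ℕ, ∃ q ∈ logLaurent V, ∃ K : κ → ℝ, ∀ x,
      (fun y => b y x - q y x - K x) =O[𝓝[<] (1 : ℝ)] fun y => (1 - y) ^ (J : ℤ) := by
    intro J
    obtain ⟨p, hp, hp'⟩ := ha J
    obtain ⟨q, hq, hq'⟩ := exists_primitive_logLaurent hp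
    have := fun x => exists_limit_of_deriv_isBigO J
      (f := fun y => b y x - q y x) (f' := fun y => a y x - p y x)
      (fun y hy => (hb x y hy).sub (hq' x y hy.2)) (hp' x)
    choose K hK using this
    exact ⟨q, hq, K, hK⟩
  -- The constant is fixed at order `1`, where the error already tends to `0`. The constant found at
  -- a higher order differs from it by the limit of `q₁ - q`, which lies in `V`.
  obtain ⟨q₁, hq₁, K, hK⟩ := key 1
  refine ⟨K, expansible_of_approx fun J => ?_⟩
  obtain ⟨q, hq, K', hK'⟩ := key (J + 1)
  have hKK : (fun x => K' x - K x) ∈ V := by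
    refine limit_mem_of_expansible (a := fun y x => q₁ y x - q y x)
      (logLaurent_le_expansible (sub_mem hq₁ hq)) fun x => ?_
    have h0 : ∀ n : ℕ, Tendsto (fun y : ℝ => (1 - y) ^ ((n + 1 : ℕ) : ℤ)) (𝓝[<] 1) (𝓝 0) := by
      intro n
      have := (tendsto_one_sub.mono_right nhdsWithin_le_nhds).pow (n + 1)
      simp only [zpow_natCast]
      simpa using this
    have h1 := ((hK' x).trans_tendsto (h0 J)).sub ((hK x).trans_tendsto (h0 0))
    rw [sub_zero] at h1
    have h2 := h1.add_const (K' x - K x)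
    rw [zero_add] at h2
    exact h2.congr fun y => by ring
  refine ⟨fun y x => q y x + (K' x - K x),
    add_mem (logLaurent_le_expansible hq) (const_mem_expansible hKK), fun x => ?_⟩
  refine ((hK' x).trans (isBigO_zpow_of_le (k := J) (by push_cast; omega))).congr_left
    fun y => by ring

end BigZeta

/-! ### The operators `θ` and `(θ + c)⁻¹` on power series, and the shuffle product -/

namespace BigZeta

open Filter Asymptotics Topology PowerSeries

/-- The operator `(θ + c)⁻¹`, `θ = X d/dX`: the coefficient of `X ^ n` is divided by `n + c`
(and replaced by `0` if `n + c = 0`). -/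
noncomputable def divOp (c : ℤ) : ℚ⟦X⟧ →ₗ[ℚ] ℚ⟦X⟧ where
  toFun f := PowerSeries.mk fun n => coeff n f / ((n : ℚ) + c)
  map_add' f g := by ext n; simp [add_div]
  map_smul' r f := by ext n; simp [mul_div_assoc]

@[simp] lemma coeff_divOp (c : ℤ) (f : ℚ⟦X⟧) (n : ℕ) :
    coeff n (divOp c f) = coeff n f / ((n : ℚ) + c) := by simp [divOp]

/-- The derivation `θ = X d/dX`. -/
noncomputable def theta : Derivation ℚ ℚ⟦X⟧ ℚ⟦X⟧ := (X : ℚ⟦X⟧) • PowerSeries.derivative ℚ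

@[simp] lemma coeff_theta (f : ℚ⟦X⟧) (n : ℕ) : coeff n (theta f) = n * coeff n f := by
  simp only [theta, Derivation.smul_apply, smul_eq_mul]
  cases n with
  | zero => simp
  | succ n => rw [coeff_succ_X_mul, PowerSeries.coeff_derivative]; push_cast; ring

/-- `1 / (1 - X)`. -/
noncomputable def geom : ℚ⟦X⟧ := PowerSeries.mk fun _ => 1

@[simp] lemma coeff_geom (n : ℕ) : coeff n geom = 1 := by simp [geom]

lemma X_mul_geom : X * geom = geom - 1 := by
  ext n
  cases n with
  | zero => rw [coeff_zero_X_mul, map_sub, coeff_geom, coeff_zero_one, sub_self]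
  | succ n => rw [coeff_succ_X_mul]; simp [coeff_one]

lemma one_sub_X_mul_geom : (1 - X) * geom = 1 := by
  rw [sub_mul, X_mul_geom]; ring

lemma theta_geom : theta geom = geom ^ 2 - geom := by
  have h : theta ((1 - X) * geom) = 0 := by rw [one_sub_X_mul_geom]; simp
  have hX : theta (X : ℚ⟦X⟧) = X := by
    ext n; simp only [coeff_theta, coeff_X]; split_ifs with h <;> simp [h]
  rw [Derivation.leibniz, map_sub, hX, Derivation.map_one_eq_zero] at h
  simp only [smul_eq_mul, zero_sub] at h
  have h2 := congrArg (geom * ·) h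
  simp only [mul_add, mul_zero] at h2
  have h3 : geom * ((1 - X) * theta geom) = theta geom := by
    rw [← mul_assoc, mul_comm geom, one_sub_X_mul_geom, one_mul]
  rw [h3] at h2
  have h4 : geom * (geom * -X) = - (geom * (X * geom)) := by ring
  rw [h4, X_mul_geom] at h2
  linear_combination h2

/-- The coefficient of `X ^ (-c)`, lost by `divOp c`. -/
noncomputable def lostTerm (c : ℤ) (f : ℚ⟦X⟧) : ℚ⟦X⟧ :=
  if c ≤ 0 then monomial c.natAbs (coeff c.natAbs f) else 0

lemma coeff_lostTerm (c : ℤ) (f : ℚ⟦X⟧) (n : ℕ) :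
    coeff n (lostTerm c f) = if (n : ℚ) + c = 0 then coeff n f else 0 := by
  have h0 : (n : ℚ) + c = 0 ↔ (n : ℤ) + c = 0 := by exact_mod_cast Iff.rfl
  unfold lostTerm
  split_ifs with h1 h2 h2
  · have : n = c.natAbs := by rw [h0] at h2; omega
    subst this; simp
  · have : n ≠ c.natAbs := by rw [h0] at h2; omega
    simp [coeff_monomial, this]
  · rw [h0] at h2; omega
  · simp

/-- At the exponent `-c` the convention `a / 0 = 0` makes `divOp c` forget a coefficient; `lostTerm`
keeps account of it. -/
lemma theta_divOp (c : ℤ) (f : ℚ⟦X⟧) :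
    theta (divOp c f) = f - (c : ℚ) • divOp c f - lostTerm c f := by
  ext n
  simp only [coeff_theta, coeff_divOp, map_sub, coeff_lostTerm, map_smul, smul_eq_mul]
  split_ifs with h
  · simp [h]
  · field_simp; ring

/-- Integration by parts: for `c ≠ 0` it expresses `divOp c f` through `divOp c (theta f)`. -/
lemma divOp_theta (c : ℤ) (f : ℚ⟦X⟧) :
    divOp c (theta f) = f - (c : ℚ) • divOp c f - lostTerm c f := by
  ext n
  simp only [coeff_theta, coeff_divOp, map_sub, coeff_lostTerm, map_smul, smul_eq_mul]
  split_ifs with h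
  · simp [h]
  · field_simp; ring

lemma X_pow_mul_divOp (N : ℕ) (c : ℤ) (f : ℚ⟦X⟧) :
    X ^ N * divOp c f = divOp (c - N) (X ^ N * f) := by
  ext n
  rw [coeff_divOp, coeff_X_pow_mul', coeff_X_pow_mul']
  split_ifs with h
  · rw [coeff_divOp]; push_cast [Nat.cast_sub h]; congr 1; ring
  · simp

lemma divOp_X_mul (c : ℤ) (f : ℚ⟦X⟧) : divOp c (X * f) = X * divOp (c + 1) f := by
  have := X_pow_mul_divOp 1 (c + 1) f
  simpa using this.symm

/-! ### Polylogarithms -/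

/-- The multiple polylogarithm attached to a word: `false` stands for the form `dX / X` and `true`
for `dX / (1 - X)`, the head of the list being integrated last. -/
noncomputable def polylog : List Bool → ℚ⟦X⟧
  | [] => 1
  | false :: v => divOp 0 (polylog v)
  | true :: v => divOp 0 (X * geom * polylog v)

@[simp] lemma polylog_nil : polylog [] = 1 := rfl
@[simp] lemma polylog_false (v : List Bool) : polylog (false :: v) = divOp 0 (polylog v) := rfl
@[simp] lemma polylog_true (v : List Bool) :
    polylog (true :: v) = divOp 0 (X * geom * polylog v) := rfl

/-- Words that are empty or end with the letter `true`. -/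
inductive GoodWord : List Bool → Prop
  | nil : GoodWord []
  | one {v} : GoodWord v → GoodWord (true :: v)
  | zero {b v} : GoodWord (b :: v) → GoodWord (false :: b :: v)

lemma coeff_zero_mul' (f g : ℚ⟦X⟧) : coeff 0 (f * g) = coeff 0 f * coeff 0 g := by simp

lemma coeff_zero_divOp_zero (f : ℚ⟦X⟧) : coeff 0 (divOp 0 f) = 0 := by simp

lemma coeff_zero_polylog (b : Bool) (v : List Bool) : coeff 0 (polylog (b :: v)) = 0 := by
  cases b <;> exact coeff_zero_divOp_zero _

/-- If the last letter is `false`, the innermost step is `divOp 0 1`, which is `0` because `1 / 0 =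
0`; all further operations preserve zero. -/
lemma goodWord_or_polylog_eq_zero (v : List Bool) : GoodWord v ∨ polylog v = 0 := by
  induction v with
  | nil => exact Or.inl .nil
  | cons b v ih =>
    cases b with
    | true =>
      rcases ih with h | h
      · exact Or.inl (.one h)
      · right; simp [h]
    | false =>
      rcases ih with h | h
      · cases v with
        | nil =>
          right; ext n
          rw [polylog_false, coeff_divOp, polylog_nil, coeff_one]
          split_ifs with h <;> simp [h]
        | cons b v => exact Or.inl (.zero h)
      · right; simp [h]

lemma theta_divOp_zero {f : ℚ⟦X⟧} (hf : coeff 0 f = 0) : theta (divOp 0 f) = f := by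
  rw [theta_divOp]; simp [lostTerm, hf]

lemma divOp_zero_theta {f : ℚ⟦X⟧} (hf : coeff 0 f = 0) : divOp 0 (theta f) = f := by
  rw [divOp_theta]; simp [lostTerm, hf]

lemma theta_polylog_true (v : List Bool) : theta (polylog (true :: v)) = X * geom * polylog v :=
  theta_divOp_zero (by simp [mul_assoc])

lemma theta_polylog_false (b : Bool) (v : List Bool) :
    theta (polylog (false :: b :: v)) = polylog (b :: v) :=
  theta_divOp_zero (coeff_zero_polylog b v)

/-- The span of the polylogarithms of given weight and depth. -/
noncomputable def polylogSpan (w d : ℕ) : Submodule ℚ ℚ⟦X⟧ :=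
  Submodule.span ℚ {f | ∃ v, GoodWord v ∧ v.length = w ∧ v.count true = d ∧ f = polylog v}

lemma polylog_mem_polylogSpan {v : List Bool} (hv : GoodWord v) :
    polylog v ∈ polylogSpan v.length (v.count true) :=
  Submodule.subset_span ⟨v, hv, rfl, rfl, rfl⟩

lemma divOp_true_mem_polylogSpan {w d : ℕ} {f : ℚ⟦X⟧} (hf : f ∈ polylogSpan w d) :
    divOp 0 (X * geom * f) ∈ polylogSpan (w + 1) (d + 1) := by
  induction hf using Submodule.span_induction with
  | mem f hf =>
    obtain ⟨v, hv, rfl, rfl, rfl⟩ := hf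
    exact Submodule.subset_span ⟨true :: v, .one hv, by simp, by simp, rfl⟩
  | zero => simp
  | add f g _ _ h1 h2 => rw [mul_add, map_add]; exact add_mem h1 h2
  | smul c f _ h => rw [mul_smul_comm, map_smul]; exact Submodule.smul_mem _ _ h

lemma divOp_false_mem_span {w d : ℕ} {f : ℚ⟦X⟧} (hf : f ∈ polylogSpan (w + 1) d) :
    divOp 0 f ∈ Submodule.span ℚ {f | ∃ v, GoodWord (false :: v) ∧ v.length = w + 1 ∧
      v.count true = d ∧ f = polylog (false :: v)} := by
  induction hf using Submodule.span_induction with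
  | mem f hf =>
    obtain ⟨v, hv, hw, rfl, rfl⟩ := hf
    refine Submodule.subset_span ⟨v, ?_, hw, rfl, rfl⟩
    cases v with
    | nil => simp at hw
    | cons b v => exact .zero hv
  | zero => simp
  | add f g _ _ h1 h2 => rw [map_add]; exact add_mem h1 h2
  | smul c f _ h => rw [map_smul]; exact Submodule.smul_mem _ _ h

lemma divOp_false_mem_polylogSpan {w d : ℕ} {f : ℚ⟦X⟧} (hf : f ∈ polylogSpan (w + 1) d) :
    divOp 0 f ∈ polylogSpan (w + 2) d := by
  refine Submodule.span_mono ?_ (divOp_false_mem_span hf)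
  rintro _ ⟨v, hv, hw, hd, rfl⟩
  exact ⟨false :: v, hv, by simp [hw], by simp [hd], rfl⟩

/-- The shuffle product. By the Leibniz rule `L_u L_v` is the `θ`-primitive of `L_v θ L_u + L_u θ
L_v`, and `θ` strips the first letter of a word; induct on the total length. -/
lemma polylog_mul_mem_polylogSpan {u v : List Bool} (hu : GoodWord u) (hv : GoodWord v) :
    polylog u * polylog v ∈
      polylogSpan (u.length + v.length) (u.count true + v.count true) := by
  obtain ⟨n, hn⟩ : ∃ n, u.length + v.length = n := ⟨_, rfl⟩
  induction n using Nat.strong_induction_on generalizing u v with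
  | _ n ih =>
  subst hn
  cases u with
  | nil => simpa using polylog_mem_polylogSpan hv
  | cons a u =>
  cases v with
  | nil => simpa using polylog_mem_polylogSpan hu
  | cons b v =>
  have half : ∀ (a : Bool) (u v : List Bool), v ≠ [] → GoodWord (a :: u) → GoodWord v →
      (∀ u', GoodWord u' → u'.length = u.length → polylog u' * polylog v ∈
        polylogSpan (u'.length + v.length) (u'.count true + v.count true)) →
      divOp 0 (polylog v * theta (polylog (a :: u))) ∈
        polylogSpan ((a :: u).length + v.length) ((a :: u).count true + v.count true) := by
    intro a u v hne hu hv h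
    cases hu with
    | one hu =>
      rw [theta_polylog_true]
      have := divOp_true_mem_polylogSpan (h u hu rfl)
      convert this using 2
      · simp only [List.length_cons]; omega
      · simp only [List.count_cons_self]; omega
      · ring
    | @zero b u hu =>
      rw [theta_polylog_false]
      have h1 := h (b :: u) hu rfl
      obtain ⟨k, hk⟩ : ∃ k, (b :: u).length + v.length = k + 1 :=
        ⟨u.length + v.length, by simp; ring⟩
      rw [hk] at h1
      have := divOp_false_mem_polylogSpan h1
      convert this using 2
      · simp only [List.length_cons] at hk ⊢; omega
      · simp
      · ring
  have key : polylog (a :: u) * polylog (b :: v) =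
      divOp 0 (polylog (b :: v) * theta (polylog (a :: u))) +
      divOp 0 (polylog (a :: u) * theta (polylog (b :: v))) := by
    rw [← map_add, ← divOp_zero_theta (f := polylog (a :: u) * polylog (b :: v)),
      Derivation.leibniz, add_comm]
    · rfl
    · rw [coeff_zero_mul', coeff_zero_polylog, zero_mul]
  rw [key]
  refine add_mem (half a u (b :: v) (by simp) hu hv fun u' hu' hl => ?_) ?_
  · exact ih (u'.length + (b :: v).length) (by simp only [List.length_cons]; omega) hu' hv rfl
  · rw [add_comm (a :: u).length, add_comm ((a :: u).count true)]
    refine half b v (a :: u) (by simp) hv hu fun v' hv' hl => ?_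
    rw [add_comm v'.length]
    rw [add_comm (v'.count true), mul_comm]
    exact ih ((a :: u).length + v'.length) (by simp only [List.length_cons]; omega) hu hv' rfl

/-- The product of the logarithm with a polylogarithm: the words in which the new letter is not
put into the initial block of `true`s have a shorter such block. -/
lemma log_mul_polylog_block (m : ℕ) {u : List Bool} (hu : GoodWord (false :: u)) :
    polylog [true] * polylog (List.replicate m true ++ false :: u) -
      ((m + 1 : ℕ) : ℚ) • polylog (List.replicate (m + 1) true ++ false :: u) ∈
    Submodule.span ℚ {f | ∃ v, GoodWord (List.replicate m true ++ false :: v) ∧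
      v.length = u.length + 1 ∧ v.count true = u.count true + 1 ∧
      f = polylog (List.replicate m true ++ false :: v)} := by
  -- Either the new letter goes in front of `v`, or the first letter of `v` stays in front and the
  -- product continues behind it.
  have hθ : ∀ v : List Bool, v ≠ [] → polylog [true] * polylog v =
      polylog (true :: v) + divOp 0 (polylog [true] * theta (polylog v)) := by
    intro v hv
    obtain ⟨b, v, rfl⟩ := List.exists_cons_of_ne_nil hv
    rw [← divOp_zero_theta (f := polylog [true] * polylog (b :: v)), Derivation.leibniz,
      theta_polylog_true, add_comm, map_add, polylog_true (b :: v)]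
    · simp only [smul_eq_mul, polylog_nil, mul_one]
      rw [mul_comm (polylog (b :: v))]
    · rw [coeff_zero_mul', coeff_zero_polylog, zero_mul]
  induction m with
  | zero =>
    simp only [List.replicate_zero, List.nil_append, zero_add, Nat.cast_one, one_smul,
      List.replicate_one, List.singleton_append]
    rw [hθ _ (by simp), add_sub_cancel_left]
    cases hu with
    | @zero b u hu =>
    rw [theta_polylog_false]
    have h := polylog_mul_mem_polylogSpan (.one .nil) hu
    obtain ⟨k, hk⟩ : ∃ k, [true].length + (b :: u).length = k + 1 := ⟨(b :: u).length, by simp; ring⟩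
    rw [hk] at h
    refine Submodule.span_mono ?_ (divOp_false_mem_span h)
    rintro _ ⟨v, hv, hw, hd, rfl⟩
    refine ⟨v, hv, ?_, ?_, rfl⟩
    · rw [hw, ← hk]; simp; ring
    · rw [hd]; simp; ring
  | succ m ih =>
    rw [List.replicate_succ, List.cons_append, hθ _ (by simp), theta_polylog_true]
    have h1 : divOp 0 (polylog [true] * (X * geom * polylog (List.replicate m true ++ false :: u)))
        = divOp 0 (X * geom * (polylog [true] * polylog (List.replicate m true ++ false :: u) -
          ((m + 1 : ℕ) : ℚ) • polylog (List.replicate (m + 1) true ++ false :: u))) +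
          ((m + 1 : ℕ) : ℚ) •
            polylog (true :: (List.replicate (m + 1) true ++ false :: u)) := by
      rw [polylog_true (List.replicate (m + 1) true ++ false :: u), ← map_smul, ← map_add]
      congr 1
      rw [mul_sub, mul_smul_comm]; ring
    rw [h1]
    have h2 : ∀ (A B : ℚ⟦X⟧), A + (B + ((m + 1 : ℕ) : ℚ) • A) - ((m + 1 + 1 : ℕ) : ℚ) • A = B := by
      intro A B; push_cast; module
    rw [show polylog (true :: true :: (List.replicate m true ++ false :: u)) =
      polylog (true :: (List.replicate (m + 1) true ++ false :: u)) from rfl,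
      show polylog (List.replicate (m + 1 + 1) true ++ false :: u) =
      polylog (true :: (List.replicate (m + 1) true ++ false :: u)) from rfl, h2]
    have h3 : ∀ f ∈ Submodule.span ℚ {f | ∃ v, GoodWord (List.replicate m true ++ false :: v) ∧
      v.length = u.length + 1 ∧ v.count true = u.count true + 1 ∧
      f = polylog (List.replicate m true ++ false :: v)}, divOp 0 (X * geom * f) ∈
      Submodule.span ℚ {f | ∃ v, GoodWord (true :: (List.replicate m true ++ false :: v)) ∧
      v.length = u.length + 1 ∧ v.count true = u.count true + 1 ∧
      f = polylog (true :: (List.replicate m true ++ false :: v))} := by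
      intro f hf
      induction hf using Submodule.span_induction with
      | mem f hf =>
        obtain ⟨v, hv, h1, h2, rfl⟩ := hf
        exact Submodule.subset_span ⟨v, .one hv, h1, h2, rfl⟩
      | zero => simp
      | add f g _ _ h1 h2 => rw [mul_add, map_add]; exact add_mem h1 h2
      | smul c f _ h => rw [mul_smul_comm, map_smul]; exact Submodule.smul_mem _ _ h
    exact h3 _ ih

/-- The word of `m` letters `true` is the logarithm to the power `m`, divided by `m!`. -/
lemma log_mul_log_pow (m : ℕ) :
    polylog [true] * polylog (List.replicate m true) =
      ((m + 1 : ℕ) : ℚ) • polylog (List.replicate (m + 1) true) := by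
  induction m with
  | zero => simp
  | succ m ih =>
    rw [← divOp_zero_theta (f := polylog [true] * polylog (List.replicate (m + 1) true)),
      Derivation.leibniz, List.replicate_succ (n := m), theta_polylog_true, theta_polylog_true]
    · simp only [smul_eq_mul, map_add]
      have h1 : polylog [true] * (X * geom * polylog (List.replicate m true)) =
        X * geom * (polylog [true] * polylog (List.replicate m true)) := by ring
      rw [h1, ih, mul_smul_comm, map_smul, polylog_nil, mul_one, mul_comm (polylog (true :: _))]
      have h2 : divOp 0 (X * geom * polylog (List.replicate (m + 1) true)) =
        polylog (List.replicate (m + 1 + 1) true) := rfl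
      rw [← List.replicate_succ, h2]
      push_cast; module
    · rw [coeff_zero_mul', coeff_zero_polylog, zero_mul]

/-! ### Evaluation at real points -/

/-- The value of a power series at `y`. -/
noncomputable def evalAt (f : ℚ⟦X⟧) (y : ℝ) : ℝ := ∑' n, ((coeff n f : ℚ) : ℝ) * y ^ n

/-- Power series converging absolutely in the open unit disc. -/
def Tame (f : ℚ⟦X⟧) : Prop := ∀ y ∈ Set.Ico (0 : ℝ) 1, Summable fun n => |((coeff n f : ℚ) : ℝ)| * y ^ n

lemma Tame.summable_norm {f : ℚ⟦X⟧} (hf : Tame f) {y : ℝ} (hy : |y| < 1) :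
    Summable fun n => ‖((coeff n f : ℚ) : ℝ) * y ^ n‖ := by
  simpa only [norm_mul, norm_pow, Real.norm_eq_abs] using hf |y| ⟨abs_nonneg y, hy⟩

lemma Tame.summable {f : ℚ⟦X⟧} (hf : Tame f) {y : ℝ} (hy : |y| < 1) :
    Summable fun n => ((coeff n f : ℚ) : ℝ) * y ^ n := (hf.summable_norm hy).of_norm

lemma Tame.add {f g : ℚ⟦X⟧} (hf : Tame f) (hg : Tame g) : Tame (f + g) := by
  intro y hy
  refine Summable.of_nonneg_of_le (fun n => by have := hy.1; positivity) (fun n => ?_)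
    ((hf y hy).add (hg y hy))
  rw [← add_mul]
  refine mul_le_mul_of_nonneg_right ?_ (pow_nonneg hy.1 _)
  simpa using abs_add_le ((coeff n f : ℚ) : ℝ) ((coeff n g : ℚ) : ℝ)

lemma Tame.smul {f : ℚ⟦X⟧} (c : ℚ) (hf : Tame f) : Tame (c • f) := by
  intro y hy
  simpa [abs_mul, mul_assoc] using (hf y hy).mul_left |(c : ℝ)|

lemma Tame.mono {f g : ℚ⟦X⟧} (hf : Tame f) (h : ∀ n, |coeff n g| ≤ |coeff n f|) : Tame g := by
  intro y hy
  refine Summable.of_nonneg_of_le (fun n => by have := hy.1; positivity) (fun n => ?_) (hf y hy)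
  refine mul_le_mul_of_nonneg_right ?_ (pow_nonneg hy.1 _)
  exact_mod_cast h n

lemma abs_div_int_le (a : ℚ) (k : ℤ) : |a / (k : ℚ)| ≤ |a| := by
  rcases eq_or_ne k 0 with h | h
  · simp [h]
  · rw [abs_div]
    refine div_le_self (abs_nonneg a) ?_
    exact_mod_cast Int.one_le_abs h

lemma Tame.divOp {f : ℚ⟦X⟧} (hf : Tame f) (c : ℤ) : Tame (divOp c f) := by
  refine hf.mono fun n => ?_
  have := abs_div_int_le (coeff n f) (n + c)
  push_cast at this
  simpa using this

lemma tame_geom : Tame geom := by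
  intro y hy
  simpa using summable_geometric_of_lt_one hy.1 hy.2

lemma tame_monomial (n : ℕ) (r : ℚ) : Tame (monomial n r) := by
  intro y hy
  refine summable_of_ne_finset_zero (s := {n}) fun m hm => ?_
  have : m ≠ n := by simpa using hm
  simp [coeff_monomial, this]

lemma Tame.mul_aux {f g : ℚ⟦X⟧} (y : ℝ) (n : ℕ) :
    ((coeff n (f * g) : ℚ) : ℝ) * y ^ n =
      ∑ kl ∈ Finset.HasAntidiagonal.antidiagonal n, (((coeff kl.1 f : ℚ) : ℝ) * y ^ kl.1) *
        (((coeff kl.2 g : ℚ) : ℝ) * y ^ kl.2) := by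
  rw [coeff_mul]; push_cast; rw [Finset.sum_mul]
  refine Finset.sum_congr rfl fun kl hkl => ?_
  rw [← Finset.HasAntidiagonal.mem_antidiagonal.mp hkl, pow_add]; ring

lemma Tame.mul {f g : ℚ⟦X⟧} (hf : Tame f) (hg : Tame g) : Tame (f * g) := by
  intro y hy
  have hy' : |y| < 1 := by rw [abs_of_nonneg hy.1]; exact hy.2
  have h := summable_norm_sum_mul_antidiagonal_of_summable_norm (hf.summable_norm hy')
    (hg.summable_norm hy')
  refine h.congr fun n => ?_
  rw [← Tame.mul_aux, norm_mul, norm_pow, Real.norm_of_nonneg hy.1, Real.norm_eq_abs]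

lemma evalAt_mul {f g : ℚ⟦X⟧} (hf : Tame f) (hg : Tame g) {y : ℝ} (hy : |y| < 1) :
    evalAt (f * g) y = evalAt f y * evalAt g y := by
  rw [evalAt, evalAt, evalAt, tsum_mul_tsum_eq_tsum_sum_antidiagonal_of_summable_norm
    (hf.summable_norm hy) (hg.summable_norm hy)]
  exact tsum_congr fun n => Tame.mul_aux y n

lemma evalAt_add {f g : ℚ⟦X⟧} (hf : Tame f) (hg : Tame g) {y : ℝ} (hy : |y| < 1) :
    evalAt (f + g) y = evalAt f y + evalAt g y := by
  rw [evalAt, evalAt, evalAt, ← (hf.summable hy).tsum_add (hg.summable hy)]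
  exact tsum_congr fun n => by simp [add_mul]

lemma evalAt_smul (c : ℚ) (f : ℚ⟦X⟧) (y : ℝ) : evalAt (c • f) y = c * evalAt f y := by
  rw [evalAt, evalAt, ← tsum_mul_left]
  exact tsum_congr fun n => by simp [mul_assoc]

lemma evalAt_monomial (n : ℕ) (r : ℚ) (y : ℝ) : evalAt (monomial n r) y = r * y ^ n := by
  rw [evalAt, tsum_eq_single n]
  · simp
  · intro m hm; simp [coeff_monomial, hm]

lemma evalAt_zero (y : ℝ) : evalAt 0 y = 0 := by simp [evalAt]

lemma evalAt_one (y : ℝ) : evalAt 1 y = 1 := by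
  have := evalAt_monomial 0 1 y
  rw [monomial_zero_eq_C_apply, map_one] at this
  simpa using this

lemma tame_one : Tame 1 := by
  have := tame_monomial 0 1
  rwa [monomial_zero_eq_C_apply, map_one] at this

lemma tame_zero : Tame 0 := by simpa using tame_monomial 0 0

lemma tame_X : Tame X := by rw [X_eq]; exact tame_monomial 1 1

lemma evalAt_X (y : ℝ) : evalAt X y = y := by
  rw [X_eq, evalAt_monomial]; simp

lemma evalAt_geom {y : ℝ} (hy : |y| < 1) : evalAt geom y = (1 - y)⁻¹ := by
  simp only [evalAt, coeff_geom, Rat.cast_one, one_mul]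
  exact tsum_geometric_of_abs_lt_one hy

lemma Tame.pow {f : ℚ⟦X⟧} (hf : Tame f) (n : ℕ) : Tame (f ^ n) := by
  induction n with
  | zero => simpa using tame_one
  | succ n ih => rw [pow_succ]; exact ih.mul hf

lemma evalAt_pow {f : ℚ⟦X⟧} (hf : Tame f) (n : ℕ) {y : ℝ} (hy : |y| < 1) :
    evalAt (f ^ n) y = evalAt f y ^ n := by
  induction n with
  | zero => simp [evalAt_one]
  | succ n ih => rw [pow_succ, evalAt_mul (hf.pow n) hf hy, ih, pow_succ]

/-- Compare with the series at a larger radius `r < 1`: the sequence `n * (y / r) ^ n` is bounded.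
-/
lemma Tame.summable_deriv {f : ℚ⟦X⟧} (hf : Tame f) {y : ℝ} (hy : y ∈ Set.Ioo (0 : ℝ) 1) :
    Summable fun n : ℕ => |((coeff n f : ℚ) : ℝ)| * (n * y ^ n) := by
  obtain ⟨r, hr1, hr2⟩ := exists_between hy.2
  have hr0 : 0 < r := hy.1.trans hr1
  have h1 : Tendsto (fun n : ℕ => (n : ℝ) * (y / r) ^ n) atTop (𝓝 0) :=
    tendsto_self_mul_const_pow_of_lt_one (div_nonneg hy.1.le hr0.le) ((div_lt_one hr0).mpr hr1)
  obtain ⟨C, hC⟩ := h1.bddAbove_range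
  refine Summable.of_nonneg_of_le (fun n => by have := hy.1; positivity) (fun n => ?_)
    ((hf r ⟨hr0.le, hr2⟩).mul_left C)
  have h2 : (n : ℝ) * (y / r) ^ n ≤ C := hC ⟨n, rfl⟩
  have h3 : (n : ℝ) * y ^ n = (n * (y / r) ^ n) * r ^ n := by
    rw [div_pow]; field_simp
  rw [h3]
  calc |((coeff n f : ℚ) : ℝ)| * (n * (y / r) ^ n * r ^ n)
      ≤ |((coeff n f : ℚ) : ℝ)| * (C * r ^ n) := by gcongr
    _ = C * (|((coeff n f : ℚ) : ℝ)| * r ^ n) := by ring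

lemma hasDerivAt_evalAt {f : ℚ⟦X⟧} (hf : Tame f) {y : ℝ} (hy : y ∈ Set.Ioo (0 : ℝ) 1) :
    HasDerivAt (evalAt f) (evalAt (theta f) y / y) y := by
  obtain ⟨r, hr1, hr2⟩ := exists_between hy.2
  have hr0 : 0 < r := hy.1.trans hr1
  have hu : Summable fun n : ℕ => |((coeff n f : ℚ) : ℝ)| * (n * r ^ n) * r⁻¹ :=
    (hf.summable_deriv ⟨hr0, hr2⟩).mul_right _
  have h := hasDerivAt_tsum_of_isPreconnected (t := Set.Ioo 0 r) (y₀ := y) (y := y)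
    (g := fun n y => ((coeff n f : ℚ) : ℝ) * y ^ n)
    (g' := fun n y => ((coeff n f : ℚ) : ℝ) * (n * y ^ (n - 1))) hu isOpen_Ioo isPreconnected_Ioo
    (fun n z _ => (hasDerivAt_pow n z).const_mul _) (fun n z hz => ?_) ⟨hy.1, hr1⟩
    (hf.summable (by rw [abs_of_pos hy.1]; exact hy.2)) ⟨hy.1, hr1⟩
  · refine hasDerivAt_of_eq h (fun z => rfl) ?_
    rw [evalAt, ← tsum_div_const]
    refine tsum_congr fun n => ?_
    cases n with
    | zero => simp
    | succ n =>
      have := hy.1.ne'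
      simp only [coeff_theta, Nat.add_sub_cancel]; push_cast; field_simp; ring
  · have hz0 := hz.1.le
    rw [norm_mul, Real.norm_eq_abs, mul_assoc]
    refine mul_le_mul_of_nonneg_left ?_ (abs_nonneg _)
    rw [Real.norm_of_nonneg (by positivity)]
    cases n with
    | zero => simp
    | succ n =>
      have : ((n + 1 : ℕ) : ℝ) * r ^ (n + 1) * r⁻¹ = (n + 1 : ℕ) * r ^ n := by
        field_simp; ring
      rw [this]; simp only [Nat.add_sub_cancel]
      gcongr
      exact hz.2.le

/-- The integrating factor of `θ + c` is `y ^ c`: the derivative of `y ^ c * g` is `y ^ (c - 1) * (θ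
+ c) g`. -/
lemma hasDerivAt_zpow_mul_evalAt_divOp {f : ℚ⟦X⟧} (hf : Tame f) (c : ℤ) {y : ℝ}
    (hy : y ∈ Set.Ioo (0 : ℝ) 1) :
    HasDerivAt (fun y => y ^ c * evalAt (divOp c f) y)
      (y ^ (c - 1) * (evalAt f y - evalAt (lostTerm c f) y)) y := by
  have hy0 := hy.1.ne'
  have hy1 : |y| < 1 := by rw [abs_of_pos hy.1]; exact hy.2
  have h := (hasDerivAt_zpow c y (Or.inl hy0)).mul (hasDerivAt_evalAt (hf.divOp c) hy)
  refine hasDerivAt_of_eq h (fun z => rfl) ?_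
  have hl : Tame (lostTerm c f) := by
    unfold lostTerm; split_ifs
    · exact tame_monomial _ _
    · exact tame_zero
  have h2 : evalAt (theta (divOp c f)) y =
      evalAt f y - c * evalAt (divOp c f) y - evalAt (lostTerm c f) y := by
    have : theta (divOp c f) = f + (-c : ℚ) • divOp c f + (-1 : ℚ) • lostTerm c f := by
      rw [theta_divOp]; module
    rw [this, evalAt_add (hf.add ((hf.divOp c).smul _)) (hl.smul _) hy1,
      evalAt_add hf ((hf.divOp c).smul _) hy1, evalAt_smul, evalAt_smul]
    push_cast; ring
  rw [h2, zpow_sub_one₀ hy0]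
  field_simp
  ring

/-- Abel's theorem. -/
lemma tendsto_evalAt {f : ℚ⟦X⟧} {l : ℝ} (h : HasSum (fun n => ((coeff n f : ℚ) : ℝ)) l) :
    Tendsto (evalAt f) (𝓝[<] 1) (𝓝 l) :=
  Real.tendsto_tsum_powerSeries_nhdsWithin_lt h.tendsto_sum_nat

lemma tame_polylog (v : List Bool) : Tame (polylog v) := by
  induction v with
  | nil => exact tame_one
  | cons b v ih =>
    cases b with
    | false => exact ih.divOp 0
    | true => exact ((tame_X.mul tame_geom).mul ih).divOp 0

lemma evalAt_log {y : ℝ} (hy : |y| < 1) : evalAt (polylog [true]) y = logSing y := by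
  have h := Real.hasSum_pow_div_log_of_abs_lt_one hy
  rw [logSing, ← h.tsum_eq, evalAt, (tame_polylog [true]).summable hy |>.tsum_eq_zero_add]
  simp only [coeff_zero_polylog, Rat.cast_zero, zero_mul, zero_add]
  refine tsum_congr fun n => ?_
  simp only [polylog_true, polylog_nil, mul_one, X_mul_geom, coeff_divOp, map_sub, coeff_geom,
    coeff_one]
  simp
  ring

end BigZeta

/-! ### Multiple zeta values as sums of coefficients of polylogarithms -/

namespace BigZeta

open Filter Asymptotics Topology PowerSeries

/-- Strictly increasing `r`-tuples of positive integers less than `N`. -/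
def chains (r N : ℕ) : Finset (Fin r → ℕ) :=
  (Fintype.piFinset fun _ => Finset.range N).filter fun n => (∀ i, 0 < n i) ∧ StrictMono n

lemma mem_chains {r N : ℕ} {n : Fin r → ℕ} :
    n ∈ chains r N ↔ (∀ i, n i < N) ∧ (∀ i, 0 < n i) ∧ StrictMono n := by
  simp [chains]

lemma strictMono_snoc {r : ℕ} {n : Fin r → ℕ} {m : ℕ} :
    StrictMono (Fin.snoc n m : Fin (r + 1) → ℕ) ↔ StrictMono n ∧ ∀ i, n i < m := by
  constructor
  · intro h
    refine ⟨fun i j hij => ?_, fun i => ?_⟩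
    · have := h (Fin.castSucc_lt_castSucc_iff.mpr hij)
      simpa using this
    · have := h (Fin.castSucc_lt_last i)
      simpa using this
  · rintro ⟨h1, h2⟩ i j hij
    induction j using Fin.lastCases with
    | last =>
      obtain ⟨i, rfl⟩ := Fin.exists_castSucc_eq.mpr hij.ne
      simpa using h2 i
    | cast j =>
      obtain ⟨i, rfl⟩ := Fin.exists_castSucc_eq.mpr (hij.trans (Fin.castSucc_lt_last j)).ne
      simpa using h1 (Fin.castSucc_lt_castSucc_iff.mp hij)

lemma forall_snoc_pos {r : ℕ} {n : Fin r → ℕ} {m : ℕ} :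
    (∀ i, 0 < (Fin.snoc n m : Fin (r + 1) → ℕ) i) ↔ (∀ i, 0 < n i) ∧ 0 < m := by
  rw [Fin.forall_fin_succ']; simp

lemma snoc_mem_chains {r N : ℕ} {n : Fin r → ℕ} {m : ℕ} :
    (Fin.snoc n m : Fin (r + 1) → ℕ) ∈ chains (r + 1) N ↔ n ∈ chains r m ∧ 0 < m ∧ m < N := by
  rw [mem_chains, mem_chains, strictMono_snoc, forall_snoc_pos, Fin.forall_fin_succ']
  simp only [Fin.snoc_castSucc, Fin.snoc_last]
  constructor
  · rintro ⟨⟨_, h2⟩, ⟨h3, h4⟩, h5, h6⟩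
    exact ⟨⟨h6, h3, h5⟩, h4, h2⟩
  · rintro ⟨⟨h6, h3, h5⟩, h4, h2⟩
    exact ⟨⟨fun i => (h6 i).trans h2, h2⟩, ⟨h3, h4⟩, h5, h6⟩

/-- The term `1 / (n_1 ^ k_1 ⋯ n_r ^ k_r)`. -/
noncomputable def zetaTerm {r : ℕ} (k n : Fin r → ℕ) : ℝ := 1 / ∏ i, (n i : ℝ) ^ k i

lemma zetaTerm_nonneg {r : ℕ} (k n : Fin r → ℕ) : 0 ≤ zetaTerm k n := by
  unfold zetaTerm; positivity

lemma zetaTerm_snoc {r : ℕ} (k n : Fin r → ℕ) (a m : ℕ) :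
    zetaTerm (Fin.snoc k a : Fin (r + 1) → ℕ) (Fin.snoc n m : Fin (r + 1) → ℕ) =
      zetaTerm k n / (m : ℝ) ^ a := by
  simp [zetaTerm, Fin.prod_univ_castSucc]
  rw [mul_comm, div_eq_mul_inv]

/-- Truncated multiple zeta values: all `n_i < N`. -/
noncomputable def truncZeta {r : ℕ} (k : Fin r → ℕ) (N : ℕ) : ℝ :=
  ∑ n ∈ chains r N, zetaTerm k n

lemma truncZeta_zero (k : Fin 0 → ℕ) (N : ℕ) : truncZeta k N = 1 := by
  have : chains 0 N = {Fin.elim0} := by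
    ext n
    rw [mem_chains, Finset.mem_singleton]
    exact ⟨fun _ => Subsingleton.elim _ _, fun _ => ⟨fun i => i.elim0, fun i => i.elim0,
      fun i => i.elim0⟩⟩
  simp [truncZeta, this, zetaTerm]

lemma truncZeta_snoc {r : ℕ} (k : Fin r → ℕ) {a : ℕ} (ha : 1 ≤ a) (N : ℕ) :
    truncZeta (Fin.snoc k a : Fin (r + 1) → ℕ) N =
      ∑ m ∈ Finset.range N, truncZeta k m / (m : ℝ) ^ a := by
  -- The term `m = 0` corresponds to no tuple; it vanishes because `a ≥ 1` makes the denominator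
  -- `0`.
  have h1 : ∑ m ∈ Finset.range N, truncZeta k m / (m : ℝ) ^ a =
      ∑ m ∈ (Finset.range N).filter (0 < ·), truncZeta k m / (m : ℝ) ^ a := by
    rw [Finset.sum_filter]
    refine Finset.sum_congr rfl fun m _ => ?_
    split_ifs with h
    · rfl
    · have : m = 0 := by omega
      subst this
      rw [Nat.cast_zero, zero_pow (by omega), div_zero]
  rw [h1]
  simp only [truncZeta, Finset.sum_div]
  rw [Finset.sum_sigma']
  symm
  refine Finset.sum_bij (fun p _ => (Fin.snoc p.2 p.1 : Fin (r + 1) → ℕ)) ?_ ?_ ?_ ?_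
  · rintro ⟨m, n⟩ h
    simp only [Finset.mem_sigma, Finset.mem_filter, Finset.mem_range] at h
    exact snoc_mem_chains.mpr ⟨h.2, h.1.2, h.1.1⟩
  · rintro ⟨m, n⟩ _ ⟨m', n'⟩ _ h
    obtain ⟨h3, h4⟩ : n = n' ∧ m = m' := Fin.snoc_injective2 h
    rw [h3, h4]
  · intro n hn
    rw [← Fin.snoc_init_self n] at hn
    have h3 := snoc_mem_chains.mp hn
    exact ⟨⟨n (Fin.last r), Fin.init n⟩, by simpa using ⟨⟨h3.2.2, h3.2.1⟩, h3.1⟩,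
      Fin.snoc_init_self n⟩
  · rintro ⟨m, n⟩ _
    exact (zetaTerm_snoc k n a m).symm

/-- Tuples indexing a multiple zeta value, sorted by their last entry. -/
def chainEquiv (r : ℕ) :
    {n : Fin (r + 1) → ℕ // (∀ i, 0 < n i) ∧ StrictMono n} ≃ Σ m : ℕ, chains r (m + 1) where
  -- The last entry is positive, so it is indexed by its predecessor `m`; the other entries are then
  -- less than `m + 1`.
  toFun n := ⟨n.1 (Fin.last r) - 1, ⟨Fin.init n.1, by
    have h := n.2
    rw [← Fin.snoc_init_self n.1, strictMono_snoc, forall_snoc_pos] at h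
    rw [Nat.sub_add_cancel h.1.2, mem_chains]
    exact ⟨h.2.2, h.1.1, h.2.1⟩⟩⟩
  invFun p := ⟨Fin.snoc p.2.1 (p.1 + 1), by
    have h := mem_chains.mp p.2.2
    rw [strictMono_snoc, forall_snoc_pos]
    exact ⟨⟨h.2.1, by omega⟩, h.2.2, h.1⟩⟩
  left_inv n := by
    have h := n.2.1 (Fin.last r)
    apply Subtype.ext
    simp only [Nat.sub_add_cancel h]
    exact Fin.snoc_init_self n.1
  right_inv p := by
    obtain ⟨m, n, hn⟩ := p
    have h1 : (Fin.snoc n (m + 1) : Fin (r + 1) → ℕ) (Fin.last r) - 1 = m := by simp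
    refine Sigma.ext h1 ?_
    have h2 : ∀ (m' : ℕ) (n' : Fin r → ℕ) (hn' : n' ∈ chains r (m' + 1)), m' = m → n' = n →
        HEq (⟨n', hn'⟩ : chains r (m' + 1)) (⟨n, hn⟩ : chains r (m + 1)) := by
      rintro _ _ _ rfl rfl; rfl
    exact h2 _ _ _ h1 (by simp)

/-- Group the tuples by their last entry. The terms are nonnegative and each group is finite, so
summability of the group sums is enough. -/
lemma hasSum_multiZeta {r : ℕ} (k : Fin r → ℕ) {a : ℕ} (ha : 1 ≤ a)
    (h : Summable fun m : ℕ => truncZeta k m / (m : ℝ) ^ a) :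
    HasSum (fun m : ℕ => truncZeta k m / (m : ℝ) ^ a)
      (multiZeta (Fin.snoc k a : Fin (r + 1) → ℕ)) := by
  have h0 : truncZeta k 0 / ((0 : ℕ) : ℝ) ^ a = 0 := by
    rw [Nat.cast_zero, zero_pow (by omega), div_zero]
  have h' := (summable_nat_add_iff 1).mpr h
  let F : (Σ m : ℕ, chains r (m + 1)) → ℝ := fun p =>
    zetaTerm k p.2.1 / ((p.1 + 1 : ℕ) : ℝ) ^ a
  have hfib : ∀ m : ℕ, ∑' n : chains r (m + 1), F ⟨m, n⟩ =
      truncZeta k (m + 1) / ((m + 1 : ℕ) : ℝ) ^ a := by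
    intro m
    rw [tsum_fintype, truncZeta, Finset.sum_div,
      ← Finset.sum_coe_sort (chains r (m + 1)) fun n => zetaTerm k n / ((m + 1 : ℕ) : ℝ) ^ a]
  have hF0 : ∀ p, 0 ≤ F p := fun p => div_nonneg (zetaTerm_nonneg _ _) (by positivity)
  have hF : Summable F := by
    rw [summable_sigma_of_nonneg hF0]
    exact ⟨fun m => Summable.of_finite, h'.congr fun m => (hfib m).symm⟩
  have h3 : multiZeta (Fin.snoc k a : Fin (r + 1) → ℕ) = ∑' p, F p := by
    rw [multiZeta, ← (chainEquiv r).symm.tsum_eq]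
    refine tsum_congr fun p => ?_
    exact zetaTerm_snoc k p.2.1 a (p.1 + 1)
  have h6 : ∑' p, F p = ∑' m : ℕ, truncZeta k (m + 1) / ((m + 1 : ℕ) : ℝ) ^ a := by
    rw [hF.tsum_sigma]
    exact tsum_congr hfib
  rw [h3, h6]
  have h5 := (hasSum_nat_add_iff (f := fun m : ℕ => truncZeta k m / (m : ℝ) ^ a) 1).mp h'.hasSum
  rwa [Finset.sum_range_one, h0, add_zero] at h5

/-! ### Coefficients of polylogarithms -/

lemma coeff_X_mul_geom_mul (f : ℚ⟦X⟧) (n : ℕ) :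
    coeff n (X * geom * f) = ∑ j ∈ Finset.range n, coeff j f := by
  rw [mul_assoc]
  cases n with
  | zero => simp
  | succ n =>
    rw [coeff_succ_X_mul, coeff_mul, ← Finset.Nat.sum_antidiagonal_swap,
      Finset.Nat.sum_antidiagonal_eq_sum_range_succ_mk]
    simp

/-- `polylog v` is the generating series of the multiple zeta value with indices `k, a`. -/
def Represents (v : List Bool) {r : ℕ} (k : Fin r → ℕ) (a : ℕ) : Prop :=
  ∀ m : ℕ, ((coeff m (polylog v) : ℚ) : ℝ) = truncZeta k m / (m : ℝ) ^ a

lemma represents_log (k : Fin 0 → ℕ) : Represents [true] k 1 := by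
  intro m
  rw [polylog_true, coeff_divOp, coeff_X_mul_geom_mul, truncZeta_zero, polylog_nil]
  cases m with
  | zero => simp
  | succ m =>
    rw [Finset.sum_eq_single 0]
    · simp
    · intro j _ hj; simp [coeff_one, hj]
    · simp

lemma Represents.zero {v : List Bool} {r : ℕ} {k : Fin r → ℕ} {a : ℕ} (h : Represents v k a) :
    Represents (false :: v) k (a + 1) := by
  intro m
  rw [polylog_false, coeff_divOp]
  push_cast
  rw [h m, add_zero, pow_succ, div_div]

lemma Represents.one {v : List Bool} {r : ℕ} {k : Fin r → ℕ} {a : ℕ} (ha : 1 ≤ a)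
    (h : Represents v k a) : Represents (true :: v) (Fin.snoc k a : Fin (r + 1) → ℕ) 1 := by
  intro m
  rw [polylog_true, coeff_divOp, coeff_X_mul_geom_mul, truncZeta_snoc k ha]
  push_cast
  rw [add_zero, pow_one]
  congr 1
  exact Finset.sum_congr rfl fun j _ => h j

/-- A letter `false` in front raises the exponent of the largest summation variable; a letter `true`
introduces a new largest variable with exponent `1`. The final clause gives admissibility for words
starting with `false`. -/
lemma exists_represents {v : List Bool} (hv : GoodWord v) : v = [] ∨
    ∃ (r : ℕ) (k : Fin r → ℕ) (a : ℕ), 1 ≤ a ∧ (∀ i, 1 ≤ k i) ∧ ∑ i, k i + a = v.length ∧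
      r + 1 = v.count true ∧ Represents v k a ∧ (∀ u, v = false :: u → 2 ≤ a) := by
  induction hv with
  | nil => exact Or.inl rfl
  | @one v _ ih =>
    right
    rcases ih with rfl | ⟨r, k, a, h1, h2, h3, h4, h5, _⟩
    · exact ⟨0, Fin.elim0, 1, le_rfl, fun i => i.elim0, by simp, by simp, represents_log _,
        fun u h => by simp at h⟩
    · refine ⟨r + 1, Fin.snoc k a, 1, le_rfl, ?_, ?_, ?_, h5.one h1, fun u h => by simp at h⟩
      · rw [Fin.forall_fin_succ']; simpa using ⟨h2, h1⟩
      · simp [Fin.sum_univ_castSucc, h3]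
      · simp [h4]
  | @zero b v _ ih =>
    right
    rcases ih with h | ⟨r, k, a, h1, h2, h3, h4, h5, _⟩
    · simp at h
    · exact ⟨r, k, a + 1, by omega, h2, by simp only [List.length_cons] at h3 ⊢; omega,
        by simpa using h4, h5.zero, fun u _ => by omega⟩

lemma exists_word (r : ℕ) : ∀ (k : Fin r → ℕ) (a : ℕ), 1 ≤ a → (∀ i, 1 ≤ k i) →
    ∃ b v, GoodWord (b :: v) ∧ ∑ i, k i + a = (b :: v).length ∧ r + 1 = (b :: v).count true ∧
      Represents (b :: v) k a := by
  induction r with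
  | zero =>
    intro k a ha _
    induction a, ha using Nat.le_induction with
    | base => exact ⟨true, [], .one .nil, by simp, by simp, represents_log k⟩
    | succ a _ ih =>
      obtain ⟨b, v, h1, h2, h3, h4⟩ := ih
      exact ⟨false, b :: v, .zero h1, by simp only [List.length_cons] at h2 ⊢; omega,
        by simpa using h3, h4.zero⟩
  | succ r ihr =>
    intro k a ha hk
    induction a, ha using Nat.le_induction with
    | base =>
      obtain ⟨b, v, h1, h2, h3, h4⟩ := ihr (Fin.init k) (k (Fin.last r)) (hk _) fun i => hk _
      refine ⟨true, b :: v, .one h1, ?_, ?_, ?_⟩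
      · rw [Fin.sum_univ_castSucc]
        simp only [List.length_cons, Fin.init] at h2 ⊢; omega
      · simp [h3]
      · have := h4.one (hk _)
        rwa [Fin.snoc_init_self] at this
    | succ a _ ih =>
      obtain ⟨b, v, h1, h2, h3, h4⟩ := ih
      exact ⟨false, b :: v, .zero h1, by simp only [List.length_cons] at h2 ⊢; omega,
        by simpa using h3, h4.zero⟩

lemma coeff_polylog_nonneg (v : List Bool) (m : ℕ) : 0 ≤ coeff m (polylog v) := by
  induction v generalizing m with
  | nil => rw [polylog_nil, coeff_one]; split_ifs <;> simp
  | cons b v ih =>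
    cases b with
    | false => rw [polylog_false, coeff_divOp]; have := ih m; simp; positivity
    | true =>
      rw [polylog_true, coeff_divOp, coeff_X_mul_geom_mul]
      have := Finset.sum_nonneg fun j (_ : j ∈ Finset.range m) => ih j
      simp only [Int.cast_zero, add_zero]
      positivity

/-- Each letter costs at most one factor `h = 1 + ∑ 1 / j`: for `true`, the bounds for `j < m`, each
a power of `h` times `1 / j`, are added up. Logarithmic growth is all that convergence requires. -/
lemma coeff_polylog_le (v : List Bool) (hv : v ≠ []) (m : ℕ) :
    coeff m (polylog v) ≤ (1 + ∑ j ∈ Finset.range m, (1 : ℚ) / j) ^ v.length / m := by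
  have hh : ∀ m : ℕ, (1 : ℚ) ≤ 1 + ∑ j ∈ Finset.range m, (1 : ℚ) / j := fun m => by
    have : 0 ≤ ∑ j ∈ Finset.range m, (1 : ℚ) / j := Finset.sum_nonneg fun j _ => by positivity
    linarith
  induction v generalizing m with
  | nil => exact absurd rfl hv
  | cons b v ih =>
    set h := 1 + ∑ j ∈ Finset.range m, (1 : ℚ) / j with hdef
    cases m with
    | zero => simpa using (coeff_zero_polylog b v).le
    | succ m =>
    have h1 : 1 ≤ h := hh (m + 1)
    have hm : (1 : ℚ) ≤ ((m + 1 : ℕ) : ℚ) := by exact_mod_cast Nat.le_add_left 1 m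
    rcases eq_or_ne v [] with rfl | hne
    · cases b with
      | false =>
        rw [polylog_false, coeff_divOp, polylog_nil, coeff_one]
        simp only [Nat.add_eq_zero_iff, one_ne_zero, and_false, if_false, zero_div]
        positivity
      | true =>
        have := represents_log Fin.elim0 (m + 1)
        rw [truncZeta_zero, pow_one] at this
        have h2 : coeff (m + 1) (polylog [true]) = 1 / ((m + 1 : ℕ) : ℚ) := by
          apply Rat.cast_injective (α := ℝ)
          rw [this]; push_cast; rfl
        rw [h2]
        gcongr
        simpa using h1
    · cases b with
      | false =>
        rw [polylog_false, coeff_divOp]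
        simp only [Int.cast_zero, add_zero, List.length_cons]
        gcongr
        refine (ih hne (m + 1)).trans ((div_le_self (by positivity) hm).trans ?_)
        exact pow_le_pow_right₀ h1 (Nat.le_succ _)
      | true =>
        rw [polylog_true, coeff_divOp, coeff_X_mul_geom_mul]
        simp only [Int.cast_zero, add_zero, List.length_cons]
        gcongr
        calc ∑ j ∈ Finset.range (m + 1), coeff j (polylog v)
            ≤ ∑ j ∈ Finset.range (m + 1), h ^ v.length * (1 / (j : ℚ)) := by
              refine Finset.sum_le_sum fun j hj => (ih hne j).trans ?_
              rw [div_eq_mul_one_div]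
              refine mul_le_mul_of_nonneg_right ?_ (by positivity)
              refine pow_le_pow_left₀ (by linarith [hh j]) ?_ _
              rw [hdef]
              refine add_le_add le_rfl (Finset.sum_le_sum_of_subset_of_nonneg ?_
                fun i _ _ => by positivity)
              rw [Finset.mem_range] at hj
              exact Finset.range_subset_range.mpr hj.le
          _ = h ^ v.length * (h - 1) := by rw [← Finset.mul_sum, hdef]; ring
          _ ≤ h ^ (v.length + 1) := by
              rw [pow_succ]
              exact mul_le_mul_of_nonneg_left (by linarith) (by positivity)

lemma sum_inv_le_log (m : ℕ) (hm : 1 ≤ m) :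
    ((∑ j ∈ Finset.range m, (1 : ℚ) / j : ℚ) : ℝ) ≤ 1 + Real.log m := by
  obtain ⟨m, rfl⟩ : ∃ k, m = k + 1 := ⟨m - 1, by omega⟩
  have h1 : ∑ j ∈ Finset.range (m + 1), (1 : ℚ) / j = harmonic m := by
    rw [Finset.sum_range_succ', harmonic]; simp
  rw [h1]
  refine (harmonic_le_one_add_log m).trans ?_
  rcases Nat.eq_zero_or_pos m with h | h
  · subst h; simp
  · have : (0 : ℝ) < m := by exact_mod_cast h
    gcongr; linarith

/-- The leading `false` supplies a second factor `1 / m`, so the coefficients are `O (log m ^ r / m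
^ 2)`. -/
lemma summable_coeff_polylog_false {v : List Bool} (hv : v ≠ []) :
    Summable fun m => ((coeff m (polylog (false :: v)) : ℚ) : ℝ) := by
  set r := v.length
  have hO : (fun m : ℕ => ((coeff m (polylog (false :: v)) : ℚ) : ℝ)) =O[atTop]
      fun m : ℕ => (m : ℝ) ^ (-(3 / 2) : ℝ) := by
    have h1 : (fun m : ℕ => ((coeff m (polylog (false :: v)) : ℚ) : ℝ)) =O[atTop]
        fun m : ℕ => (Real.log m) ^ (r : ℝ) * (m : ℝ) ^ (-2 : ℝ) := by
      refine IsBigO.of_bound (3 ^ r) ?_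
      filter_upwards [eventually_ge_atTop 3] with m hm
      have hm3 : (3 : ℝ) ≤ m := by exact_mod_cast hm
      have hm0 : (0 : ℝ) < m := by linarith
      have hlog : 1 ≤ Real.log m := by
        rw [Real.le_log_iff_exp_le hm0]
        exact Real.exp_one_lt_three.le.trans hm3
      have h2 : ((coeff m (polylog v) : ℚ) : ℝ) ≤ (3 * Real.log m) ^ r / m := by
        have h3 : ((coeff m (polylog v) : ℚ) : ℝ) ≤
            (((1 + ∑ j ∈ Finset.range m, (1 : ℚ) / j) ^ r / m : ℚ) : ℝ) := by
          exact_mod_cast coeff_polylog_le v hv m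
        refine h3.trans ?_
        push_cast
        have h4 := sum_inv_le_log m (by omega)
        push_cast at h4
        gcongr
        linarith
      rw [polylog_false, coeff_divOp]
      push_cast
      rw [Real.rpow_natCast, add_zero, Real.rpow_neg hm0.le, Real.rpow_two]
      have h5 : (0 : ℝ) ≤ ((coeff m (polylog v) : ℚ) : ℝ) := by
        exact_mod_cast coeff_polylog_nonneg v m
      rw [Real.norm_of_nonneg (by positivity), Real.norm_of_nonneg (by positivity)]
      calc ((coeff m (polylog v) : ℚ) : ℝ) / m ≤ (3 * Real.log m) ^ r / m / m := by gcongr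
        _ = 3 ^ r * (Real.log m ^ r * ((m : ℝ) ^ 2)⁻¹) := by rw [mul_pow]; field_simp
    refine h1.trans ?_
    have h2 : (fun m : ℕ => (Real.log m) ^ (r : ℝ)) =O[atTop] fun m : ℕ => (m : ℝ) ^ (1 / 2 : ℝ) :=
      ((isLittleO_log_rpow_rpow_atTop (r : ℝ) (by norm_num : (0 : ℝ) < 1 / 2)).isBigO).comp_tendsto
        tendsto_natCast_atTop_atTop
    refine (h2.mul (isBigO_refl _ _)).trans_eventuallyEq ?_
    filter_upwards [eventually_gt_atTop 0] with m hm
    have hm0 : (0 : ℝ) < m := by exact_mod_cast hm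
    rw [← Real.rpow_add hm0]; norm_num
  exact summable_of_isBigO_nat (Real.summable_nat_rpow.mpr (by norm_num)) hO

end BigZeta

/-! ### Expansions of polylogarithms at `1` and products of multiple zeta values -/

namespace BigZeta

open Filter Asymptotics Topology PowerSeries

lemma multiZetaSpan_mono {w d w' d' : ℕ} (hw : w ≤ w') (hd : d ≤ d') :
    multiZetaSpan w d ≤ multiZetaSpan w' d' := by
  refine Submodule.span_mono ?_
  rintro x ⟨r, k, h1, h2, h3, h4⟩
  exact ⟨r, k, h1, h2.trans hw, h3.trans hd, h4⟩

lemma multiZeta_fin_zero (k : Fin 0 → ℕ) : multiZeta k = 1 := by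
  have : Unique {n : Fin 0 → ℕ // (∀ i, 0 < n i) ∧ StrictMono n} :=
    { default := ⟨Fin.elim0, fun i => i.elim0, fun i => i.elim0⟩
      uniq := fun a => Subtype.ext (Subsingleton.elim _ _) }
  rw [multiZeta, tsum_fintype, Fintype.sum_unique]
  simp

lemma one_mem_multiZetaSpan (w d : ℕ) : (1 : ℝ) ∈ multiZetaSpan w d :=
  Submodule.subset_span ⟨0, Fin.elim0, ⟨fun i => i.elim0, fun i => i.elim0⟩, by simp,
    by omega, (multiZeta_fin_zero _).symm⟩

lemma hasSum_coeff_polylog_false {v : List Bool} (hv : GoodWord (false :: v)) :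
    ∃ l ∈ multiZetaSpan (v.length + 1) (v.count true),
      HasSum (fun n => ((coeff n (polylog (false :: v)) : ℚ) : ℝ)) l := by
  rcases exists_represents hv with h | ⟨r, k, a, h1, h2, h3, h4, h5, h6⟩
  · simp at h
  refine ⟨multiZeta (Fin.snoc k a : Fin (r + 1) → ℕ), Submodule.subset_span
    ⟨r + 1, Fin.snoc k a, ⟨?_, ?_⟩, ?_, ?_, rfl⟩, ?_⟩
  · rw [Fin.forall_fin_succ']; simpa using ⟨h2, h1⟩
  · intro i hi
    have : i = Fin.last r := by ext; simp; omega
    subst this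
    simpa using h6 v rfl
  · simpa [Fin.sum_univ_castSucc] using h3.le
  · simpa using h4.le
  · have hne : v ≠ [] := by rintro rfl; cases hv
    have hs := summable_coeff_polylog_false hne
    have h7 := hasSum_multiZeta k h1 (hs.congr h5)
    rw [funext h5]; exact h7

/-- The families over a point with coefficients in `V`. -/
noncomputable def scalarModule (V : Submodule ℚ ℝ) : Submodule ℚ (Unit → ℝ) :=
  V.comap (LinearMap.proj () : (Unit → ℝ) →ₗ[ℚ] ℝ)

lemma mem_scalarModule {V : Submodule ℚ ℝ} {v : Unit → ℝ} : v ∈ scalarModule V ↔ v () ∈ V :=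
  Iff.rfl

lemma scalarModule_mono {V W : Submodule ℚ ℝ} (h : V ≤ W) : scalarModule V ≤ scalarModule W :=
  Submodule.comap_mono h

lemma abs_lt_one_of_mem_Ioo {y : ℝ} (hy : y ∈ Set.Ioo (0 : ℝ) 1) : |y| < 1 := by
  rw [abs_of_pos hy.1]; exact hy.2

/-- Power series whose sum has an asymptotic expansion at `1` with coefficients in `V`. -/
noncomputable def expanding (V : Submodule ℚ ℝ) : Submodule ℚ ℚ⟦X⟧ where
  carrier := {f | Tame f ∧ (fun y _ => evalAt f y) ∈ expansible (scalarModule V)}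
  zero_mem' := ⟨tame_zero, by simp only [evalAt_zero]; exact zero_mem _⟩
  add_mem' := by
    rintro f g ⟨hf, hf'⟩ ⟨hg, hg'⟩
    refine ⟨hf.add hg, expansible_congr (fun x => ?_) (add_mem hf' hg')⟩
    filter_upwards [eventually_mem_Ioo] with y hy
    exact (evalAt_add hf hg (abs_lt_one_of_mem_Ioo hy)).symm
  smul_mem' := by
    rintro c f ⟨hf, hf'⟩
    refine ⟨hf.smul c, expansible_congr (fun x => ?_) (Submodule.smul_mem _ c hf')⟩
    refine Eventually.of_forall fun y => ?_
    simp [evalAt_smul, Rat.smul_def]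

variable {V W : Submodule ℚ ℝ}

lemma expanding_mono (h : V ≤ W) : expanding V ≤ expanding W :=
  fun _ hf => ⟨hf.1, expansible_mono (scalarModule_mono h) hf.2⟩

lemma one_mem_expanding (h : 1 ∈ V) : 1 ∈ expanding V := by
  refine ⟨tame_one, ?_⟩
  simp only [evalAt_one]
  exact const_mem_expansible (v := fun _ => 1) h

lemma X_mul_mem_expanding {f : ℚ⟦X⟧} (hf : f ∈ expanding V) : X * f ∈ expanding V := by
  refine ⟨tame_X.mul hf.1, expansible_congr (fun x => ?_) (expansible_mul_self hf.2)⟩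
  filter_upwards [eventually_mem_Ioo] with y hy
  rw [evalAt_mul tame_X hf.1 (abs_lt_one_of_mem_Ioo hy), evalAt_X]

lemma geom_mul_mem_expanding {f : ℚ⟦X⟧} (hf : f ∈ expanding V) : geom * f ∈ expanding V := by
  refine ⟨tame_geom.mul hf.1, expansible_congr (fun x => ?_) (expansible_zpow_mul (-1) hf.2)⟩
  filter_upwards [eventually_mem_Ioo] with y hy
  have h := abs_lt_one_of_mem_Ioo hy
  rw [evalAt_mul tame_geom hf.1 h, evalAt_geom h, zpow_neg_one]

lemma log_mul_mem_expanding {f : ℚ⟦X⟧} (hf : f ∈ expanding V) :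
    polylog [true] * f ∈ expanding V := by
  have hL := tame_polylog [true]
  refine ⟨hL.mul hf.1, expansible_congr (fun x => ?_) (expansible_logSing_mul hf.2)⟩
  filter_upwards [eventually_mem_Ioo] with y hy
  have h := abs_lt_one_of_mem_Ioo hy
  rw [evalAt_mul hL hf.1 h, evalAt_log h]

lemma limit_mem_of_expanding {f : ℚ⟦X⟧} (hf : f ∈ expanding V) {l : ℝ}
    (hl : Tendsto (evalAt f) (𝓝[<] 1) (𝓝 l)) : l ∈ V :=
  mem_scalarModule.mp (limit_mem_of_expansible (l := fun _ => l) hf.2 fun _ => hl)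

/-- Termwise integration with a convergent value at `1`. -/
lemma divOp_zero_mem_expanding {f : ℚ⟦X⟧} (hf : f ∈ expanding V) (h0 : coeff 0 f = 0)
    (hl : ∃ l ∈ V, HasSum (fun n => ((coeff n (divOp 0 f) : ℚ) : ℝ)) l) :
    divOp 0 f ∈ expanding V := by
  refine ⟨hf.1.divOp 0, ?_⟩
  obtain ⟨l, hl, hsum⟩ := hl
  have hlost : lostTerm 0 f = 0 := by simp [lostTerm, h0]
  obtain ⟨K, hK⟩ := exists_const_of_hasDerivAt (V := scalarModule V)
    (b := fun y _ => evalAt (divOp 0 f) y) (a := fun y _ => y ^ (-1 : ℤ) * evalAt f y)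
    (fun _ y hy => by
      have := hasDerivAt_zpow_mul_evalAt_divOp hf.1 0 hy
      simp only [hlost, evalAt_zero, sub_zero, zpow_zero, one_mul, zero_sub] at this
      exact this)
    (expansible_self_zpow_mul (-1) hf.2)
  -- By Abel's theorem the expansible part tends to `l - K`, which is thus in `V`; so the constant
  -- `K` is `l` minus an element of `V`.
  have h1 := limit_mem_of_expansible (l := fun x => l - K x) hK
    fun x => (tendsto_evalAt hsum).sub_const (K x)
  have h2 : K ∈ scalarModule V := by
    have := sub_mem hl (mem_scalarModule.mp h1)
    rwa [sub_sub_cancel] at this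
  refine expansible_congr (fun x => ?_) (add_mem hK (const_mem_expansible h2))
  exact Eventually.of_forall fun y => by simp

lemma goodWord_append_of_true {m : ℕ} {v : List Bool}
    (h : GoodWord (List.replicate m true ++ v)) : GoodWord v := by
  induction m with
  | zero => simpa using h
  | succ m ih =>
    rw [List.replicate_succ, List.cons_append] at h
    cases h with
    | one h => exact ih h

lemma eq_replicate_append (v : List Bool) :
    ∃ m, v = List.replicate m true ∨ ∃ u, v = List.replicate m true ++ false :: u := by
  induction v with
  | nil => exact ⟨0, Or.inl rfl⟩
  | cons b v ih =>
    cases b with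
    | false => exact ⟨0, Or.inr ⟨v, rfl⟩⟩
    | true =>
      obtain ⟨m, rfl | ⟨u, rfl⟩⟩ := ih
      · exact ⟨m + 1, Or.inl rfl⟩
      · exact ⟨m + 1, Or.inr ⟨u, rfl⟩⟩

/-- Shuffle regularization, by induction on the length and, for fixed length, on the initial block
of letters `true`. A word starting with `false` converges at `1`, so the expansion of its tail can
be integrated. A longer block is obtained from `log_mul_polylog_block`: the logarithm times a
shorter word, minus words with a shorter block, divided by `m + 1`. -/
lemma polylog_mem_expanding {v : List Bool} (hv : GoodWord v) :
    polylog v ∈ expanding (multiZetaSpan v.length (v.count true)) := by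
  obtain ⟨n, hn⟩ : ∃ n, v.length = n := ⟨_, rfl⟩
  induction n using Nat.strong_induction_on generalizing v with
  | _ n ih =>
  subst hn
  obtain ⟨m, rfl | ⟨u, rfl⟩⟩ := eq_replicate_append v
  · clear ih hv
    have h : polylog (List.replicate m true) ∈ expanding (multiZetaSpan 0 0) := by
      induction m with
      | zero => exact one_mem_expanding (one_mem_multiZetaSpan 0 0)
      | succ m ih =>
        have h1 := Submodule.smul_mem _ (((m + 1 : ℕ) : ℚ)⁻¹) (log_mul_mem_expanding ih)
        rwa [log_mul_log_pow, smul_smul, inv_mul_cancel₀ (by exact_mod_cast Nat.succ_ne_zero m),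
          one_smul] at h1
    exact expanding_mono (multiZetaSpan_mono (by omega) (by omega)) h
  · induction m generalizing u with
    | zero =>
      simp only [List.replicate_zero, List.nil_append] at hv ih ⊢
      obtain ⟨l, hl, hsum⟩ := hasSum_coeff_polylog_false hv
      cases hv with
      | @zero b v hv =>
      have h1 := ih _ (by simp) hv rfl
      refine divOp_zero_mem_expanding (expanding_mono (multiZetaSpan_mono (by simp) (by simp)) h1)
        (coeff_zero_polylog b v) ⟨l, ?_, hsum⟩
      simpa using hl
    | succ m ihm =>
      have hu : GoodWord (false :: u) := goodWord_append_of_true hv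
      have hmu : GoodWord (List.replicate m true ++ false :: u) := by
        rw [List.replicate_succ, List.cons_append] at hv
        cases hv with
        | one h => exact h
      set M := multiZetaSpan (List.replicate (m + 1) true ++ false :: u).length
        ((List.replicate (m + 1) true ++ false :: u).count true) with hM
      have h1 : polylog (List.replicate m true ++ false :: u) ∈ expanding M := by
        refine expanding_mono (multiZetaSpan_mono ?_ ?_) (ih _ ?_ hmu rfl)
        · simp
        · simp
        · simp
      have h2 := log_mul_mem_expanding h1
      have h3 := log_mul_polylog_block m hu
      have h4 : ∀ f ∈ Submodule.span ℚ {f | ∃ v, GoodWord (List.replicate m true ++ false :: v) ∧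
          v.length = u.length + 1 ∧ v.count true = u.count true + 1 ∧
          f = polylog (List.replicate m true ++ false :: v)}, f ∈ expanding M := by
        intro f hf
        refine Submodule.span_le.mpr ?_ hf
        rintro _ ⟨v, hv, h5, h6, rfl⟩
        refine expanding_mono (multiZetaSpan_mono ?_ ?_) (ihm v hv ?_)
        · simp [h5]; omega
        · simp [h6]; omega
        · intro k hk v' hv' hl
          refine ih k ?_ hv' hl
          simp only [List.length_append, List.length_replicate, List.length_cons] at hk ⊢
          omega
      have h5 := sub_mem h2 (h4 _ h3)
      rw [sub_sub_cancel] at h5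
      have h6 := Submodule.smul_mem _ (((m + 1 : ℕ) : ℚ)⁻¹) h5
      rwa [smul_smul, inv_mul_cancel₀ (by exact_mod_cast Nat.succ_ne_zero m), one_smul] at h6

lemma polylogSpan_le_expanding (w d : ℕ) : polylogSpan w d ≤ expanding (multiZetaSpan w d) := by
  refine Submodule.span_le.mpr ?_
  rintro _ ⟨v, hv, rfl, rfl, rfl⟩
  exact polylog_mem_expanding hv

lemma multiZeta_generator {r : ℕ} {k : Fin r → ℕ} (hk : IsAdmissible k) :
    ∃ v, GoodWord v ∧ ∑ i, k i = v.length ∧ r = v.count true ∧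
      HasSum (fun n => ((coeff n (polylog v) : ℚ) : ℝ)) (multiZeta k) := by
  cases r with
  | zero =>
    refine ⟨[], .nil, by simp, by simp, ?_⟩
    rw [multiZeta_fin_zero]
    convert hasSum_single (f := fun n => ((coeff n (polylog []) : ℚ) : ℝ)) 0 ?_ using 1
    · simp
    · intro n hn; simp [coeff_one, hn]
  | succ r =>
    have ha : 2 ≤ k (Fin.last r) := hk.2 _ rfl
    obtain ⟨b, v, h1, h2, h3, h4⟩ := exists_word r (Fin.init k) (k (Fin.last r) - 1) (by omega)
      fun i => hk.1 _
    refine ⟨false :: b :: v, .zero h1, ?_, by simpa using h3, ?_⟩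
    · rw [Fin.sum_univ_castSucc]
      simp only [List.length_cons, Fin.init] at h2 ⊢; omega
    · have h5 := h4.zero
      rw [Nat.sub_add_cancel (by omega)] at h5
      have h6 := hasSum_multiZeta (Fin.init k) (by omega)
        ((summable_coeff_polylog_false (List.cons_ne_nil b v)).congr h5)
      rw [Fin.snoc_init_self] at h6
      rw [funext h5]; exact h6

/-- The product is the limit at `1` of a product of two polylogarithms. The shuffle product is a
combination of polylogarithms, and a limit of such a combination is in the span of the expansion
coefficients, whether or not its single terms converge. -/
lemma mul_mem_multiZetaSpan {w d w' d' : ℕ} {x y : ℝ} (hx : x ∈ multiZetaSpan w d)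
    (hy : y ∈ multiZetaSpan w' d') : x * y ∈ multiZetaSpan (w + w') (d + d') := by
  induction hx using Submodule.span_induction with
  | zero => rw [zero_mul]; exact zero_mem _
  | add a b _ _ h1 h2 => rw [add_mul]; exact add_mem h1 h2
  | smul c a _ h => rw [smul_mul_assoc]; exact Submodule.smul_mem _ _ h
  | mem x hx =>
  induction hy using Submodule.span_induction with
  | zero => rw [mul_zero]; exact zero_mem _
  | add a b _ _ h1 h2 => rw [mul_add]; exact add_mem h1 h2
  | smul c a _ h => rw [mul_smul_comm]; exact Submodule.smul_mem _ _ h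
  | mem y hy =>
  obtain ⟨r, k, hk, hw, hd, rfl⟩ := hx
  obtain ⟨r', k', hk', hw', hd', rfl⟩ := hy
  obtain ⟨u, hu, hu1, hu2, hu3⟩ := multiZeta_generator hk
  obtain ⟨v, hv, hv1, hv2, hv3⟩ := multiZeta_generator hk'
  refine multiZetaSpan_mono (w := u.length + v.length) (d := u.count true + v.count true)
    (by omega) (by omega) ?_
  refine limit_mem_of_expanding
    (polylogSpan_le_expanding _ _ (polylog_mul_mem_polylogSpan hu hv)) ?_
  refine ((tendsto_evalAt hu3).mul (tendsto_evalAt hv3)).congr' ?_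
  filter_upwards [eventually_mem_Ioo] with y hy
  exact (evalAt_mul (tame_polylog u) (tame_polylog v) (abs_lt_one_of_mem_Ioo hy)).symm

end BigZeta

/-! ### Polylogarithms with poles at `1`: stability under `(θ + c)⁻¹` -/

namespace BigZeta

open Filter Asymptotics Topology PowerSeries

/-- The span of the power series `X ^ a * geom ^ b * polylog v` of bounded weight and depth, where
a power of `geom` counts for depth `1`. -/
noncomputable def polarSpan (w d : ℕ) : Submodule ℚ ℚ⟦X⟧ :=
  Submodule.span ℚ {f | ∃ (a b : ℕ) (v : List Bool), v.length ≤ w ∧ v.count true + min b 1 ≤ d ∧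
    f = X ^ a * (geom ^ b * polylog v)}

lemma polarSpan_mono {w d w' d' : ℕ} (hw : w ≤ w') (hd : d ≤ d') :
    polarSpan w d ≤ polarSpan w' d' := by
  refine Submodule.span_mono ?_
  rintro _ ⟨a, b, v, h1, h2, rfl⟩
  exact ⟨a, b, v, h1.trans hw, h2.trans hd, rfl⟩

lemma span_mul_mem {s : Set ℚ⟦X⟧} {S : Submodule ℚ ℚ⟦X⟧} {g : ℚ⟦X⟧} (h : ∀ f ∈ s, g * f ∈ S)
    {f : ℚ⟦X⟧} (hf : f ∈ Submodule.span ℚ s) : g * f ∈ S := by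
  induction hf using Submodule.span_induction with
  | mem f hf => exact h f hf
  | zero => rw [mul_zero]; exact zero_mem _
  | add a b _ _ h1 h2 => rw [mul_add]; exact add_mem h1 h2
  | smul c a _ h => rw [mul_smul_comm]; exact Submodule.smul_mem _ _ h

lemma X_pow_mul_mem_polarSpan {w d : ℕ} (N : ℕ) {f : ℚ⟦X⟧} (hf : f ∈ polarSpan w d) :
    X ^ N * f ∈ polarSpan w d := by
  refine span_mul_mem ?_ hf
  rintro _ ⟨a, b, v, h1, h2, rfl⟩
  exact Submodule.subset_span ⟨N + a, b, v, h1, h2, by ring⟩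

/-- Power series that belong to `polarSpan w d` up to a power of `X`. -/
noncomputable def polarClass (w d : ℕ) : Submodule ℚ ℚ⟦X⟧ where
  carrier := {f | ∃ N : ℕ, X ^ N * f ∈ polarSpan w d}
  zero_mem' := ⟨0, by simp⟩
  add_mem' := by
    rintro f g ⟨N, hf⟩ ⟨M, hg⟩
    refine ⟨N + M, ?_⟩
    have h1 := X_pow_mul_mem_polarSpan M hf
    have h2 := X_pow_mul_mem_polarSpan N hg
    convert add_mem h1 h2 using 1
    ring
  smul_mem' := by
    rintro c f ⟨N, hf⟩
    refine ⟨N, ?_⟩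
    rw [mul_smul_comm]
    exact Submodule.smul_mem _ c hf

variable {w d : ℕ} {f : ℚ⟦X⟧}

lemma polarClass_mono {w' d' : ℕ} (hw : w ≤ w') (hd : d ≤ d') :
    polarClass w d ≤ polarClass w' d' := by
  rintro f ⟨N, hf⟩
  exact ⟨N, polarSpan_mono hw hd hf⟩

lemma polarSpan_le_polarClass : polarSpan w d ≤ polarClass w d :=
  fun f hf => ⟨0, by simpa using hf⟩

lemma X_pow_mul_mem_polarClass_iff {N : ℕ} : X ^ N * f ∈ polarClass w d ↔ f ∈ polarClass w d := by
  constructor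
  · rintro ⟨M, h⟩
    exact ⟨M + N, by rwa [pow_add, mul_assoc]⟩
  · rintro ⟨M, h⟩
    refine ⟨M, ?_⟩
    rw [mul_left_comm]
    exact X_pow_mul_mem_polarSpan N h

lemma X_mul_mem_polarClass_iff : X * f ∈ polarClass w d ↔ f ∈ polarClass w d := by
  simpa using X_pow_mul_mem_polarClass_iff (N := 1) (f := f)

lemma geom_pow_mul_polylog_mem_polarClass (b : ℕ) {v : List Bool} (hw : v.length ≤ w)
    (hd : v.count true + min b 1 ≤ d) : geom ^ b * polylog v ∈ polarClass w d :=
  polarSpan_le_polarClass (Submodule.subset_span ⟨0, b, v, hw, hd, by simp⟩)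

lemma monomial_mem_polarClass (n : ℕ) (r : ℚ) : monomial n r ∈ polarClass w d := by
  have h := geom_pow_mul_polylog_mem_polarClass (w := w) (d := d) 0 (v := []) (by simp) (by simp)
  have h1 := Submodule.smul_mem _ r (X_pow_mul_mem_polarClass_iff (N := n).mpr h)
  convert h1 using 1
  ext m
  simp [coeff_monomial, coeff_X_pow]

lemma lostTerm_mem_polarClass (c : ℤ) (f : ℚ⟦X⟧) : lostTerm c f ∈ polarClass w d := by
  unfold lostTerm
  split_ifs
  · exact monomial_mem_polarClass _ _
  · exact zero_mem _

lemma theta_geom_pow_mul (b : ℕ) (f : ℚ⟦X⟧) : theta (geom ^ b * f) =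
    (b : ℚ) • (geom ^ (b + 1) * f) - (b : ℚ) • (geom ^ b * f) + geom ^ b * theta f := by
  rw [Derivation.leibniz, Derivation.leibniz_pow, theta_geom]
  simp only [smul_eq_mul, nsmul_eq_mul, Algebra.smul_def]
  cases b with
  | zero => simp
  | succ b => simp; ring

/-- The hypothesis concerns `theta (polylog v)`, which involves a shorter word. Integration by parts
reduces to it: directly when there is no pole, and by lowering the order of the pole when `b ≥ 2`. A
simple pole produces the new letter `true`, and for this a factor `geom` has been counted in the
depth. -/
lemma divOp_geom_pow_mul_polylog_of_theta {v : List Bool}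
    (h : ∀ (c : ℤ) (b : ℕ), divOp c (geom ^ b * theta (polylog v)) ∈
      polarClass (v.length + 1) (v.count true + min b 1)) (c : ℤ) (b : ℕ) :
    divOp c (geom ^ b * polylog v) ∈ polarClass (v.length + 1) (v.count true + min b 1) := by
  have zero : ∀ c : ℤ, divOp c (polylog v) ∈ polarClass (v.length + 1) (v.count true) := by
    intro c
    rcases eq_or_ne c 0 with rfl | hc
    · have := geom_pow_mul_polylog_mem_polarClass (w := v.length + 1) (d := v.count true) 0
        (v := false :: v) (by simp) (by simp)
      simpa using this
    · have h1 := divOp_theta c (polylog v)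
      have h2 : divOp c (polylog v) =
          (c : ℚ)⁻¹ • (polylog v - divOp c (theta (polylog v)) - lostTerm c (polylog v)) := by
        rw [h1, eq_inv_smul_iff₀ (by exact_mod_cast hc)]; abel
      rw [h2]
      refine Submodule.smul_mem _ _ (sub_mem (sub_mem ?_ ?_) (lostTerm_mem_polarClass _ _))
      · simpa using geom_pow_mul_polylog_mem_polarClass (w := v.length + 1) (d := v.count true) 0
          (v := v) (by simp) (by simp)
      · simpa using h c 0
  have one : ∀ c : ℤ, divOp c (geom * polylog v) ∈
      polarClass (v.length + 1) (v.count true + 1) := by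
    have hz := fun c => polarClass_mono le_rfl (Nat.le_succ _) (zero c)
    have hg : geom = X * geom + 1 := by rw [X_mul_geom]; ring
    -- The identity `1 / (1 - X) = X / (1 - X) + 1` moves `c` by one, so all cases follow from `c =
    -- 0`.
    have step : ∀ c : ℤ, divOp c (geom * polylog v) =
        X * divOp (c + 1) (geom * polylog v) + divOp c (polylog v) := by
      intro c
      rw [← divOp_X_mul, ← map_add]
      congr 1
      nth_rewrite 1 [hg]
      ring
    intro c
    induction c using Int.induction_on with
    | zero =>
      have h1 : divOp 0 (geom * polylog v) = polylog (true :: v) + divOp 0 (polylog v) := by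
        rw [polylog_true, ← map_add]
        congr 1
        nth_rewrite 1 [hg]
        ring
      rw [h1]
      refine add_mem ?_ (hz 0)
      simpa using geom_pow_mul_polylog_mem_polarClass (w := v.length + 1)
        (d := v.count true + 1) 0 (v := true :: v) (by simp) (by simp)
    | succ i ih =>
      rw [step] at ih
      have := sub_mem ih (hz i)
      rw [add_sub_cancel_right] at this
      exact X_mul_mem_polarClass_iff.mp this
    | pred i ih =>
      rw [step, sub_add_cancel]
      exact add_mem (X_mul_mem_polarClass_iff.mpr ih) (hz _)
  induction b with
  | zero => simpa using zero c
  | succ b ih =>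
    rcases Nat.eq_zero_or_pos b with rfl | hb
    · simpa using one c
    · have hmin : min (b + 1) 1 = min b 1 := by omega
      rw [hmin]
      -- Since `θ (geom ^ b) = b (geom ^ (b + 1) - geom ^ b)`, a pole of order `b + 1` is traded for
      -- one of order `b`.
      have h1 := congrArg (divOp c) (theta_geom_pow_mul b (polylog v))
      rw [divOp_theta] at h1
      simp only [map_add, map_sub, map_smul] at h1
      have hb0 : (b : ℚ) ≠ 0 := by exact_mod_cast hb.ne'
      have h2 : divOp c (geom ^ (b + 1) * polylog v) = (b : ℚ)⁻¹ •
          (geom ^ b * polylog v - (c : ℚ) • divOp c (geom ^ b * polylog v) -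
            lostTerm c (geom ^ b * polylog v) + (b : ℚ) • divOp c (geom ^ b * polylog v) -
            divOp c (geom ^ b * theta (polylog v))) := by
        rw [h1, eq_inv_smul_iff₀ hb0]; abel
      rw [h2]
      refine Submodule.smul_mem _ _ (sub_mem (add_mem (sub_mem (sub_mem ?_ ?_) ?_) ?_) (h c b))
      · exact geom_pow_mul_polylog_mem_polarClass b (by simp) le_rfl
      · exact Submodule.smul_mem _ _ ih
      · exact lostTerm_mem_polarClass _ _
      · exact Submodule.smul_mem _ _ ih

/-- Applying `θ` turns a leading `true` into one more factor `geom`. The depth does not increase,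
because a pole of any order counts once. -/
lemma divOp_geom_pow_mul_polylog (v : List Bool) (c : ℤ) (b : ℕ) :
    divOp c (geom ^ b * polylog v) ∈ polarClass (v.length + 1) (v.count true + min b 1) := by
  rcases goodWord_or_polylog_eq_zero v with hv | h
  · induction hv generalizing c b with
    | nil =>
      refine divOp_geom_pow_mul_polylog_of_theta (fun c b => ?_) c b
      simp
    | @one v hv ih =>
      refine divOp_geom_pow_mul_polylog_of_theta (fun c b => ?_) c b
      rw [theta_polylog_true, show geom ^ b * (X * geom * polylog v) =
        X * (geom ^ (b + 1) * polylog v) by ring, divOp_X_mul]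
      refine X_mul_mem_polarClass_iff.mpr (polarClass_mono ?_ ?_ (ih (c + 1) (b + 1)))
      · simp
      · simp
    | @zero a v hv ih =>
      refine divOp_geom_pow_mul_polylog_of_theta (fun c b => ?_) c b
      rw [theta_polylog_false]
      exact polarClass_mono (by simp) (by simp) (ih c b)
  · simp [h]

lemma divOp_mem_polarClass (c : ℤ) (hf : f ∈ polarClass w d) :
    divOp c f ∈ polarClass (w + 1) d := by
  obtain ⟨N, h⟩ := hf
  rw [← X_pow_mul_mem_polarClass_iff (N := N), X_pow_mul_divOp]
  generalize c - N = c
  generalize X ^ N * f = g at h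
  induction h using Submodule.span_induction with
  | zero => rw [map_zero]; exact zero_mem _
  | add a b _ _ h1 h2 => rw [map_add]; exact add_mem h1 h2
  | smul r a _ h => rw [map_smul]; exact Submodule.smul_mem _ _ h
  | mem g hg =>
    obtain ⟨a, b, v, h1, h2, rfl⟩ := hg
    have h3 := X_pow_mul_divOp a (c + a) (geom ^ b * polylog v)
    rw [add_sub_cancel_right] at h3
    rw [← h3, X_pow_mul_mem_polarClass_iff]
    exact polarClass_mono (by omega) h2 (divOp_geom_pow_mul_polylog v (c + a) b)

lemma polarSpan_le_expanding : polarSpan w d ≤ expanding (multiZetaSpan w d) := by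
  refine Submodule.span_le.mpr ?_
  rintro _ ⟨a, b, v, h1, h2, rfl⟩
  have hX : ∀ (n : ℕ) (g : ℚ⟦X⟧), g ∈ expanding (multiZetaSpan w d) →
      X ^ n * g ∈ expanding (multiZetaSpan w d) := by
    intro n g hg
    induction n with
    | zero => simpa using hg
    | succ n ih => rw [pow_succ', mul_assoc]; exact X_mul_mem_expanding ih
  have hG : ∀ (n : ℕ) (g : ℚ⟦X⟧), g ∈ expanding (multiZetaSpan w d) →
      geom ^ n * g ∈ expanding (multiZetaSpan w d) := by
    intro n g hg
    induction n with
    | zero => simpa using hg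
    | succ n ih => rw [pow_succ', mul_assoc]; exact geom_mul_mem_expanding ih
  refine hX a _ (hG b _ ?_)
  rcases goodWord_or_polylog_eq_zero v with hv | h
  · exact expanding_mono (multiZetaSpan_mono h1 (by omega)) (polylog_mem_expanding hv)
  · rw [h]; exact zero_mem _

lemma mem_expanding_of_polarClass (hf : f ∈ polarClass w d) (ht : Tame f) :
    f ∈ expanding (multiZetaSpan w d) := by
  obtain ⟨N, h⟩ := hf
  refine ⟨ht, expansible_congr (fun x => ?_)
    (expansible_self_zpow_mul (-N) (polarSpan_le_expanding h).2)⟩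
  filter_upwards [eventually_mem_Ioo] with y hy
  have h1 := abs_lt_one_of_mem_Ioo hy
  rw [evalAt_mul (tame_X.pow N) ht h1, evalAt_pow tame_X N h1, evalAt_X, zpow_neg, zpow_natCast,
    inv_mul_cancel_left₀ (pow_ne_zero _ hy.1.ne')]

end BigZeta

/-! ### Power series in several variables: words and their differential equations -/

namespace BigZeta

open Filter Asymptotics Topology PowerSeries

set_option linter.unusedSectionVars false

variable {ι : Type*}

lemma coeff_X_mul_eq {R : Type*} [CommSemiring R] (t : ι) (f : MvPowerSeries ι R) (x : ι →₀ ℕ) :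
    MvPowerSeries.coeff x (MvPowerSeries.X t * f) =
      if 1 ≤ x t then MvPowerSeries.coeff (x - Finsupp.single t 1) f else 0 := by
  classical
  rw [MvPowerSeries.X_def, MvPowerSeries.coeff_monomial_mul]
  simp only [Finsupp.single_le_iff, one_mul]

/-- `1 / (1 - X_t)`. -/
noncomputable def geomVar (t : ι) : MvPowerSeries ι ℚ := (1 - MvPowerSeries.X t)⁻¹

lemma one_sub_X_mul_geomVar (t : ι) : (1 - MvPowerSeries.X t) * geomVar t = 1 :=
  MvPowerSeries.mul_inv_cancel _ (by simp)

/-- Division of the coefficient of a monomial of degree `n` by `n + c` (with result `0` if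
`n + c = 0`). -/
noncomputable def divDeg (c : ℤ) : MvPowerSeries ι ℚ →ₗ[ℚ] MvPowerSeries ι ℚ where
  toFun f := fun x => MvPowerSeries.coeff x f / ((x.degree : ℚ) + c)
  map_add' f g := by
    ext x
    simp only [MvPowerSeries.coeff_apply, map_add, add_div]; rfl
  map_smul' r f := by
    ext x
    simp only [MvPowerSeries.coeff_apply, map_smul, smul_eq_mul, mul_div_assoc]; rfl

lemma coeff_divDeg (c : ℤ) (f : MvPowerSeries ι ℚ) (x : ι →₀ ℕ) :
    MvPowerSeries.coeff x (divDeg c f) = MvPowerSeries.coeff x f / ((x.degree : ℚ) + c) := rfl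

/-- Multiplication of the coefficient at `x` by `ℓ x`. -/
noncomputable def scale (ℓ : (ι →₀ ℕ) → ℚ) : MvPowerSeries ι ℚ →ₗ[ℚ] MvPowerSeries ι ℚ where
  toFun f := fun x => ℓ x * MvPowerSeries.coeff x f
  map_add' f g := by
    ext x
    simp only [MvPowerSeries.coeff_apply, map_add, mul_add]; rfl
  map_smul' r f := by
    ext x
    simp only [MvPowerSeries.coeff_apply, map_smul, smul_eq_mul, mul_left_comm]; rfl

lemma coeff_scale (ℓ : (ι →₀ ℕ) → ℚ) (f : MvPowerSeries ι ℚ) (x : ι →₀ ℕ) :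
    MvPowerSeries.coeff x (scale ℓ f) = ℓ x * MvPowerSeries.coeff x f := rfl

lemma scale_divDeg (ℓ : (ι →₀ ℕ) → ℚ) (c : ℤ) (f : MvPowerSeries ι ℚ) :
    scale ℓ (divDeg c f) = divDeg c (scale ℓ f) := by
  ext x
  rw [coeff_scale, coeff_divDeg, coeff_divDeg, coeff_scale, mul_div_assoc]

/-- A factor independent of the exponent of `X_t` commutes with `X_t`, hence with the inverse of `1
- X_t`. -/
lemma scale_geomVar_mul {ℓ : (ι →₀ ℕ) → ℚ} {t : ι} (h : ∀ x, ℓ (x + Finsupp.single t 1) = ℓ x)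
    (f : MvPowerSeries ι ℚ) : scale ℓ (geomVar t * f) = geomVar t * scale ℓ f := by
  have hX : ∀ g : MvPowerSeries ι ℚ,
      scale ℓ (MvPowerSeries.X t * g) = MvPowerSeries.X t * scale ℓ g := by
    intro g
    ext x
    rw [coeff_scale, coeff_X_mul_eq, coeff_X_mul_eq]
    split_ifs with hx
    · rw [coeff_scale, ← h (x - Finsupp.single t 1),
        tsub_add_cancel_of_le (Finsupp.single_le_iff.mpr hx)]
    · simp
  have h1 : (1 - MvPowerSeries.X t) * scale ℓ (geomVar t * f) = scale ℓ f := by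
    rw [sub_mul, one_mul, ← hX, ← map_sub]
    congr 1
    linear_combination f * one_sub_X_mul_geomVar t
  rw [← h1]
  linear_combination -scale ℓ (geomVar t * f) * one_sub_X_mul_geomVar t

lemma scale_geomVar_pow_mul {ℓ : (ι →₀ ℕ) → ℚ} {t : ι}
    (h : ∀ x, ℓ (x + Finsupp.single t 1) = ℓ x) (k : ℕ) (f : MvPowerSeries ι ℚ) :
    scale ℓ (geomVar t ^ k * f) = geomVar t ^ k * scale ℓ f := by
  induction k with
  | zero => simp
  | succ k ih => rw [pow_succ', mul_assoc, scale_geomVar_mul h, ih, mul_assoc]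

/-! ### Words -/

/-- The two kinds of operations performed on power series in several variables. -/
inductive Op (ι : Type*)
  | div (c : ℤ)
  | mul (t : ι) (k : ℕ)

/-- The power series obtained from the monomial `x` by a list of operations, the head of the list
being performed last. -/
noncomputable def evalWord (x : ι →₀ ℕ) : List (Op ι) → MvPowerSeries ι ℚ
  | [] => MvPowerSeries.monomial x 1
  | .div c :: l => divDeg c (evalWord x l)
  | .mul t k :: l => geomVar t ^ k * evalWord x l

/-- The number of divisions. -/
def weight : List (Op ι) → ℕ
  | [] => 0
  | .div _ :: l => weight l + 1
  | .mul _ _ :: l => weight l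

/-- The number of multiplications. -/
def depth : List (Op ι) → ℕ
  | [] => 0
  | .div _ :: l => depth l
  | .mul _ _ :: l => depth l + 1

/-- The span of words of weight less than `w` and depth at most `d`. -/
noncomputable def wordSpan (ι : Type*) (w d : ℕ) : Submodule ℚ (MvPowerSeries ι ℚ) :=
  Submodule.span ℚ {f | ∃ x l, weight l < w ∧ depth l ≤ d ∧ f = evalWord x l}

lemma evalWord_mem_wordSpan {w d : ℕ} (x : ι →₀ ℕ) {l : List (Op ι)} (hw : weight l < w)
    (hd : depth l ≤ d) : evalWord x l ∈ wordSpan ι w d :=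
  Submodule.subset_span ⟨x, l, hw, hd, rfl⟩

lemma divDeg_mem_wordSpan {w d : ℕ} (c : ℤ) {f : MvPowerSeries ι ℚ} (hf : f ∈ wordSpan ι w d) :
    divDeg c f ∈ wordSpan ι (w + 1) d := by
  induction hf using Submodule.span_induction with
  | mem f hf =>
    obtain ⟨x, l, hw, hd, rfl⟩ := hf
    exact evalWord_mem_wordSpan x (l := .div c :: l) (by simpa [weight] using hw) hd
  | zero => rw [map_zero]; exact zero_mem _
  | add a b _ _ h1 h2 => rw [map_add]; exact add_mem h1 h2
  | smul r a _ h => rw [map_smul]; exact Submodule.smul_mem _ _ h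

lemma geomVar_pow_mul_mem_wordSpan {w d : ℕ} (t : ι) (k : ℕ) {f : MvPowerSeries ι ℚ}
    (hf : f ∈ wordSpan ι w d) : geomVar t ^ k * f ∈ wordSpan ι w (d + 1) := by
  induction hf using Submodule.span_induction with
  | mem f hf =>
    obtain ⟨x, l, hw, hd, rfl⟩ := hf
    exact evalWord_mem_wordSpan x (l := .mul t k :: l) hw (by simpa [depth] using hd)
  | zero => rw [mul_zero]; exact zero_mem _
  | add a b _ _ h1 h2 => rw [mul_add]; exact add_mem h1 h2
  | smul r a _ h => rw [mul_smul_comm]; exact Submodule.smul_mem _ _ h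

variable [Fintype ι] [DecidableEq ι]

/-- The homogeneous part of degree `-c`, which is lost by `divDeg c`. -/
noncomputable def lostPart (c : ℤ) (f : MvPowerSeries ι ℚ) : MvPowerSeries ι ℚ :=
  if c ≤ 0 then ∑ x ∈ Finset.finsuppAntidiag Finset.univ c.natAbs,
    MvPowerSeries.monomial x (MvPowerSeries.coeff x f) else 0

lemma coeff_lostPart (c : ℤ) (f : MvPowerSeries ι ℚ) (x : ι →₀ ℕ) :
    MvPowerSeries.coeff x (lostPart c f) =
      if (x.degree : ℚ) + c = 0 then MvPowerSeries.coeff x f else 0 := by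
  have h0 : (x.degree : ℚ) + c = 0 ↔ (x.degree : ℤ) + c = 0 := by exact_mod_cast Iff.rfl
  have h1 : x ∈ Finset.finsuppAntidiag Finset.univ c.natAbs ↔ x.degree = c.natAbs := by
    simp [Finset.mem_finsuppAntidiag, Finsupp.degree_eq_sum]
  unfold lostPart
  split_ifs with h2 h3 h3
  · rw [map_sum, Finset.sum_eq_single x]
    · simp
    · intro y _ hy; rw [MvPowerSeries.coeff_monomial_ne hy.symm]
    · intro h; rw [h1] at h; rw [h0] at h3; omega
  · rw [map_sum, Finset.sum_eq_zero]
    intro y hy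
    rw [MvPowerSeries.coeff_monomial_ne]
    rintro rfl
    rw [h1] at hy; rw [h0] at h3; omega
  · rw [h0] at h3; omega
  · simp

/-- Only finitely many monomials have a given degree, and a monomial is a word without letters, free
in weight and depth. -/
lemma lostPart_mem_wordSpan {w d : ℕ} (c : ℤ) (f : MvPowerSeries ι ℚ) :
    lostPart c f ∈ wordSpan ι (w + 1) d := by
  unfold lostPart
  split_ifs
  · refine Submodule.sum_mem _ fun x _ => ?_
    have h := evalWord_mem_wordSpan (w := w + 1) (d := d) x (l := []) (by simp [weight])
      (by simp [depth])
    have h2 := Submodule.smul_mem _ (MvPowerSeries.coeff x f) h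
    rwa [evalWord, ← LinearMap.map_smul, smul_eq_mul, mul_one] at h2
  · exact zero_mem _

lemma scale_degree_add_divDeg (c : ℤ) (f : MvPowerSeries ι ℚ) :
    scale (fun x => (x.degree : ℚ) + c) (divDeg c f) = f - lostPart c f := by
  ext x
  rw [coeff_scale, coeff_divDeg, map_sub, coeff_lostPart]
  split_ifs with h
  · simp [h]
  · field_simp; ring

/-! ### Differential equations with respect to a distinguished variable -/

section Distinguished

variable (s : ι)

/-- The word satisfies a first order differential equation in the variables other than `s`, up
to words of smaller weight. -/
def EqOthers (x : ι →₀ ℕ) (l : List (Op ι)) : Prop :=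
  ∃ γ : ℤ, scale (fun y => (y.degree : ℚ) - y s + γ) (evalWord x l) ∈
    wordSpan ι (weight l) (depth l)

/-- The word satisfies a first order differential equation in the variable `s`, up to words of
smaller weight. -/
def EqSelf (x : ι →₀ ℕ) (l : List (Op ι)) : Prop :=
  ∃ γ : ℤ, scale (fun y => (y s : ℚ) + γ) (evalWord x l) ∈ wordSpan ι (weight l) (depth l)

variable {s} {x : ι →₀ ℕ} {l : List (Op ι)}

lemma scale_monomial_eq_zero {ℓ : (ι →₀ ℕ) → ℚ} (h : ℓ x = 0) :
    scale ℓ (MvPowerSeries.monomial x 1) = 0 := by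
  classical
  ext y
  rw [coeff_scale, MvPowerSeries.coeff_monomial]
  split_ifs with hy
  · simp [hy, h]
  · simp

lemma eqOthers_nil : EqOthers s x [] := by
  -- This `γ` makes the factor vanish at the only exponent present.
  refine ⟨x s - x.degree, ?_⟩
  rw [evalWord, scale_monomial_eq_zero (by push_cast; ring)]
  exact zero_mem _

lemma eqSelf_nil : EqSelf s x [] := by
  refine ⟨-x s, ?_⟩
  rw [evalWord, scale_monomial_eq_zero (by push_cast; ring)]
  exact zero_mem _

lemma EqOthers.mul_self (h : EqOthers s x l) (k : ℕ) : EqOthers s x (.mul s k :: l) := by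
  obtain ⟨γ, h⟩ := h
  refine ⟨γ, ?_⟩
  rw [evalWord, scale_geomVar_pow_mul]
  · exact geomVar_pow_mul_mem_wordSpan s k h
  · intro y; simp

lemma EqSelf.mul_other (h : EqSelf s x l) {t : ι} (ht : t ≠ s) (k : ℕ) :
    EqSelf s x (.mul t k :: l) := by
  obtain ⟨γ, h⟩ := h
  refine ⟨γ, ?_⟩
  rw [evalWord, scale_geomVar_pow_mul]
  · exact geomVar_pow_mul_mem_wordSpan t k h
  · intro y; simp [ht]

lemma EqOthers.div (h : EqOthers s x l) (c : ℤ) : EqOthers s x (.div c :: l) := by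
  obtain ⟨γ, h⟩ := h
  refine ⟨γ, ?_⟩
  rw [evalWord, scale_divDeg]
  exact divDeg_mem_wordSpan c h

lemma EqSelf.div (h : EqSelf s x l) (c : ℤ) : EqSelf s x (.div c :: l) := by
  obtain ⟨γ, h⟩ := h
  refine ⟨γ, ?_⟩
  rw [evalWord, scale_divDeg]
  exact divDeg_mem_wordSpan c h

lemma sub_lostPart_mem_wordSpan (x : ι →₀ ℕ) (l : List (Op ι)) (c : ℤ) :
    evalWord x l - lostPart c (evalWord x l) ∈ wordSpan ι (weight l + 1) (depth l) :=
  sub_mem (evalWord_mem_wordSpan x (Nat.lt_succ_self _) le_rfl) (lostPart_mem_wordSpan c _)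

/-- Write `θ_s + (c - γ)` as `(θ_total + c) - (θ_others + γ)`. The first operator undoes the
division, up to the lost part; the second one lowers the weight by hypothesis. -/
lemma EqOthers.eqSelf_div (h : EqOthers s x l) (c : ℤ) : EqSelf s x (.div c :: l) := by
  obtain ⟨γ, h⟩ := h
  refine ⟨c - γ, ?_⟩
  have h1 : scale (fun y : ι →₀ ℕ => (y s : ℚ) + (c - γ : ℤ)) (evalWord x (.div c :: l)) =
      (evalWord x l - lostPart c (evalWord x l)) -
        divDeg c (scale (fun y => (y.degree : ℚ) - y s + γ) (evalWord x l)) := by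
    rw [← scale_degree_add_divDeg, ← scale_divDeg]
    ext y
    simp only [map_sub, coeff_scale, evalWord]; push_cast; ring
  rw [h1]
  exact sub_mem (sub_lostPart_mem_wordSpan x l c) (divDeg_mem_wordSpan c h)

lemma EqSelf.eqOthers_div (h : EqSelf s x l) (c : ℤ) : EqOthers s x (.div c :: l) := by
  obtain ⟨γ, h⟩ := h
  refine ⟨c - γ, ?_⟩
  have h1 : scale (fun y : ι →₀ ℕ => (y.degree : ℚ) - y s + (c - γ : ℤ))
      (evalWord x (.div c :: l)) = (evalWord x l - lostPart c (evalWord x l)) -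
        divDeg c (scale (fun y => (y s : ℚ) + γ) (evalWord x l)) := by
    rw [← scale_degree_add_divDeg, ← scale_divDeg]
    ext y
    simp only [map_sub, coeff_scale, evalWord]; push_cast; ring
  rw [h1]
  exact sub_mem (sub_lostPart_mem_wordSpan x l c) (divDeg_mem_wordSpan c h)

end Distinguished

/-! ### Separation of the distinguished variable -/

/-- The coefficient of `X ^ x * Y ^ n` in the homogenized power series. -/
noncomputable def hatCoeff (s : ι) (f : MvPowerSeries ι ℚ) (x : ι →₀ ℕ) (n : ℕ) : ℚ :=
  if x s = 0 ∧ x.degree ≤ n then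
    MvPowerSeries.coeff (x + Finsupp.single s (n - x.degree)) f else 0

/-- The homogenized power series: `X_s` becomes `Y` and the other `X_t` become `X_t * Y`. -/
noncomputable def hat (s : ι) : MvPowerSeries ι ℚ →ₗ[ℚ] MvPowerSeries ι ℚ⟦X⟧ where
  toFun f := fun x => PowerSeries.mk (hatCoeff s f x)
  map_add' f g := by
    ext1 x
    change PowerSeries.mk (hatCoeff s (f + g) x) =
      PowerSeries.mk (hatCoeff s f x) + PowerSeries.mk (hatCoeff s g x)
    ext n
    rw [map_add, coeff_mk, coeff_mk, coeff_mk]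
    unfold hatCoeff
    split_ifs <;> simp
  map_smul' r f := by
    ext1 x
    change PowerSeries.mk (hatCoeff s (r • f) x) = r • PowerSeries.mk (hatCoeff s f x)
    ext n
    rw [map_smul, coeff_mk, coeff_mk]
    unfold hatCoeff
    split_ifs <;> simp

variable {s : ι}

lemma coeff_hat (f : MvPowerSeries ι ℚ) (x : ι →₀ ℕ) (n : ℕ) :
    coeff n (MvPowerSeries.coeff x (hat s f)) = if x s = 0 ∧ x.degree ≤ n then
      MvPowerSeries.coeff (x + Finsupp.single s (n - x.degree)) f else 0 := by
  change coeff n (PowerSeries.mk (hatCoeff s f x)) = _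
  rw [coeff_mk, hatCoeff]

lemma hat_X_self_mul (f : MvPowerSeries ι ℚ) :
    hat s (MvPowerSeries.X s * f) = MvPowerSeries.C X * hat s f := by
  ext x n
  rw [MvPowerSeries.coeff_C_mul, coeff_hat, coeff_X_mul_eq]
  cases n with
  | zero =>
    rw [coeff_zero_X_mul]
    simp
    intro h1 h2 h3
    omega
  | succ n =>
    rw [coeff_succ_X_mul, coeff_hat]
    by_cases hx : x s = 0
    · by_cases hn : x.degree ≤ n
      · have h1 : n + 1 - x.degree = (n - x.degree) + 1 := by omega
        rw [if_pos (⟨hx, by omega⟩ : x s = 0 ∧ x.degree ≤ n + 1),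
          if_pos (⟨hx, hn⟩ : x s = 0 ∧ x.degree ≤ n), h1, if_pos (by simp; omega), Finsupp.single_add,
          ← add_assoc, add_tsub_cancel_right]
      · rw [if_neg (c := x s = 0 ∧ x.degree ≤ n) (by tauto)]
        split_ifs with h1 h2
        · have h3 : n + 1 - x.degree = 0 := by omega
          simp [hx, h3] at h2
        · rfl
        · rfl
    · rw [if_neg (by tauto), if_neg (by tauto)]

lemma degree_sub_single {x : ι →₀ ℕ} {t : ι} (h : 1 ≤ x t) :
    (x - Finsupp.single t 1).degree + 1 = x.degree := by
  have h1 := congrArg Finsupp.degree (tsub_add_cancel_of_le (Finsupp.single_le_iff.mpr h))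
  rwa [map_add, Finsupp.degree_single] at h1

lemma hat_X_other_mul {t : ι} (ht : t ≠ s) (f : MvPowerSeries ι ℚ) :
    hat s (MvPowerSeries.X t * f) = MvPowerSeries.C X * MvPowerSeries.X t * hat s f := by
  ext x n
  rw [mul_assoc, MvPowerSeries.coeff_C_mul, coeff_hat, coeff_X_mul_eq, coeff_X_mul_eq]
  have h0 : (x + Finsupp.single s (n - x.degree)) t = x t := by simp [ht.symm]
  rw [h0]
  by_cases hx : 1 ≤ x t
  · simp only [if_pos hx]
    have h1 := degree_sub_single hx
    have h2 : (x - Finsupp.single t 1 : ι →₀ ℕ) s = x s := by simp [ht]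
    cases n with
    | zero =>
      rw [coeff_zero_X_mul, if_neg (by omega)]
    | succ n =>
      rw [coeff_succ_X_mul, coeff_hat, h2]
      have h3 : x.degree ≤ n + 1 ↔ (x - Finsupp.single t 1).degree ≤ n := by omega
      have h4 : n + 1 - x.degree = n - (x - Finsupp.single t 1).degree := by omega
      simp only [h3]
      rw [h4, tsub_add_eq_add_tsub (Finsupp.single_le_iff.mpr hx)]
  · simp [hx]

/-- `1 / (1 - X_t Y)`. -/
noncomputable def geomHom (t : ι) : MvPowerSeries ι ℚ⟦X⟧ :=
  MvPowerSeries.invOfUnit (1 - MvPowerSeries.C X * MvPowerSeries.X t) 1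

lemma one_sub_mul_geomHom (t : ι) :
    (1 - MvPowerSeries.C X * MvPowerSeries.X t) * geomHom t = 1 :=
  MvPowerSeries.mul_invOfUnit _ _ (by simp)

lemma one_sub_mul_C_geom :
    (1 - MvPowerSeries.C X) * (MvPowerSeries.C geom : MvPowerSeries ι ℚ⟦X⟧) = 1 := by
  rw [← map_one MvPowerSeries.C, ← map_sub, ← map_mul, one_sub_X_mul_geom]

lemma hat_geomVar_self_mul (f : MvPowerSeries ι ℚ) :
    hat s (geomVar s * f) = MvPowerSeries.C geom * hat s f := by
  have h1 : (1 - MvPowerSeries.C X) * hat s (geomVar s * f) = hat s f := by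
    rw [sub_mul, one_mul, ← hat_X_self_mul, ← map_sub]
    congr 1
    linear_combination f * one_sub_X_mul_geomVar s
  rw [← h1]
  linear_combination -hat s (geomVar s * f) * one_sub_mul_C_geom (ι := ι)

lemma hat_geomVar_other_mul {t : ι} (ht : t ≠ s) (f : MvPowerSeries ι ℚ) :
    hat s (geomVar t * f) = geomHom t * hat s f := by
  have h1 : (1 - MvPowerSeries.C X * MvPowerSeries.X t) * hat s (geomVar t * f) = hat s f := by
    rw [sub_mul, one_mul, ← hat_X_other_mul ht, ← map_sub]
    congr 1
    linear_combination f * one_sub_X_mul_geomVar t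
  rw [← h1]
  linear_combination -hat s (geomVar t * f) * one_sub_mul_geomHom t

lemma hat_geomVar_pow_self_mul (k : ℕ) (f : MvPowerSeries ι ℚ) :
    hat s (geomVar s ^ k * f) = MvPowerSeries.C geom ^ k * hat s f := by
  induction k with
  | zero => simp
  | succ k ih => rw [pow_succ', mul_assoc, hat_geomVar_self_mul, ih, pow_succ', mul_assoc]

lemma hat_geomVar_pow_other_mul {t : ι} (ht : t ≠ s) (k : ℕ) (f : MvPowerSeries ι ℚ) :
    hat s (geomVar t ^ k * f) = geomHom t ^ k * hat s f := by
  induction k with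
  | zero => simp
  | succ k ih => rw [pow_succ', mul_assoc, hat_geomVar_other_mul ht, ih, pow_succ', mul_assoc]

/-- The exponent of `Y` is the total degree, so division by the degree becomes a one-variable
operator on each coefficient. -/
lemma coeff_hat_divDeg (c : ℤ) (f : MvPowerSeries ι ℚ) (x : ι →₀ ℕ) :
    MvPowerSeries.coeff x (hat s (divDeg c f)) = divOp c (MvPowerSeries.coeff x (hat s f)) := by
  ext n
  rw [coeff_divOp, coeff_hat, coeff_hat]
  split_ifs with h
  · rw [coeff_divDeg, map_add, Finsupp.degree_single, Nat.add_sub_cancel' h.2]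
  · simp

lemma coeff_hat_lostPart (c : ℤ) (f : MvPowerSeries ι ℚ) (x : ι →₀ ℕ) :
    MvPowerSeries.coeff x (hat s (lostPart c f)) =
      lostTerm c (MvPowerSeries.coeff x (hat s f)) := by
  ext n
  rw [coeff_lostTerm, coeff_hat, coeff_hat]
  split_ifs with h h1 h1
  · rw [coeff_lostPart, map_add, Finsupp.degree_single, Nat.add_sub_cancel' h.2, if_pos h1]
  · rw [coeff_lostPart, map_add, Finsupp.degree_single, Nat.add_sub_cancel' h.2, if_neg h1]
  · rfl
  · rfl

/-- The degree in the variables other than `s` does not see `Y`: the differential operator in these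
variables becomes a scalar on each coefficient. -/
lemma coeff_hat_scale (γ : ℤ) (f : MvPowerSeries ι ℚ) (x : ι →₀ ℕ) :
    MvPowerSeries.coeff x (hat s (scale (fun y => (y.degree : ℚ) - y s + γ) f)) =
      ((x.degree : ℚ) + γ) • MvPowerSeries.coeff x (hat s f) := by
  ext n
  rw [map_smul, coeff_hat, coeff_hat]
  split_ifs with h
  · rw [coeff_scale, map_add, Finsupp.degree_single, Finsupp.add_apply, h.1]
    simp
  · simp

/-! ### Reduction of adjacent multiplications -/

/-- Extension of scalars to power series over `ℚ⟦X⟧`. -/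
noncomputable def embed (ι : Type*) : MvPowerSeries ι ℚ →+* MvPowerSeries ι ℚ⟦X⟧ :=
  MvPowerSeries.map PowerSeries.C

lemma one_sub_X_mul_embed_geomVar (t : ι) :
    (1 - MvPowerSeries.X t) * embed ι (geomVar t) = 1 := by
  have h := congrArg (embed ι) (one_sub_X_mul_geomVar t)
  rw [map_mul, map_sub, map_one] at h
  rwa [show embed ι (MvPowerSeries.X t) = MvPowerSeries.X t from MvPowerSeries.map_X _ _] at h

/-- Partial fractions in `Y` for `1 / ((1 - Y) (1 - X_t Y))`, with `ε = 1 / (1 - X_t)` as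
coefficient. -/
lemma C_geom_mul_geomHom (t : ι) : MvPowerSeries.C geom * geomHom t =
    embed ι (geomVar t) * MvPowerSeries.C geom + (1 - embed ι (geomVar t)) * geomHom t := by
  have h1 := one_sub_X_mul_embed_geomVar t
  have h2 := one_sub_mul_C_geom (ι := ι)
  have h3 := one_sub_mul_geomHom t
  generalize embed ι (geomVar t) = ε at *
  generalize (MvPowerSeries.C geom : MvPowerSeries ι ℚ⟦X⟧) = e at *
  generalize geomHom t = g at *
  generalize (MvPowerSeries.C X : MvPowerSeries ι ℚ⟦X⟧) = Y at *
  generalize (MvPowerSeries.X t : MvPowerSeries ι ℚ⟦X⟧) = z at *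
  linear_combination -(e * g * Y) * h1 + ((1 - ε) * g) * h2 + (ε * e) * h3

/-- The span of the products `ε ^ i * f` with `f ∈ T`, where `ε = 1 / (1 - X_t)`. -/
noncomputable def epsSpan (t : ι) (T : Set (MvPowerSeries ι ℚ⟦X⟧)) :
    Submodule ℚ (MvPowerSeries ι ℚ⟦X⟧) :=
  Submodule.span ℚ {F | ∃ i, ∃ f ∈ T, F = embed ι (geomVar t) ^ i * f}

lemma eps_mul_mem_epsSpan {t : ι} {T : Set (MvPowerSeries ι ℚ⟦X⟧)} {F : MvPowerSeries ι ℚ⟦X⟧}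
    (hF : F ∈ epsSpan t T) : embed ι (geomVar t) * F ∈ epsSpan t T := by
  induction hF using Submodule.span_induction with
  | mem f hf =>
    obtain ⟨i, f, hf, rfl⟩ := hf
    exact Submodule.subset_span ⟨i + 1, f, hf, by ring⟩
  | zero => rw [mul_zero]; exact zero_mem _
  | add a b _ _ h1 h2 => rw [mul_add]; exact add_mem h1 h2
  | smul r a _ h => rw [mul_smul_comm]; exact Submodule.smul_mem _ _ h

/-- Each use of the partial fraction identity lowers `a` or `b` by one, until only one kind of pole
remains. -/
lemma geom_pow_mul_geomHom_pow_mem (t : ι) (F : MvPowerSeries ι ℚ⟦X⟧) (a b : ℕ) :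
    MvPowerSeries.C geom ^ a * (geomHom t ^ b * F) ∈
      epsSpan t {f | ∃ j, f = MvPowerSeries.C geom ^ j * F ∨ f = geomHom t ^ j * F} := by
  obtain ⟨n, hn⟩ : ∃ n, a + b = n := ⟨_, rfl⟩
  induction n using Nat.strong_induction_on generalizing a b with
  | _ n ih =>
  subst hn
  rcases a with _ | a
  · exact Submodule.subset_span ⟨0, _, ⟨b, Or.inr rfl⟩, by simp⟩
  rcases b with _ | b
  · exact Submodule.subset_span ⟨0, _, ⟨a + 1, Or.inl rfl⟩, by simp⟩
  have h1 : MvPowerSeries.C geom ^ (a + 1) * (geomHom t ^ (b + 1) * F) =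
      embed ι (geomVar t) * (MvPowerSeries.C geom ^ (a + 1) * (geomHom t ^ b * F)) +
      (MvPowerSeries.C geom ^ a * (geomHom t ^ (b + 1) * F) -
        embed ι (geomVar t) * (MvPowerSeries.C geom ^ a * (geomHom t ^ (b + 1) * F))) := by
    linear_combination (MvPowerSeries.C geom ^ a * geomHom t ^ b * F) * C_geom_mul_geomHom t
  rw [h1]
  have h2 := ih (a + 1 + b) (by omega) (a + 1) b rfl
  have h3 := ih (a + (b + 1)) (by omega) a (b + 1) rfl
  exact add_mem (eps_mul_mem_epsSpan h2) (sub_mem h3 (eps_mul_mem_epsSpan h3))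

/-- The homogenized word is a combination of words of smaller depth, multiplied by powers of the
`1 / (1 - X_t)`. -/
def Reducible (s : ι) (x : ι →₀ ℕ) (l : List (Op ι)) : Prop :=
  hat s (evalWord x l) ∈ Submodule.span ℚ {F | ∃ (t : ι) (i : ℕ) (l' : List (Op ι)),
    weight l' ≤ weight l ∧ depth l' + 1 ≤ depth l ∧
    F = embed ι (geomVar t) ^ i * hat s (evalWord x l')}

variable {x : ι →₀ ℕ} {l : List (Op ι)}

lemma Reducible.mul (h : Reducible s x l) (t : ι) (k : ℕ) : Reducible s x (.mul t k :: l) := by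
  obtain ⟨g, hg⟩ : ∃ g : MvPowerSeries ι ℚ⟦X⟧, ∀ f, hat s (geomVar t ^ k * f) = g * hat s f := by
    by_cases ht : t = s
    · subst ht; exact ⟨_, hat_geomVar_pow_self_mul k⟩
    · exact ⟨_, hat_geomVar_pow_other_mul ht k⟩
  unfold Reducible at h ⊢
  rw [evalWord, hg]
  generalize hat s (evalWord x l) = F at h ⊢
  induction h using Submodule.span_induction with
  | mem f hf =>
    obtain ⟨t', i, l', h1, h2, rfl⟩ := hf
    refine Submodule.subset_span ⟨t', i, .mul t k :: l', h1, by simpa [depth] using h2, ?_⟩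
    rw [evalWord, hg]; ring
  | zero => rw [mul_zero]; exact zero_mem _
  | add a b _ _ h1 h2 => rw [mul_add]; exact add_mem h1 h2
  | smul r a _ h => rw [mul_smul_comm]; exact Submodule.smul_mem _ _ h

/-- `divOp c` applied to all coefficients. -/
noncomputable def divCoeff (ι : Type*) (c : ℤ) :
    MvPowerSeries ι ℚ⟦X⟧ →ₗ[ℚ] MvPowerSeries ι ℚ⟦X⟧ where
  toFun F := fun x => divOp c (MvPowerSeries.coeff x F)
  map_add' f g := by
    ext1 x
    change divOp c (MvPowerSeries.coeff x (f + g)) = _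
    rw [map_add, map_add]; rfl
  map_smul' r f := by
    ext1 x
    change divOp c (r • MvPowerSeries.coeff x f) = _
    rw [map_smul]; rfl

lemma coeff_divCoeff (c : ℤ) (F : MvPowerSeries ι ℚ⟦X⟧) (x : ι →₀ ℕ) :
    MvPowerSeries.coeff x (divCoeff ι c F) = divOp c (MvPowerSeries.coeff x F) := rfl

lemma hat_divDeg (c : ℤ) (f : MvPowerSeries ι ℚ) : hat s (divDeg c f) = divCoeff ι c (hat s f) := by
  ext1 x
  rw [coeff_divCoeff, coeff_hat_divDeg]

lemma coeff_embed_mul (g : MvPowerSeries ι ℚ) (F : MvPowerSeries ι ℚ⟦X⟧) (x : ι →₀ ℕ) :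
    MvPowerSeries.coeff x (embed ι g * F) = ∑ p ∈ Finset.HasAntidiagonal.antidiagonal x,
      MvPowerSeries.coeff p.1 g • MvPowerSeries.coeff p.2 F := by
  rw [MvPowerSeries.coeff_mul]
  refine Finset.sum_congr rfl fun p _ => ?_
  rw [embed, MvPowerSeries.coeff_map, PowerSeries.smul_eq_C_mul]

/-- The factor does not involve `Y`, so it passes through a division in `Y`. -/
lemma divCoeff_embed_mul (c : ℤ) (g : MvPowerSeries ι ℚ) (F : MvPowerSeries ι ℚ⟦X⟧) :
    divCoeff ι c (embed ι g * F) = embed ι g * divCoeff ι c F := by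
  ext1 x
  rw [coeff_divCoeff, coeff_embed_mul, coeff_embed_mul, map_sum]
  refine Finset.sum_congr rfl fun p _ => ?_
  rw [map_smul, coeff_divCoeff]

lemma Reducible.div (h : Reducible s x l) (c : ℤ) : Reducible s x (.div c :: l) := by
  unfold Reducible at h ⊢
  rw [evalWord, hat_divDeg]
  generalize hat s (evalWord x l) = F at h ⊢
  induction h using Submodule.span_induction with
  | mem f hf =>
    obtain ⟨t', i, l', h1, h2, rfl⟩ := hf
    refine Submodule.subset_span ⟨t', i, .div c :: l', by simpa [weight] using h1, h2, ?_⟩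
    rw [evalWord, hat_divDeg, ← map_pow, divCoeff_embed_mul]
  | zero => rw [map_zero]; exact zero_mem _
  | add a b _ _ h1 h2 => rw [map_add]; exact add_mem h1 h2
  | smul r a _ h => rw [map_smul]; exact Submodule.smul_mem _ _ h

lemma reducible_aux {t : ι} (ht : t ≠ s) (a b : ℕ) :
    MvPowerSeries.C geom ^ a * (geomHom t ^ b * hat s (evalWord x l)) ∈
    Submodule.span ℚ {F | ∃ (t : ι) (i : ℕ) (l' : List (Op ι)),
      weight l' ≤ weight l ∧ depth l' + 1 ≤ depth l + 2 ∧
      F = embed ι (geomVar t) ^ i * hat s (evalWord x l')} := by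
  refine Submodule.span_mono ?_ (geom_pow_mul_geomHom_pow_mem t (hat s (evalWord x l)) a b)
  rintro _ ⟨i, f, ⟨j, rfl | rfl⟩, rfl⟩
  · refine ⟨t, i, .mul s j :: l, le_rfl, le_rfl, ?_⟩
    rw [evalWord, hat_geomVar_pow_self_mul]
  · refine ⟨t, i, .mul t j :: l, le_rfl, le_rfl, ?_⟩
    rw [evalWord, hat_geomVar_pow_other_mul ht]

lemma reducible_mul_self_mul_other {t : ι} (ht : t ≠ s) (a b : ℕ) :
    Reducible s x (.mul s a :: .mul t b :: l) := by
  have h := reducible_aux (x := x) (l := l) ht a b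
  unfold Reducible
  rwa [evalWord, hat_geomVar_pow_self_mul, evalWord, hat_geomVar_pow_other_mul ht]

lemma reducible_mul_other_mul_self {t : ι} (ht : t ≠ s) (a b : ℕ) :
    Reducible s x (.mul t b :: .mul s a :: l) := by
  have h := reducible_aux (x := x) (l := l) ht a b
  unfold Reducible
  rwa [evalWord, hat_geomVar_pow_other_mul ht, evalWord, hat_geomVar_pow_self_mul, mul_left_comm]

/-- Build the word from the innermost letter outwards. Multiplication by `1 / (1 - X_s)` preserves
the equation in the other variables, multiplication by `1 / (1 - X_t)` the one in `X_s`, and a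
division recovers whichever equation was missing. This fails only if multiplications of the two
kinds are adjacent, and then partial fractions apply. -/
lemma reducible_or_eq (s : ι) (x : ι →₀ ℕ) (l : List (Op ι)) :
    Reducible s x l ∨ (EqOthers s x l ∧ EqSelf s x l) ∨
    (EqOthers s x l ∧ ∃ k l', l = .mul s k :: l') ∨
    (EqSelf s x l ∧ ∃ t k l', t ≠ s ∧ l = .mul t k :: l') := by
  induction l with
  | nil => exact Or.inr (Or.inl ⟨eqOthers_nil, eqSelf_nil⟩)
  | cons o l ih =>
    cases o with
    | div c =>
      rcases ih with h | ⟨h, _⟩ | ⟨h, _⟩ | ⟨h, _⟩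
      · exact Or.inl (h.div c)
      · exact Or.inr (Or.inl ⟨h.div c, h.eqSelf_div c⟩)
      · exact Or.inr (Or.inl ⟨h.div c, h.eqSelf_div c⟩)
      · exact Or.inr (Or.inl ⟨h.eqOthers_div c, h.div c⟩)
    | mul t k =>
      by_cases ht : t = s
      · subst ht
        rcases ih with h | ⟨h, _⟩ | ⟨h, _⟩ | ⟨_, t', k', l', ht', rfl⟩
        · exact Or.inl (h.mul t k)
        · exact Or.inr (Or.inr (Or.inl ⟨h.mul_self k, k, l, rfl⟩))
        · exact Or.inr (Or.inr (Or.inl ⟨h.mul_self k, k, l, rfl⟩))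
        · exact Or.inl (reducible_mul_self_mul_other ht' k k')
      · rcases ih with h | ⟨_, h⟩ | ⟨_, k', l', rfl⟩ | ⟨h, _⟩
        · exact Or.inl (h.mul t k)
        · exact Or.inr (Or.inr (Or.inr ⟨h.mul_other ht k, t, k, l, ht, rfl⟩))
        · exact Or.inl (reducible_mul_other_mul_self ht k' k)
        · exact Or.inr (Or.inr (Or.inr ⟨h.mul_other ht k, t, k, l, ht, rfl⟩))

lemma reducible_or_eqOthers (s : ι) (x : ι →₀ ℕ) (c : ℤ) (l : List (Op ι)) :
    Reducible s x (.div c :: l) ∨ EqOthers s x (.div c :: l) := by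
  rcases reducible_or_eq s x (.div c :: l) with h | ⟨h, _⟩ | ⟨h, _⟩ | ⟨_, t, k, l', _, h⟩
  · exact Or.inl h
  · exact Or.inr h
  · exact Or.inr h
  · simp at h

end BigZeta

/-! ### Expansions at `Y = 1` with coefficient arrays in modules of words -/

namespace BigZeta

open Filter Asymptotics Topology PowerSeries

set_option linter.unusedSectionVars false

lemma geom_pow_mul_mem_polarClass {w d : ℕ} {f : ℚ⟦X⟧} (k : ℕ) (hf : f ∈ polarClass w d) :
    geom ^ k * f ∈ polarClass w (d + 1) := by
  obtain ⟨N, h⟩ := hf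
  refine ⟨N, ?_⟩
  rw [mul_left_comm]
  refine span_mul_mem ?_ h
  rintro _ ⟨a, b, v, h1, h2, rfl⟩
  exact Submodule.subset_span ⟨a, b + k, v, h1, by omega, by ring⟩

lemma evalAt_sum {α : Type*} {s : Finset α} {f : α → ℚ⟦X⟧} (hf : ∀ i ∈ s, Tame (f i)) {y : ℝ}
    (hy : |y| < 1) : Tame (∑ i ∈ s, f i) ∧ evalAt (∑ i ∈ s, f i) y = ∑ i ∈ s, evalAt (f i) y := by
  classical
  induction s using Finset.induction_on with
  | empty => simp [tame_zero, evalAt_zero]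
  | insert a s ha ih =>
    obtain ⟨h1, h2⟩ := ih fun i hi => hf i (Finset.mem_insert_of_mem hi)
    have h3 := hf a (Finset.mem_insert_self a s)
    rw [Finset.sum_insert ha, Finset.sum_insert ha]
    exact ⟨h3.add h1, by rw [evalAt_add h3 h1 hy, h2]⟩

variable {ι : Type*} [Fintype ι] [DecidableEq ι]

/-! ### Convolution operators -/

/-- Multiplication by the power series `g`, on arrays of real coefficients. -/
noncomputable def convol (g : MvPowerSeries ι ℚ) :
    ((ι →₀ ℕ) → ℝ) →ₗ[ℚ] ((ι →₀ ℕ) → ℝ) where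
  toFun f := fun x => ∑ p ∈ Finset.HasAntidiagonal.antidiagonal x,
    ((MvPowerSeries.coeff p.1 g : ℚ) : ℝ) * f p.2
  map_add' f g := by
    ext x; simp [mul_add, Finset.sum_add_distrib]
  map_smul' r f := by
    ext x
    simp only [Pi.smul_apply, Rat.smul_def, Finset.mul_sum, RingHom.id_apply]
    exact Finset.sum_congr rfl fun _ _ => by ring

lemma convol_apply (g : MvPowerSeries ι ℚ) (f : (ι →₀ ℕ) → ℝ) (x : ι →₀ ℕ) :
    convol g f x = ∑ p ∈ Finset.HasAntidiagonal.antidiagonal x,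
      ((MvPowerSeries.coeff p.1 g : ℚ) : ℝ) * f p.2 := rfl

/-- An array of real numbers as a power series. -/
noncomputable def toSeries (f : (ι →₀ ℕ) → ℝ) : MvPowerSeries ι ℝ := f

lemma toSeries_convol (g : MvPowerSeries ι ℚ) (f : (ι →₀ ℕ) → ℝ) :
    toSeries (convol g f) = MvPowerSeries.map (Rat.castHom ℝ) g * toSeries f := by
  ext x
  rw [MvPowerSeries.coeff_mul]
  rfl

lemma toSeries_injective : Function.Injective (toSeries (ι := ι)) := fun _ _ h => h

lemma convol_mul (g h : MvPowerSeries ι ℚ) (f : (ι →₀ ℕ) → ℝ) :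
    convol (g * h) f = convol g (convol h f) := by
  apply toSeries_injective
  simp only [toSeries_convol, map_mul, mul_assoc]

lemma convol_one (f : (ι →₀ ℕ) → ℝ) : convol 1 f = f := by
  apply toSeries_injective
  rw [toSeries_convol, map_one, one_mul]

lemma convol_sub (g h : MvPowerSeries ι ℚ) (f : (ι →₀ ℕ) → ℝ) :
    convol (g - h) f = convol g f - convol h f := by
  ext x
  simp [convol_apply, sub_mul]

lemma convol_X (t : ι) (f : (ι →₀ ℕ) → ℝ) (x : ι →₀ ℕ) :
    convol (MvPowerSeries.X t) f x = if 1 ≤ x t then f (x - Finsupp.single t 1) else 0 := by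
  change MvPowerSeries.coeff x (toSeries (convol (MvPowerSeries.X t) f)) = _
  rw [toSeries_convol, MvPowerSeries.map_X, coeff_X_mul_eq]
  rfl

lemma finiteRows_convol (g : MvPowerSeries ι ℚ) : FiniteRows (convol g) := by
  intro x
  refine ⟨(Finset.HasAntidiagonal.antidiagonal x).image Prod.snd,
    fun y => ((MvPowerSeries.coeff (x - y) g : ℚ) : ℝ), fun f => ?_⟩
  rw [Finset.sum_image, convol_apply]
  · refine Finset.sum_congr rfl fun p hp => ?_
    rw [← Finset.HasAntidiagonal.mem_antidiagonal.mp hp]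
    simp only [add_tsub_cancel_right]
  · intro p hp q hq h
    have hp' := Finset.HasAntidiagonal.mem_antidiagonal.mp hp
    have hq' := Finset.HasAntidiagonal.mem_antidiagonal.mp hq
    rw [← hq', h] at hp'
    exact Prod.ext (add_right_cancel hp') h

/-- The real coefficients of a rational power series. -/
noncomputable def realCoeff (f : MvPowerSeries ι ℚ) : (ι →₀ ℕ) → ℝ :=
  fun x => ((MvPowerSeries.coeff x f : ℚ) : ℝ)

lemma convol_realCoeff (g f : MvPowerSeries ι ℚ) : convol g (realCoeff f) = realCoeff (g * f) := by
  ext x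
  rw [convol_apply, realCoeff, MvPowerSeries.coeff_mul]
  push_cast
  rfl

lemma isBigO_finiteRows {κ κ' : Type*} {T : (κ → ℝ) → κ' → ℝ} (hT : FiniteRows T)
    {b : ℝ → κ → ℝ} {g : ℝ → ℝ} (hb : ∀ x, (fun y => b y x) =O[𝓝[<] (1 : ℝ)] g) (x : κ') :
    (fun y => T (b y) x) =O[𝓝[<] (1 : ℝ)] g := by
  obtain ⟨s, c, h⟩ := hT x
  have h1 : (∑ z ∈ s, fun y => c z * b y z) =O[𝓝[<] (1 : ℝ)] g :=
    IsBigO.sum fun z _ => (hb z).const_mul_left (c z)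
  refine h1.congr_left fun y => ?_
  simp [h]

/-! ### Modules of coefficient arrays -/

/-- The `ℚ`-span of the words with multiple zeta values as coefficients, with bounds on the total
weight and depth. -/
noncomputable def wordModule (ι : Type*) [Fintype ι] [DecidableEq ι] (w d : ℕ) :
    Submodule ℚ ((ι →₀ ℕ) → ℝ) :=
  Submodule.span ℚ {v | ∃ (w₀ d₀ : ℕ) (z : ℝ) (x : ι →₀ ℕ) (l : List (Op ι)),
    z ∈ multiZetaSpan w₀ d₀ ∧ w₀ + weight l ≤ w ∧ d₀ + depth l ≤ d ∧
    v = fun y => z * realCoeff (evalWord x l) y}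

variable {w d : ℕ}

lemma wordModule_mono {w' d' : ℕ} (hw : w ≤ w') (hd : d ≤ d') :
    wordModule ι w d ≤ wordModule ι w' d' := by
  refine Submodule.span_mono ?_
  rintro _ ⟨w₀, d₀, z, x, l, h1, h2, h3, rfl⟩
  exact ⟨w₀, d₀, z, x, l, h1, h2.trans hw, h3.trans hd, rfl⟩

lemma mul_evalWord_mem_wordModule {w₀ d₀ : ℕ} {z : ℝ} (hz : z ∈ multiZetaSpan w₀ d₀)
    (x : ι →₀ ℕ) (l : List (Op ι)) (hw : w₀ + weight l ≤ w) (hd : d₀ + depth l ≤ d) :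
    (fun y => z * realCoeff (evalWord x l) y) ∈ wordModule ι w d :=
  Submodule.subset_span ⟨w₀, d₀, z, x, l, hz, hw, hd, rfl⟩

lemma map_wordModule {κ : Type*} {T : ((ι →₀ ℕ) → ℝ) →ₗ[ℚ] (κ → ℝ)} {W : Submodule ℚ (κ → ℝ)}
    (h : ∀ (w₀ d₀ : ℕ) (z : ℝ) (x : ι →₀ ℕ) (l : List (Op ι)), z ∈ multiZetaSpan w₀ d₀ →
      w₀ + weight l ≤ w → d₀ + depth l ≤ d →
      T (fun y => z * realCoeff (evalWord x l) y) ∈ W) {v : (ι →₀ ℕ) → ℝ}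
    (hv : v ∈ wordModule ι w d) : T v ∈ W := by
  refine (Submodule.span_le (p := W.comap T)).mpr ?_ hv
  rintro _ ⟨w₀, d₀, z, x, l, h1, h2, h3, rfl⟩
  exact h w₀ d₀ z x l h1 h2 h3

lemma FiniteRows.map_const_mul {κ κ' : Type*} {T : (κ → ℝ) → κ' → ℝ} (hT : FiniteRows T) (z : ℝ)
    (f : κ → ℝ) : T (fun y => z * f y) = fun y => z * T f y := hT.map_smul z f

lemma convol_geomVar_pow_mem_wordModule (t : ι) (k : ℕ) {v : (ι →₀ ℕ) → ℝ}
    (hv : v ∈ wordModule ι w d) : convol (geomVar t ^ k) v ∈ wordModule ι w (d + 1) := by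
  refine map_wordModule (fun w₀ d₀ z x l hz hw hd => ?_) hv
  rw [(finiteRows_convol _).map_const_mul, convol_realCoeff]
  exact mul_evalWord_mem_wordModule hz x (.mul t k :: l) hw (by simp only [depth]; omega)

/-- Multiplication of the coefficient at `x` by `ℓ x`. -/
noncomputable def scaleReal (ℓ : (ι →₀ ℕ) → ℝ) : ((ι →₀ ℕ) → ℝ) →ₗ[ℚ] ((ι →₀ ℕ) → ℝ) where
  toFun f := fun x => ℓ x * f x
  map_add' f g := by ext x; simp [mul_add]
  map_smul' r f := by ext x; simp [Rat.smul_def]; ring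

lemma scaleReal_apply (ℓ : (ι →₀ ℕ) → ℝ) (f : (ι →₀ ℕ) → ℝ) (x : ι →₀ ℕ) :
    scaleReal ℓ f x = ℓ x * f x := rfl

lemma finiteRows_scaleReal (ℓ : (ι →₀ ℕ) → ℝ) : FiniteRows (scaleReal ℓ) :=
  fun x => ⟨{x}, ℓ, fun f => by simp [scaleReal_apply]⟩

lemma div_mem_wordModule (c : ℤ) {v : (ι →₀ ℕ) → ℝ} (hv : v ∈ wordModule ι w d) :
    scaleReal (fun x => ((x.degree : ℝ) + c)⁻¹) v ∈ wordModule ι (w + 1) d := by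
  refine map_wordModule (fun w₀ d₀ z x l hz hw hd => ?_) hv
  convert mul_evalWord_mem_wordModule (w := w + 1) (d := d) hz x (.div c :: l)
    (by simp only [weight]; omega) hd using 2 with y
  rw [scaleReal_apply, evalWord, realCoeff, realCoeff, coeff_divDeg]
  push_cast
  ring

lemma mul_mem_wordModule {w₀ d₀ : ℕ} {z : ℝ} (hz : z ∈ multiZetaSpan w₀ d₀) {v : (ι →₀ ℕ) → ℝ}
    (hv : v ∈ wordModule ι w d) : scaleReal (fun _ => z) v ∈ wordModule ι (w₀ + w) (d₀ + d) := by
  refine map_wordModule (fun w₁ d₁ z' x l hz' hw hd => ?_) hv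
  convert mul_evalWord_mem_wordModule (w := w₀ + w) (d := d₀ + d) (mul_mem_multiZetaSpan hz hz') x l
    (by omega) (by omega) using 2 with y
  rw [scaleReal_apply, mul_assoc]

lemma apply_mem_multiZetaSpan {v : (ι →₀ ℕ) → ℝ} (hv : v ∈ wordModule ι w d) (x : ι →₀ ℕ) :
    v x ∈ multiZetaSpan w d := by
  refine (Submodule.span_le (p := (multiZetaSpan w d).comap
    (LinearMap.proj x : ((ι →₀ ℕ) → ℝ) →ₗ[ℚ] ℝ))).mpr ?_ hv
  rintro _ ⟨w₀, d₀, z, x', l, h1, h2, h3, rfl⟩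
  change z * realCoeff (evalWord x' l) x ∈ multiZetaSpan w d
  have h4 := Submodule.smul_mem _ (MvPowerSeries.coeff x (evalWord x' l))
    (multiZetaSpan_mono (w' := w) (d' := d) (by omega) (by omega) h1)
  rw [Rat.smul_def, mul_comm] at h4
  exact h4

lemma realCoeff_monomial (x y : ι →₀ ℕ) :
    realCoeff (MvPowerSeries.monomial x 1) y = if y = x then 1 else 0 := by
  rw [realCoeff, MvPowerSeries.coeff_monomial]
  split_ifs <;> simp

/-- A finitely supported array is a combination of monomials, words without letters, so the values
may use up the whole weight and depth. -/
lemma mem_wordModule_of_finite (s : Finset (ι →₀ ℕ)) {v : (ι →₀ ℕ) → ℝ}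
    (hv : ∀ x ∈ s, v x ∈ multiZetaSpan w d) (hs : ∀ x ∉ s, v x = 0) : v ∈ wordModule ι w d := by
  have h1 : v = ∑ x ∈ s, fun y => v x * realCoeff (evalWord x []) y := by
    ext y
    simp only [Finset.sum_apply, evalWord, realCoeff_monomial, mul_ite, mul_one, mul_zero]
    rw [Finset.sum_ite_eq]
    split_ifs with h
    · rfl
    · exact hs y h
  rw [h1]
  exact Submodule.sum_mem _ fun x hx =>
    mul_evalWord_mem_wordModule (hv x hx) x [] (by simp [weight]) (by simp [depth])

/-! ### Families of power series with asymptotic expansions -/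

/-- Power series in the `X_t` whose coefficients, power series in `Y`, have asymptotic expansions at
`Y = 1` with coefficients in `V`. -/
noncomputable def expandingFamily (V : Submodule ℚ ((ι →₀ ℕ) → ℝ)) :
    Submodule ℚ (MvPowerSeries ι ℚ⟦X⟧) where
  carrier := {F | (∀ x, Tame (MvPowerSeries.coeff x F)) ∧
    (fun y x => evalAt (MvPowerSeries.coeff x F) y) ∈ expansible V}
  zero_mem' := ⟨fun x => by simpa using tame_zero, by
    simp only [map_zero, evalAt_zero]; exact zero_mem _⟩
  add_mem' := by
    rintro f g ⟨hf, hf'⟩ ⟨hg, hg'⟩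
    refine ⟨fun x => by rw [map_add]; exact (hf x).add (hg x),
      expansible_congr (fun x => ?_) (add_mem hf' hg')⟩
    filter_upwards [eventually_mem_Ioo] with y hy
    rw [map_add, evalAt_add (hf x) (hg x) (abs_lt_one_of_mem_Ioo hy)]
    rfl
  smul_mem' := by
    rintro c f ⟨hf, hf'⟩
    have h1 : ∀ x, MvPowerSeries.coeff x (c • f) = c • MvPowerSeries.coeff x f := fun x => rfl
    refine ⟨fun x => by rw [h1]; exact (hf x).smul c,
      expansible_congr (fun x => ?_) (Submodule.smul_mem _ c hf')⟩
    refine Eventually.of_forall fun y => ?_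
    simp only [h1, evalAt_smul, Pi.smul_apply, Rat.smul_def]

variable {V W : Submodule ℚ ((ι →₀ ℕ) → ℝ)} {F : MvPowerSeries ι ℚ⟦X⟧}

lemma expandingFamily_mono (h : V ≤ W) : expandingFamily V ≤ expandingFamily W :=
  fun _ hf => ⟨hf.1, expansible_mono h hf.2⟩

lemma embed_mul_mem_expandingFamily (g : MvPowerSeries ι ℚ) (hF : F ∈ expandingFamily V)
    (hVW : ∀ v ∈ V, convol g v ∈ W) : embed ι g * F ∈ expandingFamily W := by
  have h1 : ∀ x, ∀ y : ℝ, |y| < 1 → Tame (MvPowerSeries.coeff x (embed ι g * F)) ∧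
      evalAt (MvPowerSeries.coeff x (embed ι g * F)) y =
        convol g (fun x => evalAt (MvPowerSeries.coeff x F) y) x := by
    intro x y hy
    rw [coeff_embed_mul, convol_apply]
    obtain ⟨h1, h2⟩ := evalAt_sum (s := Finset.HasAntidiagonal.antidiagonal x)
      (f := fun p => MvPowerSeries.coeff p.1 g • MvPowerSeries.coeff p.2 F)
      (fun p _ => (hF.1 p.2).smul _) hy
    exact ⟨h1, h2.trans (Finset.sum_congr rfl fun p _ => evalAt_smul _ _ _)⟩
  refine ⟨fun x => (h1 x 0 (by simp)).1,
    expansible_congr (fun x => ?_) (expansible_map (finiteRows_convol g) hVW hF.2)⟩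
  filter_upwards [eventually_mem_Ioo] with y hy
  exact (h1 x y (abs_lt_one_of_mem_Ioo hy)).2.symm

lemma C_geom_pow_mul_mem_expandingFamily (k : ℕ) (hF : F ∈ expandingFamily V) :
    MvPowerSeries.C geom ^ k * F ∈ expandingFamily V := by
  have hk := tame_geom.pow k
  have h1 : ∀ x, MvPowerSeries.coeff x (MvPowerSeries.C geom ^ k * F) =
      geom ^ k * MvPowerSeries.coeff x F := by
    intro x
    rw [← map_pow, MvPowerSeries.coeff_C_mul]
  refine ⟨fun x => by rw [h1]; exact hk.mul (hF.1 x),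
    expansible_congr (fun x => ?_) (expansible_zpow_mul (-k) hF.2)⟩
  filter_upwards [eventually_mem_Ioo] with y hy
  have hy' := abs_lt_one_of_mem_Ioo hy
  rw [h1, evalAt_mul hk (hF.1 x) hy', evalAt_pow tame_geom k hy', evalAt_geom hy', zpow_neg,
    zpow_natCast, inv_pow]

/-- Solutions of `b - y * X_t * b = a`. -/
lemma expansible_of_geometric {a b : ℝ → (ι →₀ ℕ) → ℝ} (t : ι) (ha : a ∈ expansible V)
    (hV : ∀ v ∈ V, convol (geomVar t) v ∈ V)
    (hab : ∀ y ∈ Set.Ioo (0 : ℝ) 1, b y = a y + y • convol (MvPowerSeries.X t) (b y)) :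
    b ∈ expansible V := by
  obtain ⟨B, hB⟩ := expansible_bound ha
  -- Induction on the exponent of `X_t`: the recursion gives `b` the same growth as `a`.
  have hbound : ∀ n, ∀ x : ι →₀ ℕ, x t = n →
      (fun y => b y x) =O[𝓝[<] (1 : ℝ)] fun y => (1 - y) ^ (-(B : ℤ)) := by
    intro n
    induction n with
    | zero =>
      intro x hx
      refine (hB x).congr' ?_ EventuallyEq.rfl
      filter_upwards [eventually_mem_Ioo] with y hy
      rw [hab y hy, Pi.add_apply, Pi.smul_apply, convol_X, if_neg (by omega), smul_zero, add_zero]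
    | succ n ih =>
      intro x hx
      have h1 := ih (x - Finsupp.single t 1) (by simp [hx])
      have h2 : (fun y : ℝ => y) =O[𝓝[<] 1] fun _ => (1 : ℝ) :=
        (tendsto_id.mono_left nhdsWithin_le_nhds : Tendsto (fun y : ℝ => y) (𝓝[<] 1) (𝓝 1)).isBigO_one ℝ
      refine ((hB x).add ((h2.mul h1).trans_eventuallyEq
        (Eventually.of_forall fun y => one_mul _))).congr' ?_ EventuallyEq.rfl
      filter_upwards [eventually_mem_Ioo] with y hy
      nth_rewrite 2 [hab y hy]
      rw [Pi.add_apply, Pi.smul_apply, convol_X, if_pos (by omega), smul_eq_mul]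
  have hT := finiteRows_convol (geomVar t - 1)
  -- With `ε = 1 / (1 - X_t)`, the equation reads `b = ε a - (1 - y) (ε - 1) b`, and every iteration
  -- gains a factor `1 - y`.
  have hrec : ∀ y ∈ Set.Ioo (0 : ℝ) 1,
      b y = convol (geomVar t) (a y) - (1 - y) • convol (geomVar t - 1) (b y) := by
    intro y hy
    have h1 : convol (geomVar t) (b y) = convol (geomVar t) (a y) +
        y • convol (geomVar t - 1) (b y) := by
      have h2 : geomVar t - 1 = geomVar t * MvPowerSeries.X t := by
        linear_combination one_sub_X_mul_geomVar t
      nth_rewrite 1 [hab y hy]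
      rw [map_add, (finiteRows_convol _).map_smul, ← convol_mul, h2]
    rw [eq_sub_of_add_eq h1.symm, convol_sub, convol_one]
    module
  have key : ∀ J : ℕ, ∃ p ∈ expansible V, ∀ x, (fun y => b y x - p y x) =O[𝓝[<] (1 : ℝ)]
      fun y => (1 - y) ^ ((J : ℤ) - B) := by
    intro J
    induction J with
    | zero => exact ⟨0, zero_mem _, fun x => by simpa using hbound _ x rfl⟩
    | succ J ih =>
      obtain ⟨p, hp, hp'⟩ := ih
      refine ⟨fun y x => convol (geomVar t) (a y) x - (1 - y) ^ (1 : ℤ) *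
        convol (geomVar t - 1) (p y) x, sub_mem ?_ (expansible_zpow_mul 1 ?_), fun x => ?_⟩
      · exact expansible_map (finiteRows_convol _) hV ha
      · refine expansible_map hT (fun v hv => ?_) hp
        rw [convol_sub, convol_one]
        exact sub_mem (hV v hv) hv
      · have h1 := isBigO_finiteRows hT (b := fun y => b y - p y) (fun x => hp' x) x
        have h2 := (isBigO_refl (fun y : ℝ => (1 - y)) (𝓝[<] 1)).neg_left.mul h1
        refine h2.congr' ?_ ?_
        · filter_upwards [eventually_mem_Ioo] with y hy
          rw [map_sub]
          nth_rewrite 2 [hrec y hy]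
          simp only [Pi.sub_apply, Pi.smul_apply, smul_eq_mul, zpow_one]
          ring
        · filter_upwards [eventually_mem_Ioo] with y hy
          have h0 : 1 - y ≠ 0 := by linarith [hy.2]
          rw [mul_comm, ← zpow_add_one₀ h0]
          congr 1; push_cast; ring
  refine expansible_of_approx fun J => ?_
  obtain ⟨p, hp, hp'⟩ := key (J + B)
  exact ⟨p, hp, fun x => by simpa using hp' x⟩

/-- The smallest module that contains `V` and is stable under multiplication by `1 / (1 - X_t)`. -/
noncomputable def geomClosure (t : ι) (V : Submodule ℚ ((ι →₀ ℕ) → ℝ)) :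
    Submodule ℚ ((ι →₀ ℕ) → ℝ) :=
  Submodule.span ℚ {u | ∃ k : ℕ, ∃ v ∈ V, u = convol (geomVar t ^ k) v}

lemma le_geomClosure (t : ι) : V ≤ geomClosure t V := fun v hv =>
  Submodule.subset_span ⟨0, v, hv, by rw [pow_zero, convol_one]⟩

lemma convol_mem_geomClosure {t : ι} {v : (ι →₀ ℕ) → ℝ} (hv : v ∈ geomClosure t V) :
    convol (geomVar t) v ∈ geomClosure t V := by
  refine (Submodule.span_le (p := (geomClosure t V).comap (convol (geomVar t)))).mpr ?_ hv
  rintro _ ⟨k, v, hv, rfl⟩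
  exact Submodule.subset_span ⟨k + 1, v, hv, by rw [pow_succ', convol_mul]⟩

/-- A power of `1 / (1 - X_t)`, whatever its exponent, is a single letter, so the whole closure
costs one unit of depth. -/
lemma geomClosure_wordModule_le (t : ι) :
    geomClosure t (wordModule ι w d) ≤ wordModule ι w (d + 1) := by
  refine Submodule.span_le.mpr ?_
  rintro _ ⟨k, v, hv, rfl⟩
  exact convol_geomVar_pow_mem_wordModule t k hv

lemma coeff_geomHom_mul (t : ι) (F : MvPowerSeries ι ℚ⟦X⟧) (x : ι →₀ ℕ) :
    MvPowerSeries.coeff x (geomHom t * F) = MvPowerSeries.coeff x F + X *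
      (if 1 ≤ x t then MvPowerSeries.coeff (x - Finsupp.single t 1) (geomHom t * F) else 0) := by
  rw [← coeff_X_mul_eq, ← MvPowerSeries.coeff_C_mul, ← map_add]
  congr 1
  linear_combination F * one_sub_mul_geomHom t

lemma coeff_geomHom_mul_induction {P : ℚ⟦X⟧ → Prop} (hadd : ∀ f g, P f → P g → P (f + g))
    (hX : ∀ f, P f → P (X * f)) (t : ι) (hF : ∀ x, P (MvPowerSeries.coeff x F)) (x : ι →₀ ℕ) :
    P (MvPowerSeries.coeff x (geomHom t * F)) := by
  obtain ⟨n, hn⟩ : ∃ n, x t = n := ⟨_, rfl⟩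
  induction n generalizing x with
  | zero => rw [coeff_geomHom_mul, if_neg (by omega), mul_zero, add_zero]; exact hF x
  | succ n ih =>
    rw [coeff_geomHom_mul, if_pos (by omega)]
    exact hadd _ _ (hF x) (hX _ (ih _ (by simp [hn])))

lemma geomHom_mul_mem_expandingFamily {t : ι} (hV : ∀ v ∈ V, convol (geomVar t) v ∈ V)
    (hF : F ∈ expandingFamily V) : geomHom t * F ∈ expandingFamily V := by
  have h1 : ∀ x, Tame (MvPowerSeries.coeff x (geomHom t * F)) :=
    coeff_geomHom_mul_induction (P := Tame) (fun _ _ => Tame.add) (fun _ h => tame_X.mul h) t hF.1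
  refine ⟨h1, expansible_of_geometric t hF.2 hV fun y hy => ?_⟩
  have hy' := abs_lt_one_of_mem_Ioo hy
  ext x
  rw [Pi.add_apply, Pi.smul_apply, convol_X, smul_eq_mul]
  nth_rewrite 1 [coeff_geomHom_mul]
  split_ifs with h
  · rw [evalAt_add (hF.1 x) (tame_X.mul (h1 _)) hy', evalAt_mul tame_X (h1 _) hy', evalAt_X]
  · rw [mul_zero, add_zero, mul_zero, add_zero]

lemma geomHom_pow_mul_mem_expandingFamily (t : ι) (k : ℕ)
    (hF : F ∈ expandingFamily (wordModule ι w d)) :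
    geomHom t ^ k * F ∈ expandingFamily (wordModule ι w (d + 1)) := by
  refine expandingFamily_mono (geomClosure_wordModule_le t) ?_
  induction k with
  | zero => rw [pow_zero, one_mul]; exact expandingFamily_mono (le_geomClosure t) hF
  | succ k ih =>
    rw [pow_succ', mul_assoc]
    exact geomHom_mul_mem_expandingFamily (fun v hv => convol_mem_geomClosure hv) ih

/-! ### Expansions of homogenized words -/

variable {s : ι}

lemma coeff_hat_monomial (x y : ι →₀ ℕ) :
    MvPowerSeries.coeff y (hat s (MvPowerSeries.monomial x 1)) =
      if y = x.erase s then PowerSeries.monomial x.degree 1 else 0 := by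
  have hx := Finsupp.erase_add_single s x
  have hd : (x.erase s).degree + x s = x.degree := by
    have := congrArg Finsupp.degree hx
    rwa [map_add, Finsupp.degree_single] at this
  ext n
  rw [coeff_hat, MvPowerSeries.coeff_monomial]
  by_cases hy : y = x.erase s
  · rw [if_pos hy, coeff_monomial]
    subst hy
    by_cases hn : n = x.degree
    · subst hn
      have h1 : x.degree - (x.erase s).degree = x s := by omega
      rw [if_pos ⟨Finsupp.erase_same, by omega⟩, h1, if_pos hx, if_pos rfl]
    · rw [if_neg hn]
      split_ifs with h1 h2
      · have h3 := DFunLike.congr_fun h2 s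
        rw [Finsupp.add_apply, Finsupp.erase_same, Finsupp.single_eq_same] at h3
        omega
      · rfl
      · rfl
  · rw [if_neg hy, map_zero]
    split_ifs with h1 h2
    · refine absurd ?_ hy
      rw [← h2]
      ext t
      by_cases ht : t = s
      · subst ht; simp [h1.1]
      · simp [ht]
    · rfl
    · rfl

/-- Taken one at a time, the coefficients fall under the one-variable theory. For `t ≠ s` the factor
`1 / (1 - X_t Y)` only contributes powers of `Y`. The resulting control of weight and depth is
applied to the entries of the constant of integration. -/
lemma coeff_hat_evalWord_mem (x : ι →₀ ℕ) (l : List (Op ι)) (y : ι →₀ ℕ) :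
    MvPowerSeries.coeff y (hat s (evalWord x l)) ∈ polarClass (weight l) (depth l) := by
  induction l generalizing y with
  | nil =>
    rw [evalWord, coeff_hat_monomial]
    split_ifs
    · exact monomial_mem_polarClass _ _
    · exact zero_mem _
  | cons o l ih =>
    cases o with
    | div c =>
      rw [evalWord, coeff_hat_divDeg]
      exact divOp_mem_polarClass c (ih y)
    | mul t k =>
      by_cases ht : t = s
      · subst ht
        rw [evalWord, hat_geomVar_pow_self_mul, ← map_pow, MvPowerSeries.coeff_C_mul]
        exact geom_pow_mul_mem_polarClass k (ih y)
      · rw [evalWord, hat_geomVar_pow_other_mul ht]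
        refine polarClass_mono le_rfl (Nat.le_succ _) ?_
        induction k generalizing y with
        | zero => simpa [weight] using ih y
        | succ k ihk =>
          rw [pow_succ', mul_assoc]
          exact coeff_geomHom_mul_induction (P := fun f => f ∈ polarClass (weight l) (depth l))
            (fun _ _ => add_mem) (fun _ => X_mul_mem_polarClass_iff.mpr) t ihk y

lemma tame_coeff_hat_evalWord (x : ι →₀ ℕ) (l : List (Op ι)) (y : ι →₀ ℕ) :
    Tame (MvPowerSeries.coeff y (hat s (evalWord x l))) := by
  induction l generalizing y with
  | nil =>
    rw [evalWord, coeff_hat_monomial]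
    split_ifs
    · exact tame_monomial _ _
    · exact tame_zero
  | cons o l ih =>
    cases o with
    | div c =>
      rw [evalWord, coeff_hat_divDeg]
      exact (ih y).divOp c
    | mul t k =>
      by_cases ht : t = s
      · subst ht
        rw [evalWord, hat_geomVar_pow_self_mul, ← map_pow, MvPowerSeries.coeff_C_mul]
        exact (tame_geom.pow k).mul (ih y)
      · rw [evalWord, hat_geomVar_pow_other_mul ht]
        induction k generalizing y with
        | zero => simpa using ih y
        | succ k ihk =>
          rw [pow_succ', mul_assoc]
          exact coeff_geomHom_mul_induction (P := Tame) (fun _ _ => Tame.add)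
            (fun _ h => tame_X.mul h) t ihk y

/-- The constant of integration belongs to the expected module, by the differential equation with
respect to the other variables. -/
lemma constant_mem_wordModule {b : ℝ → (ι →₀ ℕ) → ℝ} {K : (ι →₀ ℕ) → ℝ} (γ : ℤ)
    (hK : (fun y x => b y x - K x) ∈ expansible (wordModule ι w d))
    (hb : (fun y x => ((x.degree : ℝ) + γ) * b y x) ∈ expansible (wordModule ι w d))
    (hmem : ∀ x, K x ∈ multiZetaSpan (w + 1) d) : K ∈ wordModule ι (w + 1) d := by
  set V := wordModule ι w d with hV
  set D := scaleReal (fun x : ι →₀ ℕ => (x.degree : ℝ) + γ) with hD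
  have h1 : (fun y => D (fun x => b y x - K x)) ∈ expansible (V.map D) :=
    expansible_map (finiteRows_scaleReal _) (fun v hv => Submodule.mem_map_of_mem hv) hK
  have h2 := sub_mem (expansible_mono (le_sup_left : V ≤ V ⊔ V.map D) hb)
    (expansible_mono (le_sup_right : V.map D ≤ V ⊔ V.map D) h1)
  -- The difference of `D b` and `D (b - K)` is the constant `D K`, which is its own limit.
  have h3 : D K ∈ V ⊔ V.map D := by
    refine limit_mem_of_expansible h2 fun x => ?_
    refine tendsto_const_nhds.congr fun y => ?_
    simp only [Pi.sub_apply, hD, scaleReal_apply]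
    ring
  obtain ⟨v₁, hv₁, u, hu, h4⟩ := Submodule.mem_sup.mp h3
  obtain ⟨v₂, hv₂, rfl⟩ := hu
  have h5 := add_mem (div_mem_wordModule γ hv₁) (wordModule_mono (Nat.le_succ w) le_rfl hv₂)
  set K' := scaleReal (fun x : ι →₀ ℕ => ((x.degree : ℝ) + γ)⁻¹) v₁ + v₂ with hK'
  -- Here `D K = v₁ + D v₂`, so `K` and `K' = D⁻¹ v₁ + v₂` can differ only where `|x| + γ = 0`.
  -- These `x` are finitely many, and there `hmem` controls the entries.
  have h6 : K - K' ∈ wordModule ι (w + 1) d := by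
    refine mem_wordModule_of_finite (Finset.finsuppAntidiag Finset.univ γ.natAbs)
      (fun x _ => sub_mem (hmem x) (apply_mem_multiZetaSpan h5 x)) fun x hx => ?_
    have hne : (x.degree : ℝ) + γ ≠ 0 := by
      intro h
      have h' : (x.degree : ℤ) + γ = 0 := by exact_mod_cast h
      apply hx
      simp only [Finset.mem_finsuppAntidiag, Finset.subset_univ, and_true]
      rw [← Finsupp.degree_eq_sum]
      omega
    have h7 := congrFun h4 x
    simp only [Pi.add_apply, hD, scaleReal_apply] at h7
    simp only [Pi.sub_apply, hK', Pi.add_apply, scaleReal_apply]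
    field_simp
    linarith
  have h7 := add_mem h6 h5
  rwa [sub_add_cancel] at h7

lemma hat_wordSpan_mem {l₀ : ℕ} (h : ∀ (x : ι →₀ ℕ) (l : List (Op ι)),
    weight l < l₀ + 1 → depth l ≤ d → hat s (evalWord x l) ∈ expandingFamily (wordModule ι (weight l) (depth l)))
    {f : MvPowerSeries ι ℚ} (hf : f ∈ wordSpan ι (l₀ + 1) d) :
    hat s f ∈ expandingFamily (wordModule ι l₀ d) := by
  refine (Submodule.span_le (p := (expandingFamily (wordModule ι l₀ d)).comap (hat s))).mpr ?_ hf
  rintro _ ⟨x, l, h1, h2, rfl⟩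
  exact expandingFamily_mono (wordModule_mono (by omega) h2) (h x l h1 h2)

/-- Induction on weight plus depth. Multiplications act directly on expansions; a division is an
integration in `Y`, whose constant is determined by the differential equation in the other
variables. -/
lemma hat_evalWord_mem_expandingFamily (x : ι →₀ ℕ) (l : List (Op ι)) :
    hat s (evalWord x l) ∈ expandingFamily (wordModule ι (weight l) (depth l)) := by
  obtain ⟨n, hn⟩ : ∃ n, weight l + depth l = n := ⟨_, rfl⟩
  induction n using Nat.strong_induction_on generalizing x l with
  | _ n ih =>
  subst hn
  have hpolar := coeff_hat_evalWord_mem (s := s) x l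
  have htame := tame_coeff_hat_evalWord (s := s) x l
  cases l with
  | nil =>
    refine ⟨htame, ?_⟩
    have h1 : realCoeff (evalWord (x.erase s) []) ∈ wordModule ι 0 0 := by
      have := mul_evalWord_mem_wordModule (w := 0) (d := 0) (one_mem_multiZetaSpan 0 0)
        (x.erase s) [] le_rfl le_rfl
      simpa only [one_mul] using this
    refine expansible_congr (fun y => ?_)
      (expansible_self_zpow_mul (x.degree : ℤ) (const_mem_expansible h1))
    refine Eventually.of_forall fun r => ?_
    simp only [evalWord, realCoeff_monomial, coeff_hat_monomial]
    split_ifs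
    · rw [evalAt_monomial, zpow_natCast]; simp
    · rw [evalAt_zero, mul_zero]
  | cons o l =>
  cases o with
  | mul t k =>
    have h1 := ih _ (by simp only [weight, depth]; omega) x l rfl
    by_cases ht : t = s
    · subst ht
      rw [evalWord, hat_geomVar_pow_self_mul]
      exact expandingFamily_mono (wordModule_mono le_rfl (Nat.le_succ _))
        (C_geom_pow_mul_mem_expandingFamily k h1)
    · rw [evalWord, hat_geomVar_pow_other_mul ht]
      exact geomHom_pow_mul_mem_expandingFamily t k h1
  | div c =>
  rcases reducible_or_eqOthers s x c l with hred | ⟨γ, hγ⟩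
  -- Here the depth drops by one, and multiplying back by a power of `1 / (1 - X_t)` uses up exactly
  -- this unit.
  · refine Submodule.span_le.mpr ?_ hred
    rintro _ ⟨t, i, l', hw, hd, rfl⟩
    have h1 := ih _ (by omega) x l' rfl
    rw [← map_pow]
    exact embed_mul_mem_expandingFamily _ h1 fun v hv =>
      wordModule_mono hw hd (convol_geomVar_pow_mem_wordModule t i hv)
  · have hspan : ∀ f ∈ wordSpan ι (weight l + 1) (depth l),
        hat s f ∈ expandingFamily (wordModule ι (weight l) (depth l)) := fun f hf =>
      hat_wordSpan_mem (fun x' l' h1 h2 => ih _ (by simp only [weight, depth]; omega) x' l' rfl) hf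
    have hF := hspan _ (sub_lostPart_mem_wordSpan x l c)
    have hG := hspan _ hγ
    have hl := ih _ (by simp only [weight, depth]; omega) x l rfl
    have hlost := hspan _ (lostPart_mem_wordSpan c (evalWord x l))
    obtain ⟨K, hK⟩ := exists_const_of_hasDerivAt (V := wordModule ι (weight l) (depth l))
      (b := fun r y => r ^ c * evalAt (MvPowerSeries.coeff y (hat s (evalWord x (.div c :: l)))) r)
      (a := fun r y => r ^ (c - 1) * evalAt (MvPowerSeries.coeff y
        (hat s (evalWord x l - lostPart c (evalWord x l)))) r)
      (fun y r hr => by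
        have h1 := hasDerivAt_zpow_mul_evalAt_divOp (hl.1 y) c hr
        have h2 : evalAt (MvPowerSeries.coeff y
            (hat s (evalWord x l - lostPart c (evalWord x l)))) r =
            evalAt (MvPowerSeries.coeff y (hat s (evalWord x l))) r -
              evalAt (lostTerm c (MvPowerSeries.coeff y (hat s (evalWord x l)))) r := by
          rw [eq_sub_iff_add_eq, ← coeff_hat_lostPart,
            ← evalAt_add (hF.1 y) (hlost.1 y) (abs_lt_one_of_mem_Ioo hr), ← map_add, ← map_add,
            sub_add_cancel]
        simp only [evalWord, coeff_hat_divDeg]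
        rw [h2]
        exact h1)
      (expansible_self_zpow_mul (c - 1) hF.2)
    have hKmem : K ∈ wordModule ι (weight l + 1) (depth l) := by
      refine constant_mem_wordModule γ hK ?_ fun y => ?_
      · refine expansible_congr (fun y => Eventually.of_forall fun r => ?_)
          (expansible_self_zpow_mul c hG.2)
        simp only [coeff_hat_scale, evalAt_smul]
        push_cast
        ring
      -- For fixed `y`, both the coefficient times `r ^ c` and its difference with `K y` expand with
      -- multiple zeta values as coefficients; hence so does `K y`.
      · have h1 := mem_expanding_of_polarClass (hpolar y) (htame y)
        have h2 := expansible_self_zpow_mul c h1.2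
        have h3 : (fun (r : ℝ) (_ : Unit) => r ^ c * evalAt (MvPowerSeries.coeff y
            (hat s (evalWord x (.div c :: l)))) r - K y) ∈
            expansible (scalarModule (multiZetaSpan (weight l + 1) (depth l))) :=
          expansible_map (T := fun v (_ : Unit) => v y) (fun _ => ⟨{y}, 1, fun f => by simp⟩)
            (fun v hv => multiZetaSpan_mono (Nat.le_succ _) le_rfl (apply_mem_multiZetaSpan hv y))
            hK
        have h4 := sub_mem h2 h3
        refine mem_scalarModule.mp (limit_mem_of_expansible (l := fun _ => K y) h4 fun _ => ?_)
        refine tendsto_const_nhds.congr fun r => ?_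
        simp
    refine ⟨htame, ?_⟩
    have h1 := expansible_self_zpow_mul (-c) (add_mem
      (expansible_mono (wordModule_mono (Nat.le_succ _) le_rfl) hK) (const_mem_expansible hKmem))
    refine expansible_congr (fun y => ?_) h1
    filter_upwards [eventually_mem_Ioo] with r hr
    have hr0 := zpow_ne_zero c hr.1.ne'
    simp only [Pi.add_apply, sub_add_cancel]
    rw [zpow_neg, inv_mul_cancel_left₀ hr0]

end BigZeta

/-! ### Evaluation of the series -/

namespace BigZeta

open Filter Asymptotics Topology PowerSeries

set_option linter.unusedSectionVars false

variable {ι : Type*} [Fintype ι] [DecidableEq ι]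

/-! ### Summation over one variable -/

/-- The sum of `f` over the exponent of the variable `s`. -/
noncomputable def sumOver (s : ι) (f : (ι →₀ ℕ) → ℝ) : (ι →₀ ℕ) → ℝ :=
  fun x => if x s = 0 then ∑' m : ℕ, f (x + Finsupp.single s m) else 0

variable {s : ι} {w d : ℕ}

lemma hasSum_of_eq {α : Type*} {f g : α → ℝ} {l : ℝ} (h : HasSum f l) (hfg : ∀ n, g n = f n) :
    HasSum g l := by rwa [funext hfg]

lemma exists_expansible_hasSum {f : (ι →₀ ℕ) → ℝ} (hf : f ∈ wordModule ι w d) :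
    ∃ a ∈ expansible (wordModule ι w d), ∀ x, ∀ y ∈ Set.Ioo (0 : ℝ) 1,
      HasSum (fun n => (if x s = 0 ∧ x.degree ≤ n then f (x + Finsupp.single s (n - x.degree))
        else 0) * y ^ n) (a y x) := by
  induction hf using Submodule.span_induction with
  | mem f hf =>
    obtain ⟨w₀, d₀, z, x₀, l, h1, h2, h3, rfl⟩ := hf
    have h4 := hat_evalWord_mem_expandingFamily (s := s) x₀ l
    refine ⟨_, expansible_mono (wordModule_mono h2 h3) (expansible_map (finiteRows_scaleReal _)
      (fun v hv => mul_mem_wordModule h1 hv) h4.2), fun x y hy => ?_⟩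
    have h5 := ((h4.1 x).summable (abs_lt_one_of_mem_Ioo hy)).hasSum.mul_left z
    refine hasSum_of_eq h5 fun n => ?_
    rw [coeff_hat]
    split_ifs
    · simp only [realCoeff, mul_assoc]
    · simp
  | zero => exact ⟨0, zero_mem _, fun x y _ => by simp⟩
  | add f g _ _ hf hg =>
    obtain ⟨a, ha, ha'⟩ := hf
    obtain ⟨b, hb, hb'⟩ := hg
    refine ⟨a + b, add_mem ha hb, fun x y hy => ?_⟩
    change HasSum _ (a y x + b y x)
    refine hasSum_of_eq ((ha' x y hy).add (hb' x y hy)) fun n => ?_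
    split_ifs
    · rw [Pi.add_apply, add_mul]
    · simp
  | smul r f _ hf =>
    obtain ⟨a, ha, ha'⟩ := hf
    refine ⟨r • a, Submodule.smul_mem _ r ha, fun x y hy => ?_⟩
    rw [Pi.smul_apply, Pi.smul_apply, Rat.smul_def]
    refine hasSum_of_eq ((ha' x y hy).mul_left (r : ℝ)) fun n => ?_
    split_ifs
    · rw [Pi.smul_apply, Rat.smul_def, mul_assoc]
    · simp

/-- By Abel's theorem the sum over the exponent of `X_s` is the limit at `Y = 1` of the homogenized
series. A limit of an expansible family stays in the same module, so neither weight nor depth grows.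
-/
lemma sumOver_mem_wordModule {f : (ι →₀ ℕ) → ℝ} (hf : f ∈ wordModule ι w d)
    (hs : ∀ x : ι →₀ ℕ, x s = 0 → Summable fun m => f (x + Finsupp.single s m)) :
    sumOver s f ∈ wordModule ι w d := by
  obtain ⟨a, ha, ha'⟩ := exists_expansible_hasSum (s := s) hf
  refine limit_mem_of_expansible ha fun x => ?_
  unfold sumOver
  split_ifs with hx
  · have h1 := Real.tendsto_tsum_powerSeries_nhdsWithin_lt (hs x hx).hasSum.tendsto_sum_nat
    -- The homogenized series at `x` starts at the exponent `|x|`, whence this factor.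
    have h2 : Tendsto (fun y : ℝ => y ^ x.degree) (𝓝[<] 1) (𝓝 1) := by
      have := ((continuous_pow x.degree).tendsto (1 : ℝ)).mono_left
        (nhdsWithin_le_nhds (s := Set.Iio 1))
      rwa [one_pow] at this
    have h3 := h2.mul h1
    rw [one_mul] at h3
    refine h3.congr' ?_
    filter_upwards [eventually_mem_Ioo] with y hy
    have h4 := (hasSum_nat_add_iff' x.degree).mpr (ha' x y hy)
    rw [Finset.sum_eq_zero, sub_zero] at h4
    · rw [← h4.tsum_eq, ← tsum_mul_left]
      refine tsum_congr fun n => ?_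
      rw [if_pos ⟨hx, by omega⟩, Nat.add_sub_cancel, pow_add]
      ring
    · intro n hn
      rw [Finset.mem_range] at hn
      rw [if_neg (by omega), zero_mul]
  · refine tendsto_const_nhds.congr' ?_
    filter_upwards [eventually_mem_Ioo] with y hy
    have h4 := ha' x y hy
    simp only [hx, false_and, if_false, zero_mul] at h4
    exact hasSum_zero.unique h4

/-- Splitting off one exponent. -/
noncomputable def splitExponent (s : ι) : {x : ι →₀ ℕ // x s = 0} × ℕ ≃ (ι →₀ ℕ) where
  toFun p := p.1.1 + Finsupp.single s p.2
  invFun x := (⟨x.erase s, Finsupp.erase_same⟩, x s)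
  left_inv p := by
    obtain ⟨⟨x, hx⟩, m⟩ := p
    refine Prod.ext (Subtype.ext ?_) ?_
    · ext t
      by_cases ht : t = s
      · subst ht; simp [hx]
      · simp [ht]
    · simp [hx]
  right_inv x := Finsupp.erase_add_single s x

lemma hasSum_sumOver {f : (ι →₀ ℕ) → ℝ} {z : ℝ} (hf : HasSum f z) : HasSum (sumOver s f) z := by
  have h1 := (splitExponent s).hasSum_iff.mpr hf
  have h2 := h1.prod_fiberwise fun x => (h1.summable.prod_factor x).hasSum
  refine (Function.Injective.hasSum_iff (Subtype.val_injective (p := fun x : ι →₀ ℕ => x s = 0))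
    (f := sumOver s f) ?_).mp ?_
  · intro x hx
    rw [sumOver, if_neg]
    intro h
    exact hx ⟨⟨x, h⟩, rfl⟩
  · convert h2 using 2 with x
    rw [Function.comp_apply, sumOver, if_pos x.2]
    rfl

/-! ### Processing the columns of the matrix -/

variable (A : Matrix ι (Fin w) ℤ) (c : Fin w → ℤ)

/-- The linear form of column `k` at a point with natural coordinates. -/
noncomputable def linForm (n : ι →₀ ℕ) (k : Fin w) : ℝ := ∑ i, (A i k : ℝ) * n i + c k

/-- The product of the inverses of the linear forms with index at least `j`. -/
noncomputable def residual (j : ℕ) (n : ι →₀ ℕ) : ℝ :=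
  ∏ k ∈ Finset.univ.filter fun k : Fin w => j ≤ k, (linForm A c n k)⁻¹

/-- The general term of the series after a partial summation; `S` is the set of variables that
occur in `f`. -/
noncomputable def partialTerm (f : (ι →₀ ℕ) → ℝ) (S : Finset ι) (j : ℕ) (n : ι →₀ ℕ) : ℝ :=
  f (n.filter (· ∈ S)) * if ∀ i ∉ S, 1 ≤ n i then residual A c j n else 0

/-- The series `z` is the sum of partial sums in `wordModule`, after the columns before `j` have been
processed, the rows in `S` have been met and the rows in `T` have been summed over. -/
def PartialSum (z : ℝ) (j : ℕ) (S T : Finset ι) : Prop :=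
  ∃ f ∈ wordModule ι j S.card, (∀ x, f x ≠ 0 → ∀ i, 1 ≤ x i ↔ i ∈ S ∧ i ∉ T) ∧
    HasSum (partialTerm A c f S j) z

variable {A c} {z : ℝ} {j : ℕ} {S T : Finset ι}

lemma convol_geomVar_apply {f : (ι →₀ ℕ) → ℝ} {i : ι} (hf : ∀ x, f x ≠ 0 → x i = 0)
    (x : ι →₀ ℕ) : convol (geomVar i) f x = f (x.erase i) := by
  have hrec : ∀ x, convol (geomVar i) f x = f x +
      if 1 ≤ x i then convol (geomVar i) f (x - Finsupp.single i 1) else 0 := by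
    intro x
    have h : convol (geomVar i - MvPowerSeries.X i * geomVar i) f = f := by
      rw [show geomVar i - MvPowerSeries.X i * geomVar i = 1 by
        linear_combination one_sub_X_mul_geomVar i, convol_one]
    rw [← convol_X, ← convol_mul]
    nth_rewrite 2 [← h]
    rw [convol_sub, Pi.sub_apply, sub_add_cancel]
  obtain ⟨n, hn⟩ : ∃ n, x i = n := ⟨_, rfl⟩
  induction n generalizing x with
  | zero =>
    rw [hrec, if_neg (by omega), add_zero, Finsupp.erase_of_notMem_support (by simpa using hn)]
  | succ n ih =>
    have h0 : f x = 0 := by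
      by_contra h
      have := hf x h
      omega
    rw [hrec, if_pos (by omega), h0, zero_add, ih _ (by simp [hn])]
    congr 1
    ext t
    by_cases ht : t = i
    · subst ht; simp
    · simp [ht]

/-- The new variable enters through `X_i / (1 - X_i) = 1 / (1 - X_i) - 1`, the indicator of `n_i ≥
1`; this is one multiplication, hence one unit of depth. -/
lemma PartialSum.start (h : PartialSum A c z j S T) {i : ι} (hi : i ∉ S) (hT : T ⊆ S) :
    PartialSum A c z j (insert i S) T := by
  obtain ⟨f, hf, hsupp, hsum⟩ := h
  have hfi : ∀ x, f x ≠ 0 → x i = 0 := by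
    intro x hx
    have := (hsupp x hx i).not.mpr (by tauto)
    omega
  have hval : ∀ x, convol (geomVar i - 1) f x = if 1 ≤ x i then f (x.erase i) else 0 := by
    intro x
    rw [convol_sub, convol_one, Pi.sub_apply, convol_geomVar_apply hfi]
    split_ifs with hx
    · have : f x = 0 := by
        by_contra h
        have := hfi x h
        omega
      rw [this, sub_zero]
    · rw [Finsupp.erase_of_notMem_support (by simp; omega), sub_self]
  refine ⟨convol (geomVar i - 1) f, ?_, fun x hx t => ?_, ?_⟩
  · rw [convol_sub, convol_one, Finset.card_insert_of_notMem hi]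
    refine sub_mem ?_ (wordModule_mono le_rfl (Nat.le_succ _) hf)
    simpa using convol_geomVar_pow_mem_wordModule i 1 hf
  · rw [hval] at hx
    split_ifs at hx with h1
    · have h2 := hsupp _ hx t
      have hiT : i ∉ T := fun h => hi (hT h)
      by_cases ht : t = i
      · subst ht; simp [h1, hiT]
      · rw [Finsupp.erase_ne ht] at h2
        simp [h2, ht]
    · exact absurd rfl hx
  · convert hsum using 1
    ext n
    have h1 : (n.filter (· ∈ insert i S)).erase i = n.filter (· ∈ S) := by
      ext t
      by_cases ht : t = i
      · subst ht; simp [hi]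
      · simp [ht, Finsupp.filter_apply]
    have h2 : (n.filter (· ∈ insert i S)) i = n i := by simp
    rw [partialTerm, partialTerm, hval, h1, h2]
    by_cases hn : 1 ≤ n i
    · rw [if_pos hn]
      congr 1
      refine if_congr ⟨fun h t ht => ?_, fun h t ht => h t fun h' => ht (by simp [h'])⟩ rfl rfl
      by_cases hti : t = i
      · rwa [hti]
      · exact h t (by simp [hti, ht])
    · rw [if_neg hn, zero_mul, if_neg fun h => hn (h i hi), mul_zero]

/-- On the support of `f` exactly the active coordinates are nonzero, so the form of the column is
the degree plus `c k`. -/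
lemma PartialSum.column {k : Fin w} (h : PartialSum A c z k S T)
    (hA : ∀ i, A i k = if i ∈ S ∧ i ∉ T then 1 else 0) : PartialSum A c z (k + 1) S T := by
  obtain ⟨f, hf, hsupp, hsum⟩ := h
  refine ⟨_, div_mem_wordModule (c k) hf, fun x hx => hsupp x (right_ne_zero_of_mul hx), ?_⟩
  convert hsum using 1
  ext n
  rw [partialTerm, partialTerm, scaleReal_apply]
  by_cases hy : f (n.filter (· ∈ S)) = 0
  · rw [hy]; simp
  have h1 : (((n.filter (· ∈ S)).degree : ℕ) : ℝ) + c k = linForm A c n k := by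
    rw [linForm, Finsupp.degree_eq_sum]
    push_cast
    congr 1
    refine Finset.sum_congr rfl fun i _ => ?_
    have h2 := hsupp _ hy i
    rw [hA, Finsupp.filter_apply] at *
    split_ifs with h3 h4 h4
    · simp
    · have : n i = 0 := by
        rw [if_pos h3] at h2
        by_contra h5
        exact h4 (h2.mp (by omega))
      simp [this]
    · exact absurd h4.1 h3
    · simp
  have h2 : residual A c k n = (linForm A c n k)⁻¹ * residual A c (k + 1) n := by
    rw [residual, residual]
    have : (Finset.univ.filter fun k' : Fin w => (k : ℕ) ≤ k') =
        insert k (Finset.univ.filter fun k' : Fin w => (k : ℕ) + 1 ≤ k') := by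
      ext k'
      simp only [Finset.mem_filter, Finset.mem_univ, true_and, Finset.mem_insert, Fin.ext_iff]
      omega
    rw [this, Finset.prod_insert (by simp)]
  rw [h1, h2]
  split_ifs
  · ring
  · simp

lemma linForm_add_single {i : ι} {k : Fin w} (hA : A i k = 0) (n : ι →₀ ℕ) (m : ℕ) :
    linForm A c (n + Finsupp.single i m) k = linForm A c n k := by
  unfold linForm
  congr 1
  refine Finset.sum_congr rfl fun t _ => ?_
  by_cases ht : t = i
  · subst ht; simp [hA]
  · simp [ht]

lemma residual_add_single {i : ι} (hA : ∀ k : Fin w, j ≤ k → A i k = 0) (n : ι →₀ ℕ) (m : ℕ) :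
    residual A c j (n + Finsupp.single i m) = residual A c j n := by
  refine Finset.prod_congr rfl fun k hk => ?_
  rw [linForm_add_single (hA k (by simpa using hk))]

/-- Coordinates equal to `0` do not enter the form, so they may be replaced by `1` to reach a
positive point. -/
lemma linForm_ne_zero (hc : ∀ (n : ι → ℕ+) (k : Fin w), ∑ i, A i k * (n i : ℤ) + c k ≠ 0)
    {n : ι →₀ ℕ} {k : Fin w} (hn : ∀ i, n i = 0 → A i k = 0) : linForm A c n k ≠ 0 := by
  have h1 := hc (fun i => ⟨max (n i) 1, by omega⟩) k
  have h2 : linForm A c n k =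
      ((∑ i, A i k * (((⟨max (n i) 1, by omega⟩ : ℕ+) : ℕ) : ℤ) + c k : ℤ) : ℝ) := by
    unfold linForm
    push_cast
    congr 1
    refine Finset.sum_congr rfl fun i _ => ?_
    rcases Nat.eq_zero_or_pos (n i) with h | h
    · simp [hn i h]
    · have h' : (1 : ℝ) ≤ n i := by exact_mod_cast h
      simp [h']
  rw [h2]
  exact_mod_cast h1

lemma filter_add_single {i : ι} (hi : i ∈ S) (n : ι →₀ ℕ) (m : ℕ) :
    (n + Finsupp.single i m).filter (· ∈ S) = n.filter (· ∈ S) + Finsupp.single i m := by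
  rw [Finsupp.filter_add, Finsupp.filter_single_of_pos (· ∈ S) hi]

lemma partialTerm_add_single {i : ι} (hi : i ∈ S) (hA : ∀ k : Fin w, j ≤ k → A i k = 0)
    (f : (ι →₀ ℕ) → ℝ) (n : ι →₀ ℕ) (m : ℕ) :
    partialTerm A c f S j (n + Finsupp.single i m) =
      f (n.filter (· ∈ S) + Finsupp.single i m) *
        if ∀ i ∉ S, 1 ≤ n i then residual A c j n else 0 := by
  rw [partialTerm, filter_add_single hi, residual_add_single hA]
  congr 1
  refine if_congr (forall₂_congr fun t ht => ?_) rfl rfl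
  have : t ≠ i := fun h => ht (h ▸ hi)
  simp [this]

/-- The remaining columns do not involve row `i`, so the residual product is constant in `n_i` and
the summation acts on `f` alone. -/
lemma PartialSum.finish (h : PartialSum A c z j S T)
    (hc : ∀ (n : ι → ℕ+) (k : Fin w), ∑ i, A i k * (n i : ℤ) + c k ≠ 0)
    (hT : ∀ i ∈ T, ∀ k : Fin w, j ≤ k → A i k = 0) {i : ι} (hi : i ∈ S)
    (hA : ∀ k : Fin w, j ≤ k → A i k = 0) : PartialSum A c z j S (insert i T) := by
  obtain ⟨f, hf, hsupp, hsum⟩ := h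
  refine ⟨sumOver i f, sumOver_mem_wordModule hf fun x hx => ?_, fun x hx t => ?_, ?_⟩
  · by_cases hex : ∃ m, f (x + Finsupp.single i m) ≠ 0
    · obtain ⟨m, hm⟩ := hex
      have hx' : ∀ t, t ≠ i → (1 ≤ x t ↔ t ∈ S ∧ t ∉ T) := by
        intro t ht
        have := hsupp _ hm t
        simpa [ht] using this
      -- Rows not yet met are given the value `1`. The residual product is then nonzero, and the sum
      -- over `m` is, up to this factor, a subfamily of a summable family.
      let n : ι →₀ ℕ := Finsupp.equivFunOnFinite.symm fun t => if t ∈ S then x t else 1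
      have hn : ∀ t, n t = if t ∈ S then x t else 1 := fun t => rfl
      have hnx : n.filter (· ∈ S) = x := by
        ext t
        rw [Finsupp.filter_apply, hn]
        by_cases ht : t ∈ S
        · simp [ht]
        · rw [if_neg ht]
          have := (hx' t fun h => ht (h ▸ hi)).not.mpr (by tauto)
          omega
      have hres : residual A c j n ≠ 0 := by
        refine Finset.prod_ne_zero_iff.mpr fun k hk => inv_ne_zero (linForm_ne_zero hc fun t ht => ?_)
        have hk' : j ≤ k := by simpa using hk
        rw [hn] at ht
        by_cases hti : t = i
        · rw [hti]; exact hA k hk'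
        · by_cases htS : t ∈ S
          · rw [if_pos htS] at ht
            have := (hx' t hti).not.mp (by omega)
            exact hT t (by tauto) k hk'
          · rw [if_neg htS] at ht; omega
      have hinj : Function.Injective fun m : ℕ => n + Finsupp.single i m := by
        intro a b hab
        exact Finsupp.single_injective i (add_left_cancel hab)
      have h1 := (hsum.summable.comp_injective hinj).mul_right (residual A c j n)⁻¹
      refine h1.congr fun m => ?_
      rw [Function.comp_apply, partialTerm_add_single hi hA, hnx, if_pos, mul_inv_cancel_right₀ hres]
      intro t ht
      rw [hn, if_neg ht]
    · push Not at hex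
      simp [hex]
  · unfold sumOver at hx
    split_ifs at hx with h1
    · obtain ⟨m, hm⟩ : ∃ m, f (x + Finsupp.single i m) ≠ 0 := by
        by_contra! h
        exact hx (by simp [h])
      by_cases ht : t = i
      · subst ht; simp [h1]
      · have := hsupp _ hm t
        simpa [ht] using this
    · exact absurd rfl hx
  · convert hasSum_sumOver (s := i) hsum using 1
    ext n
    rw [partialTerm, sumOver, sumOver, Finsupp.filter_apply_pos (· ∈ S) n hi]
    split_ifs with h1 h2 h2
    · rw [← tsum_mul_right]
      refine tsum_congr fun m => ?_
      rw [partialTerm_add_single hi hA, if_pos h2]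
    · simp [partialTerm_add_single hi hA, h2]
    · rw [zero_mul]
    · rw [zero_mul]

lemma PartialSum.start_all (h : PartialSum A c z j S T) (hT : T ⊆ S) (U : Finset ι) :
    PartialSum A c z j (S ∪ U) T := by
  induction U using Finset.induction_on with
  | empty => simpa using h
  | insert i U hi ih =>
    rw [Finset.union_insert]
    by_cases h1 : i ∈ S ∪ U
    · rwa [Finset.insert_eq_of_mem h1]
    · exact ih.start h1 (hT.trans Finset.subset_union_left)

lemma PartialSum.finish_all (h : PartialSum A c z j S T)
    (hc : ∀ (n : ι → ℕ+) (k : Fin w), ∑ i, A i k * (n i : ℤ) + c k ≠ 0)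
    (hT : ∀ i ∈ T, ∀ k : Fin w, j ≤ k → A i k = 0) {U : Finset ι} (hU : U ⊆ S)
    (hA : ∀ i ∈ U, ∀ k : Fin w, j ≤ k → A i k = 0) : PartialSum A c z j S (T ∪ U) := by
  induction U using Finset.induction_on with
  | empty => simpa using h
  | insert i U hi ih =>
    rw [Finset.union_insert]
    refine (ih (fun t ht => hU (Finset.mem_insert_of_mem ht))
      fun t ht => hA t (Finset.mem_insert_of_mem ht)).finish hc (fun t ht => ?_)
      (hU (Finset.mem_insert_self i U)) (hA i (Finset.mem_insert_self i U))
    rcases Finset.mem_union.mp ht with ht | ht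
    · exact hT t ht
    · exact hA t (Finset.mem_insert_of_mem ht)

/-- The inclusion of the points with positive integer coordinates. -/
noncomputable def positivePoint (n : ι → ℕ+) : ι →₀ ℕ :=
  Finsupp.equivFunOnFinite.symm fun i => n i

lemma positivePoint_apply (n : ι → ℕ+) (i : ι) : positivePoint n i = n i := rfl

lemma positivePoint_injective : Function.Injective (positivePoint (ι := ι)) := by
  intro m n h
  exact funext fun i => PNat.coe_injective (DFunLike.congr_fun h i)

lemma partialSum_zero
    (h : HasSum (fun n : ι → ℕ+ => 1 / ∏ k, ((∑ i, A i k * (n i : ℤ) + c k : ℤ) : ℝ)) z) :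
    PartialSum A c z 0 ∅ ∅ := by
  have hf : realCoeff (evalWord (0 : ι →₀ ℕ) []) ∈ wordModule ι 0 0 := by
    have := mul_evalWord_mem_wordModule (w := 0) (d := 0) (one_mem_multiZetaSpan 0 0)
      (0 : ι →₀ ℕ) [] le_rfl le_rfl
    simpa only [one_mul] using this
  refine ⟨_, hf, fun x hx i => ?_, ?_⟩
  · rw [evalWord, realCoeff_monomial] at hx
    have : x = 0 := by
      by_contra h
      exact hx (if_neg h)
    simp [this]
  · refine (positivePoint_injective.hasSum_iff ?_).mp ?_
    · intro n hn
      rw [partialTerm, if_neg, mul_zero]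
      intro h
      refine hn ⟨fun i => ⟨n i, h i (Finset.notMem_empty i)⟩, ?_⟩
      ext i
      rfl
    · convert h using 1
      ext n
      have h1 : ∀ i ∉ (∅ : Finset ι), 1 ≤ positivePoint n i := fun i _ => (n i).pos
      rw [Function.comp_apply, partialTerm, if_pos h1, evalWord,
        realCoeff_monomial, if_pos, one_mul, residual, one_div, ← Finset.prod_inv_distrib]
      · simp [linForm, positivePoint_apply]
      · ext i; simp

lemma mem_multiZetaSpan_of_partialSum (h : PartialSum A c z w Finset.univ Finset.univ) :
    z ∈ multiZetaSpan w (Fintype.card ι) := by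
  obtain ⟨f, hf, hsupp, hsum⟩ := h
  -- All rows have been summed over, so `f` lives at the origin and `z` is its value there.
  have h0 : ∀ n, n ≠ 0 → f n = 0 := by
    intro n hn
    by_contra h
    refine hn (Finsupp.ext fun i => ?_)
    have := (hsupp n h i).not.mpr (by simp)
    rw [Finsupp.zero_apply]
    omega
  have h1 : ∀ n, partialTerm A c f Finset.univ w n = f n := by
    intro n
    have h2 : (Finset.univ.filter fun k : Fin w => w ≤ k) = ∅ := by
      ext k; simp
    rw [partialTerm, if_pos (by simp), residual, h2, Finset.prod_empty, mul_one]
    congr 1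
    ext i; simp
  simp only [funext h1] at hsum
  have h3 := hsum.unique (hasSum_single 0 fun n hn => h0 n hn)
  rw [h3]
  exact apply_mem_multiZetaSpan hf 0

theorem mem_multiZetaSpan_of_hasSum {a b : ι → Fin w} (hab : ∀ i, a i ≤ b i)
    (hA : ∀ i k, A i k = if a i ≤ k ∧ k ≤ b i then 1 else 0)
    (hc : ∀ (n : ι → ℕ+) (k : Fin w), ∑ i, A i k * (n i : ℤ) + c k ≠ 0)
    (h : HasSum (fun n : ι → ℕ+ => 1 / ∏ k, ((∑ i, A i k * (n i : ℤ) + c k : ℤ) : ℝ)) z) :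
    z ∈ multiZetaSpan w (Fintype.card ι) := by
  -- Here the ones in a row being consecutive matters: once the rows with `a i = j` are added, row
  -- `i` is active exactly when `a i ≤ j ≤ b i`, that is, when its entry in column `j` is `1`.
  have key : ∀ j ≤ w, PartialSum A c z j (Finset.univ.filter fun i => (a i : ℕ) < j)
      (Finset.univ.filter fun i => (b i : ℕ) < j) := by
    intro j
    induction j with
    | zero => intro _; simpa using partialSum_zero h
    | succ j ih =>
      intro hj
      let k : Fin w := ⟨j, hj⟩
      have hzero : ∀ (j : ℕ) (i : ι), (b i : ℕ) < j → ∀ k : Fin w, j ≤ k → A i k = 0 := by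
        intro j i hi k hk
        rw [hA, if_neg]
        rintro ⟨_, h2⟩
        have : (k : ℕ) ≤ b i := h2
        omega
      have h1 := (ih (by omega)).start_all (fun i hi => by
        have := Fin.le_def.mp (hab i)
        simp only [Finset.mem_filter, Finset.mem_univ, true_and] at hi ⊢
        omega) (Finset.univ.filter fun i => (a i : ℕ) = j)
      have h2 : (Finset.univ.filter fun i => (a i : ℕ) < j) ∪
          (Finset.univ.filter fun i => (a i : ℕ) = j) =
          Finset.univ.filter fun i => (a i : ℕ) < j + 1 := by
        ext i
        simp only [Finset.mem_union, Finset.mem_filter, Finset.mem_univ, true_and]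
        omega
      rw [h2] at h1
      have h3 := PartialSum.column (k := k) h1 fun i => by
        rw [hA]
        refine if_congr ?_ rfl rfl
        simp only [Fin.le_def, Finset.mem_filter, Finset.mem_univ, true_and, k]
        omega
      have h4 := h3.finish_all (U := Finset.univ.filter fun i => (b i : ℕ) = j) hc
        (fun i hi => hzero _ i (by simp at hi; simp [k]; omega)) (fun i hi => by
          have := Fin.le_def.mp (hab i)
          simp only [Finset.mem_filter, Finset.mem_univ, true_and] at hi ⊢
          omega) (fun i hi => hzero _ i (by simp at hi; simp [k]; omega))
      have h5 : (Finset.univ.filter fun i => (b i : ℕ) < j) ∪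
          (Finset.univ.filter fun i => (b i : ℕ) = j) =
          Finset.univ.filter fun i => (b i : ℕ) < j + 1 := by
        ext i
        simp only [Finset.mem_union, Finset.mem_filter, Finset.mem_univ, true_and]
        omega
      rwa [h5] at h4
  have h1 := key w le_rfl
  simp only [Fin.is_lt, Finset.filter_true] at h1
  exact mem_multiZetaSpan_of_partialSum h1

end BigZeta

theorem theorem3p3 {d w : ℕ} (A : Matrix (Fin d) (Fin w) ℤ) (hA : IsQuasiBasic A)
    (c : Fin w → ℤ) (hc : ∀ (n : Fin d → ℕ+) (j : Fin w), columnForm A c n j ≠ 0)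
    (hconv : Summable (bigZetaTerm A c)) :
    bigZeta A c ∈ multiZetaSpan w d := by
  choose a b hab hrow using hA.rows
  have h := BigZeta.mem_multiZetaSpan_of_hasSum hab hrow hc hconv.hasSum
  rwa [Fintype.card_fin] at h
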